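/- For $(\chi,\tau)\in\mathbb{R}^2$ let $\vartheta(z;\chi,\tau)=\chi z+\tau z^2-2z^{-1}$. For $\chi>-(54\tau^2)^{1/3}$ this function of $z$ has a unique critical point $\xi=\xi(\chi,\tau)$ with $\mathrm{Im}\,\xi>0$, and for each $\tau\in\mathbb{R}$ let $\chi_{\mathrm c}(\tau)$ be the unique $\chi>-(54\tau^2)^{1/3}$ such that $\mathrm{Re}(\mathrm{i}\vartheta(\xi;\chi,\tau))=-1$, equivalently $\mathrm{Im}\int_{\xi^*}^{\xi}\vartheta'(z;\chi,\tau)\,\mathrm{d}z=2$. For real $\lambda$ with $\tau^2\lambda\neq\chi$ let $$R(z)^2=z^4+\tau\lambda z^3+\left[\tfrac34\tau^2\lambda^2-\tfrac12\chi\lambda\right]z^2+\frac{16\tau}{(\tau^2\lambda-\chi)^3}z+\frac{4}{(\tau^2\lambda-\chi)^2}.$$ Whenever this quartic has four distinct non-real roots, denote them $\alpha,\beta,\alpha^*,\beta^*$ with $\mathrm{Im}\,\alpha,\mathrm{Im}\,\beta>0$, $\mathrm{Re}\,\alpha\le\mathrm{Re}\,\beta$, and $\mathrm{Im}\,\alpha>\mathrm{Im}\,\beta$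 if $\mathrm{Re}\,\alpha=\mathrm{Re}\,\beta$. Let $R(z)$ be the branch of the square root that is analytic off the segment joining $\alpha$ to $\beta$ and its complex conjugate, with $R(z)=z^2+O(z)$ as $z\to\infty$, and set $$f(\lambda;\chi,\tau)=-\mathrm{i}\left(\int_{\alpha^*}^{\alpha}\frac{2\tau z+\chi-\tau^2\lambda}{z^2}R(z)\,\mathrm{d}z-2\mathrm{i}\right),$$ where the path is symmetric under complex conjugation and avoids the origin and (except at its endpoints) the branch cuts; concretely, take the polygonal path $\alpha^*\to p\to\alpha$ with $p=\min(\mathrm{Re}\,\alpha,0)-1$. (The value does not depend on the choice of such a path.) Let $\mathscr{D}_2^{\pm}(\chi,\tau,\lambda)=(\chi-\tau^2\lambda)^2\lambda\pm8$ and $\mathscr{D}_1(\chi,\tau,\lambda)=27(\tau^2\lambda-\chi)^5\tau^2\lambda+9\chi^2(\tau^2\lambda-\chi)^4+\chi^3(\tau^2\lambda-\chi)^3-864\tau^4$, and let $\chi_0(\tau)=(54\tau^2)^{1/3}$. For $\chi>\chi_{\mathrm c}(\tau)$, let $\lambda_1(\chi,\tau)$ be the only real root $\lambda$ of $\mathscr{D}_2^+$,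 let $\lambda_2(\chi,\tau)$ be the least real root of $\mathscr{D}_2^-$ (used for $\chi\ge\chi_0(\tau)$), and let $\lambda_3(\chi,\tau)$ be the lesser of the two real roots of $\mathscr{D}_1$ (used for $\chi<\chi_0(\tau)$, so that $\tau\ne0$). Let $R_{12}$ be the set of $(\chi,\tau,\lambda)$ with $\chi>\chi_{\mathrm c}(\tau)$ and $\lambda_1(\chi,\tau)<\lambda<\lambda_2(\chi,\tau)$ if $\chi\ge\chi_0(\tau)$, respectively $\lambda_1(\chi,\tau)<\lambda<\lambda_3(\chi,\tau)$ if $\chi<\chi_0(\tau)$. **Proposition.** For every $(\chi,\tau,\lambda)\in R_{12}$ the quartic $R(z)^2$ has four distinct non-real roots. For all real $\tau$ and $\chi>\chi_{\mathrm c}(\tau)$ there is exactly one $\lambda=\lambda(\chi,\tau)$ with $(\chi,\tau,\lambda)\in R_{12}$ and $f(\lambda;\chi,\tau)=0$, and the function $(\chi,\tau)\mapsto\lambda(\chi,\tau)$ is real-analytic on the open set $\{(\chi,\tau)\in\mathbb{R}^2:\chi>\chi_{\mathrm c}(\tau)\}$. -/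

import Mathlib

noncomputable section

namespace SpectralCurve

open Complex ComplexConjugate

/-! ### The phase and the critical curve `χ = χ_c(τ)` -/

/-- The phase `ϑ(z; χ, τ) = χ z + τ z² - 2 z⁻¹`. -/
def vartheta (χ τ : ℝ) (z : ℂ) : ℂ := χ * z + τ * z ^ 2 - 2 * z⁻¹

/-- `χ > -(54 τ²)^{1/3}`, and the critical point `ξ` of `ϑ( · ; χ, τ)` in the open upper half-plane
satisfies `Re (i ϑ(ξ; χ, τ)) = -1`. -/
def IsCritical (τ χ : ℝ) : Prop :=
  -(54 * τ ^ 2) ^ ((1 : ℝ) / 3) < χ ∧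
    ∃ ξ : ℂ, 0 < ξ.im ∧ deriv (vartheta χ τ) ξ = 0 ∧ (I * vartheta χ τ ξ).re = -1

theorem deriv_vartheta (χ τ : ℝ) {z : ℂ} (hz : z ≠ 0) :
    deriv (vartheta χ τ) z = χ + 2 * τ * z + 2 / z ^ 2 := by
  have h : HasDerivAt (vartheta χ τ)
      ((χ : ℂ) * 1 + τ * ((2 : ℕ) * z ^ (2 - 1) * 1) - 2 * (-(z ^ 2)⁻¹)) z :=
    (((hasDerivAt_id' z).const_mul (χ : ℂ)).add
      (((hasDerivAt_id' z).pow 2).const_mul (τ : ℂ))).sub ((hasDerivAt_inv hz).const_mul 2)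
  rw [h.deriv]
  push_cast
  field_simp
  ring

/-- The conditions on the critical point, in terms of its real and imaginary parts. -/
theorem critical_iff (χ τ u v : ℝ) (hv : 0 < v) :
    (deriv (vartheta χ τ) ⟨u, v⟩ = 0 ∧ (I * vartheta χ τ ⟨u, v⟩).re = -1) ↔
      (τ * (u ^ 2 + v ^ 2) ^ 2 = 2 * u ∧ χ * (u ^ 2 + v ^ 2) ^ 2 = 2 * v ^ 2 - 6 * u ^ 2 ∧
        4 * v ^ 3 = (u ^ 2 + v ^ 2) ^ 2) := by
  have hz : (⟨u, v⟩ : ℂ) ≠ 0 := fun h => hv.ne' (congrArg Complex.im h)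
  have hr : 0 < u ^ 2 + v ^ 2 := by positivity
  have h1 : deriv (vartheta χ τ) ⟨u, v⟩ = 0 ↔
      (χ * (u ^ 2 - v ^ 2) + 2 * τ * (u ^ 3 - 3 * u * v ^ 2) + 2 = 0 ∧
        χ * u + τ * (3 * u ^ 2 - v ^ 2) = 0) := by
    rw [deriv_vartheta χ τ hz]
    have e : (χ : ℂ) + 2 * τ * ⟨u, v⟩ + 2 / (⟨u, v⟩ : ℂ) ^ 2 =
        (χ * (⟨u, v⟩ : ℂ) ^ 2 + 2 * τ * (⟨u, v⟩ : ℂ) ^ 3 + 2) / (⟨u, v⟩ : ℂ) ^ 2 := by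
      field_simp
    rw [e, div_eq_zero_iff, or_iff_left (pow_ne_zero 2 hz), Complex.ext_iff]
    simp only [pow_succ, pow_zero, one_mul, Complex.add_re, Complex.mul_re, Complex.ofReal_re,
      Complex.ofReal_im, Complex.add_im, Complex.mul_im, Complex.re_ofNat, Complex.im_ofNat,
      Complex.zero_re, Complex.zero_im]
    constructor
    · rintro ⟨h, h'⟩
      refine ⟨by linarith, ?_⟩
      have : 2 * v * (χ * u + τ * (3 * u ^ 2 - v ^ 2)) = 0 := by linarith
      have := (mul_eq_zero.mp this).resolve_left (by positivity)
      linarith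
    · rintro ⟨h, h'⟩
      refine ⟨by linarith, ?_⟩
      linear_combination 2 * v * h'
  have h2 : (I * vartheta χ τ ⟨u, v⟩).re = -1 ↔
      v * (χ + 2 * τ * u + 2 / (u ^ 2 + v ^ 2)) = 1 := by
    have e : (I * vartheta χ τ ⟨u, v⟩).re = -(v * (χ + 2 * τ * u + 2 / (u ^ 2 + v ^ 2))) := by
      simp only [vartheta, pow_succ, pow_zero, one_mul, Complex.mul_re, Complex.I_re,
        Complex.I_im, Complex.sub_im, Complex.add_im, Complex.mul_im, Complex.ofReal_re,
        Complex.ofReal_im, Complex.inv_im, Complex.inv_re, Complex.re_ofNat, Complex.im_ofNat,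
        Complex.normSq_apply]
      ring
    rw [e, neg_inj]
  rw [h1, h2]
  constructor
  · rintro ⟨⟨ha, hb⟩, hc⟩
    have ht : τ * (u ^ 2 + v ^ 2) ^ 2 = 2 * u := by
      linear_combination (u ^ 2 - v ^ 2) * hb - u * ha
    have hx : χ * (u ^ 2 + v ^ 2) ^ 2 = 2 * v ^ 2 - 6 * u ^ 2 := by
      linear_combination (3 * u ^ 2 - v ^ 2) * ha - 2 * u * (u ^ 2 - 3 * v ^ 2) * hb
    refine ⟨ht, hx, ?_⟩
    field_simp at hc
    linear_combination (u ^ 2 + v ^ 2) * hc - v * hx - 2 * u * v * ht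
  · rintro ⟨ht, hx, hk⟩
    have hr2 : (u ^ 2 + v ^ 2) ^ 2 ≠ 0 := by positivity
    refine ⟨⟨?_, ?_⟩, ?_⟩
    · apply mul_right_cancel₀ hr2
      linear_combination (u ^ 2 - v ^ 2) * hx + 2 * (u ^ 3 - 3 * u * v ^ 2) * ht
    · apply mul_right_cancel₀ hr2
      linear_combination u * hx + (3 * u ^ 2 - v ^ 2) * ht
    · field_simp
      apply mul_right_cancel₀ hr.ne'
      linear_combination v * hx + 2 * u * v * ht + hk

/-- For every `τ` there is exactly one critical value of `χ`. -/
theorem existsUnique_isCritical (τ : ℝ) : ∃! χ : ℝ, IsCritical τ χ := by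
  obtain ⟨w, ⟨hw0, hw2⟩, hw⟩ : ∃ w ∈ Set.Icc (0 : ℝ) 2, 4 * τ ^ 2 * w ^ 9 + w = 2 := by
    have hc : ContinuousOn (fun w : ℝ => 4 * τ ^ 2 * w ^ 9 + w) (Set.Icc 0 2) := by fun_prop
    exact intermediate_value_Icc (by norm_num) hc ⟨by norm_num, by nlinarith [sq_nonneg τ]⟩
  have hwpos : 0 < w := by
    rcases hw0.lt_or_eq with h | h
    · exact h
    · rw [← h] at hw
      norm_num at hw
  have hxw : (2 * w - 3) / w ^ 3 * w ^ 3 = 2 * w - 3 := by field_simp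
  refine ⟨(2 * w - 3) / w ^ 3, ⟨?_, ⟨2 * τ * w ^ 6, w ^ 2⟩, by simpa using by positivity, ?_⟩, ?_⟩
  · have hT : 0 ≤ (54 * τ ^ 2) ^ ((1 : ℝ) / 3) := by positivity
    have hT3 : ((54 * τ ^ 2) ^ ((1 : ℝ) / 3)) ^ 3 = 54 * τ ^ 2 := by
      rw [← Real.rpow_natCast, ← Real.rpow_mul (by positivity)]
      norm_num
    set c := (54 * τ ^ 2) ^ ((1 : ℝ) / 3)
    rw [← sub_pos, sub_neg_eq_add]
    by_contra hcon
    push Not at hcon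
    have h3 : ((2 * w - 3) / w ^ 3) ^ 3 ≤ (-c) ^ 3 :=
      (Odd.pow_le_pow (by decide)).2 (by linarith)
    have h4 : ((2 * w - 3) / w ^ 3) ^ 3 * w ^ 9 ≤ (-c) ^ 3 * w ^ 9 :=
      mul_le_mul_of_nonneg_right h3 (by positivity)
    have h5 : ((2 * w - 3) / w ^ 3) ^ 3 * w ^ 9 = (2 * w - 3) ^ 3 := by field_simp
    have h6 : (-c) ^ 3 * w ^ 9 = -(27 / 2) * (2 - w) := by
      linear_combination -w ^ 9 * hT3 - 27 / 2 * hw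
    rw [h5, h6] at h4
    have h7 : 0 < w * (9 - 4 * w) ^ 2 := mul_pos hwpos (by nlinarith)
    nlinarith
  · rw [critical_iff _ _ _ _ (by positivity)]
    have hr : (2 * τ * w ^ 6) ^ 2 + (w ^ 2) ^ 2 = 2 * w ^ 3 := by
      linear_combination w ^ 3 * hw
    rw [hr]
    refine ⟨by ring, ?_, by ring⟩
    linear_combination 4 * w ^ 3 * hxw + 6 * w ^ 3 * hw
  · rintro χ ⟨-, ⟨u, v⟩, hv, h⟩
    have hv : 0 < v := hv
    rw [critical_iff _ _ _ _ hv] at h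
    obtain ⟨ht, hx, hk⟩ := h
    obtain ⟨y, hy, rfl⟩ : ∃ y : ℝ, 0 < y ∧ v = y ^ 2 :=
      ⟨√v, Real.sqrt_pos.2 hv, (Real.sq_sqrt hv.le).symm⟩
    have hr : u ^ 2 + (y ^ 2) ^ 2 = 2 * y ^ 3 := by
      have : (u ^ 2 + (y ^ 2) ^ 2) ^ 2 = (2 * y ^ 3) ^ 2 := by
        rw [← hk]
        ring
      exact (pow_left_inj₀ (by positivity) (by positivity) two_ne_zero).1 this
    rw [hr] at ht hx
    have hu : u = 2 * τ * y ^ 6 := by linear_combination -ht / 2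
    have hy9 : 4 * τ ^ 2 * y ^ 9 + y = 2 := by
      apply mul_left_cancel₀ (pow_pos hy 3).ne'
      rw [hu] at hr
      linear_combination hr
    have hyw : y = w := by
      rcases lt_trichotomy y w with h | h | h
      · have := mul_le_mul_of_nonneg_left (pow_le_pow_left₀ hy.le h.le 9)
          (by positivity : 0 ≤ 4 * τ ^ 2)
        linarith
      · exact h
      · have := mul_le_mul_of_nonneg_left (pow_le_pow_left₀ hwpos.le h.le 9)
          (by positivity : 0 ≤ 4 * τ ^ 2)
        linarith
    subst hyw
    rw [eq_div_iff (by positivity)]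
    apply mul_left_cancel₀ (pow_pos hy 3).ne'
    linear_combination hx / 4 - 3 / 2 * hr

/-- The critical curve `χ_c(τ)`: the unique critical value of `χ`. -/
def chiC (τ : ℝ) : ℝ := (existsUnique_isCritical τ).choose

/-! ### The spectral curve -/

/-- The real quartic polynomial `R(z)²`. -/
def Rsq (χ τ lam : ℝ) (z : ℂ) : ℂ :=
  z ^ 4 + τ * lam * z ^ 3 + (3 / 4 * τ ^ 2 * lam ^ 2 - 1 / 2 * χ * lam) * z ^ 2
    + 16 * τ / (τ ^ 2 * lam - χ) ^ 3 * z + 4 / (τ ^ 2 * lam - χ) ^ 2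

/-- `R(z)²` has four distinct non-real roots `α, β, α*, β*`, labelled so that `α, β` lie in the
upper half-plane, `Re α ≤ Re β`, and `Im α > Im β` in case `Re α = Re β`. This determines the pair
`(α, β)`. -/
def IsQuartet (χ τ lam : ℝ) (α β : ℂ) : Prop :=
  Rsq χ τ lam α = 0 ∧ Rsq χ τ lam β = 0 ∧ 0 < α.im ∧ 0 < β.im ∧
    α.re ≤ β.re ∧ (α.re = β.re → β.im < α.im)

open Classical in
/-- The pair `(α, β)` of labelled roots of `R(z)²`, if there is one (and `(0, 0)` otherwise). -/
def roots (χ τ lam : ℝ) : ℂ × ℂ :=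
  if h : ∃ p : ℂ × ℂ, IsQuartet χ τ lam p.1 p.2 then h.choose else 0

/-- The branch of `((z - α)(z - β))^{1/2}` that is analytic off the segment from `α` to `β` and
asymptotic to `z` at infinity: with `m` the midpoint of the segment, it is
`(z - m) (1 - ((β - α) / 2)² / (z - m)²)^{1/2}` with the principal square root. -/
def rootFactor (α β z : ℂ) : ℂ :=
  (z - (α + β) / 2) * (1 - ((β - α) / 2 / (z - (α + β) / 2)) ^ 2) ^ ((1 : ℂ) / 2)

/-- The branch `R(z) = z² + O(z)`, `z → ∞`, of the square root of
`(z - α)(z - β)(z - α*)(z - β*)` that is analytic off the segment from `α` to `β` and its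
reflection in the real axis. -/
def R (α β z : ℂ) : ℂ := rootFactor α β z * conj (rootFactor α β (conj z))

/-- `h'(z) = (2 τ z + χ - τ² λ) z⁻² R(z)`. -/
def hPrime (χ τ lam : ℝ) (z : ℂ) : ℂ :=
  (2 * τ * z + χ - τ ^ 2 * lam) / z ^ 2 * R (roots χ τ lam).1 (roots χ τ lam).2 z

/-- The integral of `g` along the straight segment from `a` to `b`. -/
def segmentIntegral (g : ℂ → ℂ) (a b : ℂ) : ℂ :=
  ∫ t in (0 : ℝ)..1, g (a + t * (b - a)) * (b - a)

/-- The integral of `h'` from `α*` to `α` along a Schwarz-symmetric path, namely the polygonal path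
`α* → p → α` through the negative real point `p = min (Re α) 0 - 1`. By the labelling of the roots
it lies to the left of the branch cuts (which it meets only at its endpoints) and it avoids the
origin. -/
def periodIntegral (χ τ lam : ℝ) : ℂ :=
  let α := (roots χ τ lam).1
  let p : ℝ := min α.re 0 - 1
  segmentIntegral (hPrime χ τ lam) (conj α) p + segmentIntegral (hPrime χ τ lam) p α

/-- The function `f(λ; χ, τ)`, whose vanishing is the integral condition
`∫_{α*}^{α} h'(z) dz = 2 i`. -/
def f (lam χ τ : ℝ) : ℂ := -I * (periodIntegral χ τ lam - 2 * I)

/-! ### The factors of the discriminant of `R(z)²` and the region `R₁₂` -/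

/-- The factor `𝒟₂⁺ = (χ - τ² λ)² λ + 8`. -/
def D2plus (χ τ lam : ℝ) : ℝ := (χ - τ ^ 2 * lam) ^ 2 * lam + 8

/-- The factor `𝒟₂⁻ = (χ - τ² λ)² λ - 8`. -/
def D2minus (χ τ lam : ℝ) : ℝ := (χ - τ ^ 2 * lam) ^ 2 * lam - 8

/-- The factor `𝒟₁`. -/
def D1 (χ τ lam : ℝ) : ℝ :=
  27 * (τ ^ 2 * lam - χ) ^ 5 * τ ^ 2 * lam + 9 * χ ^ 2 * (τ ^ 2 * lam - χ) ^ 4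
    + χ ^ 3 * (τ ^ 2 * lam - χ) ^ 3 - 864 * τ ^ 4

/-- `λ₁(χ, τ)`: the (only) real root of `𝒟₂⁺`. -/
def lambda1 (χ τ : ℝ) : ℝ := sInf {lam : ℝ | D2plus χ τ lam = 0}

/-- `λ₂(χ, τ)`: the least real root of `𝒟₂⁻` (used for `χ ≥ χ₀(τ)`). -/
def lambda2 (χ τ : ℝ) : ℝ := sInf {lam : ℝ | D2minus χ τ lam = 0}

/-- `λ₃(χ, τ)`: the lesser of the two real roots of `𝒟₁` (used for `τ ≠ 0`). -/
def lambda3 (χ τ : ℝ) : ℝ := sInf {lam : ℝ | D1 χ τ lam = 0}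

/-- `χ₀(τ) = (54 τ²)^{1/3}`. -/
def chi0 (τ : ℝ) : ℝ := (54 * τ ^ 2) ^ ((1 : ℝ) / 3)

/-- The region `R₁₂` of triples `(χ, τ, λ)`: `λ₁ < λ < λ₂` if `χ > χ_c(τ)` and `χ ≥ χ₀(τ)`, and
`λ₁ < λ < λ₃` if `χ_c(τ) < χ < χ₀(τ)` (the second case is void when `χ₀(τ) ≤ χ_c(τ)`). -/
def R12 : Set (ℝ × ℝ × ℝ) :=
  {q | chiC q.2.1 < q.1 ∧ lambda1 q.1 q.2.1 < q.2.2 ∧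
    q.2.2 < if chi0 q.2.1 ≤ q.1 then lambda2 q.1 q.2.1 else lambda3 q.1 q.2.1}

end SpectralCurve

end

noncomputable section

namespace SpectralCurve

open Complex ComplexConjugate

/-! Write s = τ²λ - χ. The coefficients of R² are such that h'(z) = (2τz - s) z⁻² R(z) has no
residue at 0 or at ∞. Hence h' = ∂_z(sR/z) + N/R with a polynomial N (`numer`). Since R vanishes at
α and α*, only N/R contributes to the period. Its integral can be moved to the vertical segment z =
Re α + i Im α sin θ, where dz cancels the singular factor of 1/R. This gives f = ∫ `vertical` dθ - 2
(`Admissible.f_eq`), a real number (`Admissible.f_im`).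

The region. A scaling reduces (χ, τ, λ) to two parameters m, w, and R₁₂ becomes a set of polynomial
inequalities (`mem_R12_iff_admissible`). Under them the quartic is positive on ℝ
(`normalized_quartic_pos`), and the two conjugate pairs of roots have different real parts
(`IsSplit.re_ne`). Thus α, β exist, are simple roots, and satisfy Re α < Re β.

Monotonicity. One has ∂_λ h' = κ/R with κ(χ, τ, λ) < 0 (`kappa_neg`). In the variable θ this becomes
∂_λ f = κ ∫ dθ / √((z - β)(z - β*)), and the principal root has positive real part. So f is strictly
decreasing in λ (`Admissible.hasDerivAt_f`).

Signs at the ends. As λ ↓ λ₁ the roots α and β merge at a non-real critical point ξ of ϑ, and h'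
tends to ϑ'. Therefore f → 2(Im ϑ(ξ) - 1), which is positive because χ > χ_c (`exists_f_re_pos`). At
the upper end α or β becomes real while Re α < Re β persists. There the integral vanishes, so f → -2
(`exists_f_re_neg`). The intermediate value theorem and monotonicity give exactly one zero.

Analyticity. Simple roots depend analytically on the parameters, and so does the integrand as an
element of the Banach algebra C([-π/2, π/2], ℂ). Hence f is analytic (`Admissible.contDiffAt_f`),
and since ∂_λ f ≠ 0 the implicit function theorem applies to its zero. -/

/-! ### Positivity of the quartic on the real axis -/

/-- The normalised quartic has no real zeros, provided that `m < 1`, `|w| < 1` and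
`1 - 2 m⁶ w > 3 m⁴`. -/
theorem normalized_quartic_pos {m w : ℝ} (hm : m ^ 2 < 1) (hw : w < 1)
    (h : 3 * m ^ 4 < 1 - 2 * m ^ 6 * w) (x : ℝ) :
    0 < (x ^ 2 + 2 * w * m ^ 3 * x) ^ 2 - 2 * w * x ^ 2 - 4 * m ^ 3 * x + 1 := by
  rcases eq_or_ne x 0 with rfl | hx
  · norm_num
  have hx2 : 0 < x ^ 2 := by positivity
  -- With k = m³ and Q_w for the quartic, Q_w = (x² + 2wkx - 1)² + 2(1 - w) x (x - 2k), which
  -- settles kx > 2k². Otherwise Q_w is compared with Q_v for some v > w, through Q_w - Q_v = 2(v -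
  -- w) x² (1 - 2kx - 2k²(w + v)).
  rcases lt_or_ge (2 * (m ^ 3) ^ 2) (m ^ 3 * x) with hk | hk
  · have h1 : 0 < x * (x - 2 * m ^ 3) := by
      rcases lt_trichotomy (m ^ 3) 0 with h0 | h0 | h0
      · have : x < 2 * m ^ 3 := by nlinarith
        nlinarith
      · rw [h0] at hk
        norm_num at hk
      · have : 2 * m ^ 3 < x := by nlinarith
        nlinarith
    nlinarith [sq_nonneg (x ^ 2 + 2 * w * m ^ 3 * x - 1)]
  -- For small m the comparison value is v = 1, where Q_1 = (x² + 2kx - 1)².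
  rcases lt_or_ge (m ^ 2) (1 / 2) with hm2 | hm2
  · have h6 : m ^ 6 < 1 / 8 := by
      have : (m ^ 2) ^ 3 < (1 / 2) ^ 3 := pow_lt_pow_left₀ hm2 (by positivity) (by norm_num)
      calc m ^ 6 = (m ^ 2) ^ 3 := by ring
        _ < 1 / 8 := by linarith
    have h7 : 0 < 1 - 2 * m ^ 3 * x - 2 * m ^ 6 * (1 + w) := by
      have : m ^ 6 * w ≤ m ^ 6 * 1 := mul_le_mul_of_nonneg_left hw.le (by positivity)
      nlinarith
    have h8 : 0 < 2 * (1 - w) * x ^ 2 * (1 - 2 * m ^ 3 * x - 2 * m ^ 6 * (1 + w)) := by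
      have : 0 < 1 - w := by linarith
      positivity
    nlinarith [sq_nonneg (x ^ 2 + 2 * m ^ 3 * x - 1)]
  · have hm0 : m ≠ 0 := by
      rintro rfl
      norm_num at hm2
    have hm6 : 0 < m ^ 6 := by positivity
    -- This v is the value of w at which 𝒟₁ vanishes. There the quartic has the double zero x = m,
    -- and the remaining quadratic factor is nonnegative.
    obtain ⟨v, hv⟩ : ∃ v, 2 * m ^ 6 * v = 1 - 3 * m ^ 4 :=
      ⟨(1 - 3 * m ^ 4) / (2 * m ^ 6), by field_simp⟩
    have hwv : w < v := by nlinarith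
    have h7 : 0 ≤ 6 * m ^ 4 - 1 - 2 * m ^ 3 * x := by
      have : 0 ≤ (2 * m ^ 2 - 1) * (1 + 2 * m ^ 2 * (1 - m ^ 2)) := by
        apply mul_nonneg <;> nlinarith
      nlinarith
    have h8 : 0 < 2 * (v - w) * x ^ 2 * (1 - 2 * m ^ 3 * x - 2 * m ^ 6 * (w + v)) := by
      have h9 : 0 < 1 - 2 * m ^ 3 * x - 2 * m ^ 6 * (w + v) := by nlinarith
      have : 0 < v - w := by linarith
      positivity
    have h10 : 0 ≤ (x ^ 2 + 2 * v * m ^ 3 * x) ^ 2 - 2 * v * x ^ 2 - 4 * m ^ 3 * x + 1 := by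
      have h11 : 0 ≤ (m * x) ^ 2 * m ^ 2 + (2 - 4 * m ^ 4) * (m * x) + m ^ 2 := by
        have : (m * x) ^ 2 * m ^ 2 + (2 - 4 * m ^ 4) * (m * x) + m ^ 2
          = m ^ 2 * ((m * x) + (1 - 2 * m ^ 4) / m ^ 2) ^ 2 +
            (2 * m ^ 2 - 1) * (1 + m ^ 2) * (1 - m ^ 2) * (2 * m ^ 2 + 1) / m ^ 2 := by
          field_simp
          ring
        rw [this]
        have h1 : 0 ≤ 2 * m ^ 2 - 1 := by linarith
        have h2 : 0 ≤ 1 - m ^ 2 := by linarith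
        positivity
      have h12 : m ^ 6 * ((x ^ 2 + 2 * v * m ^ 3 * x) ^ 2 - 2 * v * x ^ 2 - 4 * m ^ 3 * x + 1)
          = (x - m) ^ 2 * m ^ 2 *
            ((m * x) ^ 2 * m ^ 2 + (2 - 4 * m ^ 4) * (m * x) + m ^ 2) := by
        linear_combination (2 * m ^ 3 * x ^ 3 + x ^ 2 * (2 * m ^ 6 * v + 1 - 3 * m ^ 4)
          - x ^ 2) * hv
      have h13 : 0 ≤ (x - m) ^ 2 * m ^ 2 *
          ((m * x) ^ 2 * m ^ 2 + (2 - 4 * m ^ 4) * (m * x) + m ^ 2) := by positivity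
      rw [← h12] at h13
      exact nonneg_of_mul_nonneg_right h13 hm6
    nlinarith

/-- A real number has a real cube root. -/
theorem exists_cube_eq (k : ℝ) : ∃ m : ℝ, m ^ 3 = k := by
  rcases le_total 0 k with h | h
  · exact ⟨k ^ ((1 : ℝ) / 3), by rw [← Real.rpow_natCast, ← Real.rpow_mul h]; norm_num⟩
  · refine ⟨-(-k) ^ ((1 : ℝ) / 3), ?_⟩
    rw [Odd.neg_pow (by decide), ← Real.rpow_natCast, ← Real.rpow_mul (by linarith)]
    norm_num

/-- The conditions `𝒟₁ > 0`, `𝒟₂⁺ > 0 > 𝒟₂⁻` together with inequalities that single out the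
relevant connected component. -/
structure Admissible (χ τ lam : ℝ) : Prop where
  neg : τ ^ 2 * lam - χ < 0
  neg' : 3 * (τ ^ 2 * lam - χ) + χ < 0
  D1_pos : 864 * τ ^ 4 < ((τ ^ 2 * lam - χ) * (3 * (τ ^ 2 * lam - χ) + χ)) ^ 3
  D2plus_pos : -8 < (τ ^ 2 * lam - χ) ^ 2 * lam
  D2minus_neg : (τ ^ 2 * lam - χ) ^ 2 * lam < 8
  chi_gt : -χ ^ 3 < 54 * τ ^ 2

/-- Normalisation: `s = -2/ρ²`, `τ = 2k/ρ³`, `λ = 2wρ⁴`, `k = m³`. -/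
theorem exists_normalization {χ τ lam : ℝ} (h : τ ^ 2 * lam - χ < 0) :
    ∃ ρ m w : ℝ, 0 < ρ ∧ τ = 2 * m ^ 3 / ρ ^ 3 ∧ lam = 2 * w * ρ ^ 4 ∧
      χ = 2 / ρ ^ 2 * (1 + 4 * m ^ 6 * w) ∧ τ ^ 2 * lam - χ = -2 / ρ ^ 2 := by
  have hs : 0 < 2 / (χ - τ ^ 2 * lam) := div_pos two_pos (by linarith)
  obtain ⟨ρ, hρ, hρ2⟩ : ∃ ρ : ℝ, 0 < ρ ∧ ρ ^ 2 = 2 / (χ - τ ^ 2 * lam) :=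
    ⟨√(2 / (χ - τ ^ 2 * lam)), Real.sqrt_pos.2 hs, Real.sq_sqrt hs.le⟩
  have hs' : τ ^ 2 * lam - χ = -2 / ρ ^ 2 := by
    rw [hρ2]
    have : χ - τ ^ 2 * lam ≠ 0 := by linarith
    field_simp
    ring
  obtain ⟨m, hm⟩ := exists_cube_eq (τ * ρ ^ 3 / 2)
  have hτ : τ = 2 * m ^ 3 / ρ ^ 3 := by
    rw [hm]
    field_simp
  refine ⟨ρ, m, lam / (2 * ρ ^ 4), hρ, hτ, by field_simp, ?_, hs'⟩
  have : χ = τ ^ 2 * lam + 2 / ρ ^ 2 := by linear_combination -hs'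
  rw [this, hτ]
  field_simp
  ring

/-- The admissibility conditions in normalised variables. -/
theorem Admissible.normalized {ρ m w : ℝ} (hρ : 0 < ρ)
    (h : Admissible (2 / ρ ^ 2 * (1 + 4 * m ^ 6 * w)) (2 * m ^ 3 / ρ ^ 3) (2 * w * ρ ^ 4)) :
    m ^ 2 < 1 ∧ -1 < w ∧ w < 1 ∧ 3 * m ^ 4 < 1 - 2 * m ^ 6 * w := by
  have hs : (2 * m ^ 3 / ρ ^ 3) ^ 2 * (2 * w * ρ ^ 4) - 2 / ρ ^ 2 * (1 + 4 * m ^ 6 * w)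
      = -2 / ρ ^ 2 := by
    field_simp
    ring
  obtain ⟨h1, h2, h3, h4, h5, h6⟩ := h
  rw [hs] at h1 h2 h3 h4 h5
  have e4 : (-2 / ρ ^ 2) ^ 2 * (2 * w * ρ ^ 4) = 8 * w := by
    field_simp
    ring
  rw [e4] at h4 h5
  have e3 : -2 / ρ ^ 2 * (3 * (-2 / ρ ^ 2) + 2 / ρ ^ 2 * (1 + 4 * m ^ 6 * w))
      = 8 / ρ ^ 4 * (1 - 2 * m ^ 6 * w) := by
    field_simp
    ring
  have e3' : 864 * (2 * m ^ 3 / ρ ^ 3) ^ 4 = (8 / ρ ^ 4 * (3 * m ^ 4)) ^ 3 := by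
    field_simp
    ring
  rw [e3, e3'] at h3
  have h3' := lt_of_pow_lt_pow_left₀ 3 (by
    rw [← e3]
    exact (mul_pos_of_neg_of_neg h1 h2).le) h3
  have h7 : 3 * m ^ 4 < 1 - 2 * m ^ 6 * w := lt_of_mul_lt_mul_left h3' (by positivity)
  have e6 : 54 * (2 * m ^ 3 / ρ ^ 3) ^ 2 = (2 / ρ ^ 2 * (3 * m ^ 2)) ^ 3 := by
    field_simp
    ring
  have h8 : -(2 / ρ ^ 2 * (1 + 4 * m ^ 6 * w)) < 2 / ρ ^ 2 * (3 * m ^ 2) := by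
    refine lt_of_pow_lt_pow_left₀ 3 (by positivity) ?_
    rw [← e6]
    linarith [Odd.neg_pow (by decide : Odd 3) (2 / ρ ^ 2 * (1 + 4 * m ^ 6 * w))]
  have h9 : -(1 + 4 * m ^ 6 * w) < 3 * m ^ 2 := by
    refine lt_of_mul_lt_mul_left (a := 2 / ρ ^ 2) ?_ (by positivity)
    linarith
  refine ⟨?_, by linarith, by linarith, h7⟩
  -- The bounds `h7` and `h9` combine to 3(m² - 1)(2m² + 1) < 0.
  by_contra hcon
  nlinarith

/-- The real form of `R(z)²`. -/
def rsq (χ τ lam x : ℝ) : ℝ :=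
  x ^ 4 + τ * lam * x ^ 3 + (3 / 4 * τ ^ 2 * lam ^ 2 - 1 / 2 * χ * lam) * x ^ 2
    + 16 * τ / (τ ^ 2 * lam - χ) ^ 3 * x + 4 / (τ ^ 2 * lam - χ) ^ 2

theorem Rsq_ofReal (χ τ lam x : ℝ) : Rsq χ τ lam x = (rsq χ τ lam x : ℂ) := by
  simp only [Rsq, rsq]
  push_cast
  ring

theorem rsq_normalized {ρ : ℝ} (hρ : 0 < ρ) (m w x : ℝ) :
    rsq (2 / ρ ^ 2 * (1 + 4 * m ^ 6 * w)) (2 * m ^ 3 / ρ ^ 3) (2 * w * ρ ^ 4) (ρ * x)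
      = ρ ^ 4 * ((x ^ 2 + 2 * w * m ^ 3 * x) ^ 2 - 2 * w * x ^ 2 - 4 * m ^ 3 * x + 1) := by
  have hs : (2 * m ^ 3 / ρ ^ 3) ^ 2 * (2 * w * ρ ^ 4) - 2 / ρ ^ 2 * (1 + 4 * m ^ 6 * w)
      = -2 / ρ ^ 2 := by
    field_simp
    ring
  rw [rsq, hs]
  field_simp
  ring

theorem Admissible.rsq_pos {χ τ lam : ℝ} (h : Admissible χ τ lam) (x : ℝ) :
    0 < rsq χ τ lam x := by
  obtain ⟨ρ, m, w, hρ, rfl, rfl, rfl, -⟩ := exists_normalization h.neg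
  obtain ⟨h1, -, h3, h4⟩ := h.normalized hρ
  have e : x = ρ * (x / ρ) := by field_simp
  rw [e, rsq_normalized hρ]
  exact mul_pos (by positivity) (normalized_quartic_pos h1 h3 h4 _)

/-! ### Splitting the quartic into quadratic factors -/

/-- `R(z)² = ((z - c)² + a²)((z - d)² + b²)`, in terms of coefficients. -/
structure IsSplit (χ τ lam c a d b : ℝ) : Prop where
  coeff3 : τ * lam = -2 * (c + d)
  coeff2 : 3 / 4 * τ ^ 2 * lam ^ 2 - 1 / 2 * χ * lam = c ^ 2 + a ^ 2 + d ^ 2 + b ^ 2 + 4 * c * d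
  coeff1 : 16 * τ / (τ ^ 2 * lam - χ) ^ 3 = -2 * (c * (d ^ 2 + b ^ 2) + d * (c ^ 2 + a ^ 2))
  coeff0 : 4 / (τ ^ 2 * lam - χ) ^ 2 = (c ^ 2 + a ^ 2) * (d ^ 2 + b ^ 2)

theorem Rsq_eq_coeff (χ τ lam : ℝ) (z : ℂ) : Rsq χ τ lam z = z ^ 4 + (τ * lam : ℝ) * z ^ 3
    + (3 / 4 * τ ^ 2 * lam ^ 2 - 1 / 2 * χ * lam : ℝ) * z ^ 2
    + (16 * τ / (τ ^ 2 * lam - χ) ^ 3 : ℝ) * z + (4 / (τ ^ 2 * lam - χ) ^ 2 : ℝ) := by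
  simp only [Rsq]
  push_cast
  ring

theorem IsSplit.Rsq_eq {χ τ lam c a d b : ℝ} (h : IsSplit χ τ lam c a d b) (z : ℂ) :
    Rsq χ τ lam z = ((z - c) ^ 2 + a ^ 2) * ((z - d) ^ 2 + b ^ 2) := by
  rw [Rsq_eq_coeff, h.coeff3, h.coeff2, h.coeff1, h.coeff0]
  push_cast
  ring

theorem quadratic_eq_mul (α z : ℂ) :
    (z - α.re) ^ 2 + (α.im : ℂ) ^ 2 = (z - α) * (z - conj α) := by
  have h1 := Complex.add_conj α
  have h2 := Complex.mul_conj α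
  rw [normSq_apply] at h2
  push_cast at h1 h2
  linear_combination -z * (-h1) - h2

/-- Division of the real quartic by the real quadratic (z - α)(z - α*) leaves a real linear
remainder; it vanishes at the non-real point α, hence identically. -/
theorem exists_quadratic_factor {χ τ lam : ℝ} {α : ℂ} (h : Rsq χ τ lam α = 0) (hα : α.im ≠ 0) :
    ∃ p r : ℝ, τ * lam = p - 2 * α.re ∧
      3 / 4 * τ ^ 2 * lam ^ 2 - 1 / 2 * χ * lam
        = r - 2 * α.re * p + (α.re ^ 2 + α.im ^ 2) ∧
      16 * τ / (τ ^ 2 * lam - χ) ^ 3 = (α.re ^ 2 + α.im ^ 2) * p - 2 * α.re * r ∧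
      4 / (τ ^ 2 * lam - χ) ^ 2 = (α.re ^ 2 + α.im ^ 2) * r := by
  rw [Rsq_eq_coeff] at h
  generalize τ * lam = q3 at *
  generalize 3 / 4 * τ ^ 2 * lam ^ 2 - 1 / 2 * χ * lam = q2 at *
  generalize 16 * τ / (τ ^ 2 * lam - χ) ^ 3 = q1 at *
  generalize 4 / (τ ^ 2 * lam - χ) ^ 2 = q0 at *
  set c := α.re
  set a := α.im
  set n := c ^ 2 + a ^ 2
  set p := q3 + 2 * c
  set r := q2 - n + 2 * c * p
  have hquad : α ^ 2 = 2 * c * α - n := by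
    have := quadratic_eq_mul α α
    rw [sub_self, zero_mul] at this
    simp only [n]
    push_cast
    linear_combination this
  have hrem : ((q1 - n * p + 2 * c * r : ℝ) : ℂ) * α + (q0 - n * r : ℝ) = 0 := by
    have e : (α ^ 2 - 2 * c * α + n) * (α ^ 2 + p * α + r) = 0 := by
      rw [hquad]
      ring
    rw [← h]
    simp only [r, p]
    simp only [r, p] at e
    push_cast
    push_cast at e
    linear_combination -e
  have him := congrArg Complex.im hrem
  have hre := congrArg Complex.re hrem
  simp only [add_im, im_ofReal_mul, ofReal_im, add_zero, zero_im] at him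
  simp only [add_re, re_ofReal_mul, ofReal_re, zero_re] at hre
  have h1 : q1 - n * p + 2 * c * r = 0 := (mul_eq_zero.1 him).resolve_right hα
  rw [h1, zero_mul, zero_add] at hre
  exact ⟨p, r, by simp only [p]; ring, by simp only [r]; ring, by linarith, by linarith⟩

theorem eq_of_quadratic_root {p r : ℝ} {β : ℂ} (h : β ^ 2 + p * β + r = 0) (hβ : β.im ≠ 0) :
    p = -2 * β.re ∧ r = β.re ^ 2 + β.im ^ 2 := by
  have him := congrArg Complex.im h
  have hre := congrArg Complex.re h
  simp only [sq, add_im, mul_im, ofReal_re, ofReal_im, zero_im, add_zero] at him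
  simp only [sq, add_re, mul_re, ofReal_re, ofReal_im, zero_re] at hre
  have hp : p = -2 * β.re := by
    have : β.im * (p + 2 * β.re) = 0 := by linarith
    linarith [(mul_eq_zero.1 this).resolve_left hβ]
  refine ⟨hp, ?_⟩
  rw [hp] at hre
  linarith

theorem IsQuartet.isSplit {χ τ lam : ℝ} {α β : ℂ} (h : IsQuartet χ τ lam α β) :
    IsSplit χ τ lam α.re α.im β.re β.im := by
  obtain ⟨hα, hβ, hα', hβ', hle, himp⟩ := h
  obtain ⟨p, r, e3, e2, e1, e0⟩ := exists_quadratic_factor hα hα'.ne'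
  have hne : β ≠ α := by
    rintro rfl
    exact lt_irrefl _ (himp rfl)
  have hne' : β ≠ conj α := by
    intro e
    have := congrArg Complex.im e
    rw [conj_im] at this
    linarith
  have hfac : ((β - α) * (β - conj α)) * (β ^ 2 + p * β + r) = 0 := by
    rw [← hβ, Rsq_eq_coeff, e3, e2, e1, e0, ← quadratic_eq_mul]
    push_cast
    ring
  have hB : β ^ 2 + p * β + r = 0 :=
    (mul_eq_zero.1 hfac).resolve_left (mul_ne_zero (sub_ne_zero.2 hne) (sub_ne_zero.2 hne'))
  obtain ⟨hp, hr⟩ := eq_of_quadratic_root hB hβ'.ne'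
  subst hp hr
  exact ⟨by rw [e3]; ring, by rw [e2]; ring, by rw [e1]; ring, by rw [e0]⟩

theorem IsQuartet.Rsq_eq {χ τ lam : ℝ} {α β : ℂ} (h : IsQuartet χ τ lam α β) (z : ℂ) :
    Rsq χ τ lam z = ((z - α) * (z - conj α)) * ((z - β) * (z - conj β)) := by
  rw [h.isSplit.Rsq_eq, quadratic_eq_mul, quadratic_eq_mul]

theorem IsQuartet.eq_or_eq {χ τ lam : ℝ} {α β z : ℂ} (h : IsQuartet χ τ lam α β)
    (hz : Rsq χ τ lam z = 0) (hz' : 0 < z.im) : z = α ∨ z = β := by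
  have h3 := h.2.2.1
  have h4 := h.2.2.2.1
  have aux : ∀ γ : ℂ, 0 < γ.im → z - conj γ ≠ 0 := by
    intro γ hγ e
    have := congrArg Complex.im e
    simp only [sub_im, conj_im, zero_im] at this
    linarith
  rw [h.Rsq_eq] at hz
  rcases mul_eq_zero.1 hz with hz | hz
  · exact Or.inl (sub_eq_zero.1 ((mul_eq_zero.1 hz).resolve_right (aux _ h3)))
  · exact Or.inr (sub_eq_zero.1 ((mul_eq_zero.1 hz).resolve_right (aux _ h4)))

theorem IsQuartet.unique {χ τ lam : ℝ} {α β α' β' : ℂ} (h : IsQuartet χ τ lam α β)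
    (h' : IsQuartet χ τ lam α' β') : α' = α ∧ β' = β := by
  have hα := h.eq_or_eq h'.1 h'.2.2.1
  have hβ := h.eq_or_eq h'.2.1 h'.2.2.2.1
  obtain ⟨-, -, -, -, h5, h6⟩ := h
  obtain ⟨-, -, -, -, h5', h6'⟩ := h'
  rcases hα with rfl | rfl <;> rcases hβ with rfl | rfl
  · exact absurd (h6' rfl) (lt_irrefl _)
  · exact ⟨rfl, rfl⟩
  · have e := le_antisymm h5 h5'
    exact absurd (h6 e) (not_lt.2 (h6' e.symm).le)
  · exact absurd (h6' rfl) (lt_irrefl _)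

theorem IsQuartet.roots_eq {χ τ lam : ℝ} {α β : ℂ} (h : IsQuartet χ τ lam α β) :
    roots χ τ lam = (α, β) := by
  have hex : ∃ p : ℂ × ℂ, IsQuartet χ τ lam p.1 p.2 := ⟨(α, β), h⟩
  rw [roots, dif_pos hex]
  obtain ⟨h1, h2⟩ := h.unique hex.choose_spec
  exact Prod.ext h1 h2

/-- If the two pairs of roots have the same real part, then the linear coefficient of the depressed
quartic vanishes. -/
theorem IsSplit.depressed {χ τ lam c a b : ℝ} (h : IsSplit χ τ lam c a c b)
    (hs : τ ^ 2 * lam - χ ≠ 0) : τ * (64 - ((τ ^ 2 * lam - χ) ^ 2 * lam) ^ 2) = 0 := by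
  have h1 := h.coeff1
  rw [div_eq_iff (pow_ne_zero 3 hs)] at h1
  have h2 := h.coeff2
  have hc : c = -(τ * lam) / 4 := by linarith [h.coeff3]
  subst hc
  have : b ^ 2 = 3 / 4 * τ ^ 2 * lam ^ 2 - 1 / 2 * χ * lam
    - ((-(τ * lam) / 4) ^ 2 + a ^ 2 + (-(τ * lam) / 4) ^ 2 + 4 * (-(τ * lam) / 4) ^ 2) := by
    linarith
  rw [this] at h1
  linear_combination 4 * h1

/-- For τ ≠ 0 equal real parts would make 𝒟₂⁺ or 𝒟₂⁻ vanish, by `IsSplit.depressed`. For τ = 0 the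
quartic is biquadratic with a²b²χ² = 4, while the bounds give (a² + b²)²χ² < 16, against (a² + b²)²
≥ 4a²b². -/
theorem IsSplit.re_ne {χ τ lam c a d b : ℝ} (h : IsSplit χ τ lam c a d b)
    (hs : τ ^ 2 * lam - χ ≠ 0) (h1 : -8 < (τ ^ 2 * lam - χ) ^ 2 * lam)
    (h2 : (τ ^ 2 * lam - χ) ^ 2 * lam < 8) : c ≠ d := by
  rintro rfl
  have h3 := h.depressed hs
  have h4 : 64 - ((τ ^ 2 * lam - χ) ^ 2 * lam) ^ 2 ≠ 0 := by nlinarith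
  have hτ : τ = 0 := (mul_eq_zero.1 h3).resolve_right h4
  subst hτ
  have hc : c = 0 := by linarith [h.coeff3]
  subst hc
  have e2 := h.coeff2
  have e0 := h.coeff0
  norm_num at e2 e0 hs h1 h2
  rw [div_eq_iff (pow_ne_zero 2 hs)] at e0
  have h5 : (χ * lam) ^ 2 * χ ^ 2 < 64 := by nlinarith
  have h6 : (a ^ 2 + b ^ 2) ^ 2 * χ ^ 2 * 4 < 64 := by
    have : χ * lam = -2 * (a ^ 2 + b ^ 2) := by linarith
    rw [this] at h5
    linarith
  nlinarith [mul_nonneg (sq_nonneg (a ^ 2 - b ^ 2)) (sq_nonneg χ)]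

theorem Admissible.re_lt {χ τ lam : ℝ} (h : Admissible χ τ lam) {α β : ℂ}
    (hq : IsQuartet χ τ lam α β) : α.re < β.re :=
  lt_of_le_of_ne hq.2.2.2.2.1 (hq.isSplit.re_ne h.neg.ne h.D2plus_pos h.D2minus_neg)

theorem exists_monic_quadratic_root (p r : ℂ) : ∃ z : ℂ, z ^ 2 + p * z + r = 0 := by
  obtain ⟨y, hy⟩ := IsAlgClosed.exists_pow_nat_eq (p ^ 2 / 4 - r) two_pos
  exact ⟨y - p / 2, by linear_combination hy⟩

theorem exists_Rsq_root (χ τ lam : ℝ) : ∃ z : ℂ, Rsq χ τ lam z = 0 := by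
  open Polynomial in
  let P : ℂ[X] := X ^ 4 + (C ((τ * lam : ℝ) : ℂ) * X ^ 3
    + C ((3 / 4 * τ ^ 2 * lam ^ 2 - 1 / 2 * χ * lam : ℝ) : ℂ) * X ^ 2
    + C ((16 * τ / (τ ^ 2 * lam - χ) ^ 3 : ℝ) : ℂ) * X + C ((4 / (τ ^ 2 * lam - χ) ^ 2 : ℝ) : ℂ))
  have hdeg : P.degree = 4 := by
    simp only [P]
    compute_degree!
  obtain ⟨z, hz⟩ := IsAlgClosed.exists_root P (by rw [hdeg]; norm_num)
  refine ⟨z, ?_⟩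
  rw [Rsq_eq_coeff, ← hz]
  simp only [P, Polynomial.eval_add, Polynomial.eval_mul, Polynomial.eval_pow, Polynomial.eval_X,
    Polynomial.eval_C]
  ring

theorem Rsq_conj (χ τ lam : ℝ) (z : ℂ) : Rsq χ τ lam (conj z) = conj (Rsq χ τ lam z) := by
  simp only [Rsq_eq_coeff, map_add, map_mul, map_pow, conj_ofReal]

theorem Admissible.im_ne_zero {χ τ lam : ℝ} (h : Admissible χ τ lam) {z : ℂ}
    (hz : Rsq χ τ lam z = 0) : z.im ≠ 0 := by
  intro him
  have e : z = (z.re : ℂ) := Complex.ext rfl (by simpa using him)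
  rw [e, Rsq_ofReal] at hz
  exact (h.rsq_pos z.re).ne' (by exact_mod_cast hz)

/-- The predicate `P` serves both the quartic and the quadratic left over once one conjugate pair is
removed. -/
theorem Admissible.exists_root_im_pos {χ τ lam : ℝ} (h : Admissible χ τ lam) {P : ℂ → Prop}
    (hP : ∀ z, P z → P (conj z)) (hR : ∀ z, P z → Rsq χ τ lam z = 0) (hex : ∃ z, P z) :
    ∃ z, P z ∧ 0 < z.im := by
  obtain ⟨z, hz⟩ := hex
  rcases lt_or_gt_of_ne (h.im_ne_zero (hR z hz)) with h0 | h0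
  · exact ⟨conj z, hP z hz, by rw [conj_im]; linarith⟩
  · exact ⟨z, hz, h0⟩

/-- No root is real, so one conjugate pair splits off and the complementary real quadratic supplies
the other. The real parts differ, so the labelling is only a matter of order. -/
theorem Admissible.exists_isQuartet {χ τ lam : ℝ} (h : Admissible χ τ lam) :
    ∃ α β : ℂ, IsQuartet χ τ lam α β := by
  obtain ⟨α, hα, hα'⟩ := h.exists_root_im_pos (P := fun z => Rsq χ τ lam z = 0)
    (fun z hz => by rw [Rsq_conj, hz, map_zero]) (fun z hz => hz) (exists_Rsq_root χ τ lam)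
  obtain ⟨p, r, e3, e2, e1, e0⟩ := exists_quadratic_factor hα hα'.ne'
  have hfac : ∀ z, Rsq χ τ lam z
      = ((z - α.re) ^ 2 + (α.im : ℂ) ^ 2) * (z ^ 2 + p * z + r) := by
    intro z
    rw [Rsq_eq_coeff, e3, e2, e1, e0]
    push_cast
    ring
  obtain ⟨β, hβ, hβ'⟩ := h.exists_root_im_pos (P := fun z => z ^ 2 + p * z + r = 0)
    (fun z hz => by
      have := congrArg conj hz
      simpa only [map_add, map_mul, map_pow, conj_ofReal, map_zero] using this)
    (fun z hz => by rw [hfac, hz, mul_zero]) (exists_monic_quadratic_root p r)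
  have hβ0 : Rsq χ τ lam β = 0 := by rw [hfac, hβ, mul_zero]
  obtain ⟨hp, hr⟩ := eq_of_quadratic_root hβ hβ'.ne'
  have hsplit : IsSplit χ τ lam α.re α.im β.re β.im := by
    subst hp hr
    exact ⟨by rw [e3]; ring, by rw [e2]; ring, by rw [e1]; ring, by rw [e0]⟩
  rcases lt_or_gt_of_ne (hsplit.re_ne h.neg.ne h.D2plus_pos h.D2minus_neg) with hlt | hlt
  · exact ⟨α, β, hα, hβ0, hα', hβ', hlt.le, fun e => absurd e hlt.ne⟩
  · exact ⟨β, α, hβ0, hα, hβ', hα', hlt.le, fun e => absurd e hlt.ne⟩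

/-! ### The critical curve -/

theorem chi0_pow_three (τ : ℝ) : chi0 τ ^ 3 = 54 * τ ^ 2 := by
  rw [chi0, ← Real.rpow_natCast, ← Real.rpow_mul (by positivity)]
  norm_num

theorem chi0_nonneg (τ : ℝ) : 0 ≤ chi0 τ := by
  rw [chi0]
  positivity

theorem chi0_le_iff {χ τ : ℝ} : chi0 τ ≤ χ ↔ 54 * τ ^ 2 ≤ χ ^ 3 := by
  rw [← chi0_pow_three]
  exact (Odd.strictMono_pow (by decide : Odd 3)).le_iff_le.symm

theorem isCritical_chiC (τ : ℝ) : IsCritical τ (chiC τ) :=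
  (existsUnique_isCritical τ).choose_spec.1

theorem neg_pow_three_lt {χ τ : ℝ} (h : chiC τ < χ) : -χ ^ 3 < 54 * τ ^ 2 := by
  have h1 : -chi0 τ < χ := (isCritical_chiC τ).1.trans h
  have h2 := (Odd.strictMono_pow (by decide : Odd 3)) h1
  simp only [Odd.neg_pow (by decide : Odd 3), chi0_pow_three] at h2
  linarith

/-- Parametrisation of the critical curve. -/
theorem exists_chiC_param (τ : ℝ) :
    ∃ v : ℝ, 0 < v ∧ 4 * τ ^ 2 * v ^ 9 + v = 2 ∧ chiC τ = (2 * v - 3) / v ^ 3 := by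
  obtain ⟨-, ⟨u, v⟩, hv, h⟩ := isCritical_chiC τ
  have hv : 0 < v := hv
  rw [critical_iff _ _ _ _ hv] at h
  obtain ⟨ht, hx, hk⟩ := h
  obtain ⟨y, hy, rfl⟩ : ∃ y : ℝ, 0 < y ∧ v = y ^ 2 :=
    ⟨√v, Real.sqrt_pos.2 hv, (Real.sq_sqrt hv.le).symm⟩
  have hr : u ^ 2 + (y ^ 2) ^ 2 = 2 * y ^ 3 := by
    have : (u ^ 2 + (y ^ 2) ^ 2) ^ 2 = (2 * y ^ 3) ^ 2 := by
      rw [← hk]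
      ring
    exact (pow_left_inj₀ (by positivity) (by positivity) two_ne_zero).1 this
  rw [hr] at ht hx
  have hu : u = 2 * τ * y ^ 6 := by linear_combination -ht / 2
  refine ⟨y, hy, ?_, ?_⟩
  · apply mul_left_cancel₀ (pow_pos hy 3).ne'
    rw [hu] at hr
    linear_combination hr
  · rw [eq_div_iff (by positivity)]
    apply mul_left_cancel₀ (pow_pos hy 3).ne'
    linear_combination hx / 4 - 3 / 2 * hr

/-- The parameter v of the critical curve is the zero of the increasing function v ↦ 4τ²v⁹ + v - 2,
so it varies continuously with τ: sign changes at v ± η persist for nearby τ and trap the new zero.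
-/
theorem isOpen_chiC_lt : IsOpen {p : ℝ × ℝ | chiC p.2 < p.1} := by
  rw [isOpen_iff_eventually]
  rintro ⟨χ, τ⟩ h
  obtain ⟨v, hv, hv2, hc⟩ := exists_chiC_param τ
  have h : (2 * v - 3) / v ^ 3 < χ := by
    rw [← hc]
    exact h
  have hcont : ContinuousAt (fun q : (ℝ × ℝ) × ℝ => q.1.1 - (2 * q.2 - 3) / q.2 ^ 3)
      ((χ, τ), v) := by
    have : v ^ 3 ≠ 0 := by positivity
    fun_prop (disch := assumption)
  have hev := hcont.eventually (lt_mem_nhds (sub_pos.2 h))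
  rw [nhds_prod_eq, Filter.eventually_prod_iff] at hev
  obtain ⟨pa, ha, pb, hb, hab⟩ := hev
  obtain ⟨ε, hε, hball⟩ := Metric.eventually_nhds_iff.1 hb
  -- The bound by v / 2 keeps v - η positive, as the monotonicity of the ninth power requires.
  set η := min (ε / 2) (v / 2)
  have hη : 0 < η := lt_min (by linarith) (by linarith)
  have hηε : η < ε := (min_le_left _ _).trans_lt (by linarith)
  have hηv : η < v := (min_le_right _ _).trans_lt (by linarith)
  have h1 : 4 * τ ^ 2 * (v - η) ^ 9 + (v - η) < 2 := by
    have := mul_le_mul_of_nonneg_left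
      (pow_le_pow_left₀ (by linarith) (by linarith : v - η ≤ v) 9) (by positivity : 0 ≤ 4 * τ ^ 2)
    linarith
  have h2 : 2 < 4 * τ ^ 2 * (v + η) ^ 9 + (v + η) := by
    have := mul_le_mul_of_nonneg_left
      (pow_le_pow_left₀ (by linarith) (by linarith : v ≤ v + η) 9) (by positivity : 0 ≤ 4 * τ ^ 2)
    linarith
  have e1 : ∀ᶠ p : ℝ × ℝ in nhds (χ, τ), 4 * p.2 ^ 2 * (v - η) ^ 9 + (v - η) < 2 := by
    have : ContinuousAt (fun p : ℝ × ℝ => 4 * p.2 ^ 2 * (v - η) ^ 9 + (v - η)) (χ, τ) := by fun_prop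
    exact this.eventually (gt_mem_nhds h1)
  have e2 : ∀ᶠ p : ℝ × ℝ in nhds (χ, τ), 2 < 4 * p.2 ^ 2 * (v + η) ^ 9 + (v + η) := by
    have : ContinuousAt (fun p : ℝ × ℝ => 4 * p.2 ^ 2 * (v + η) ^ 9 + (v + η)) (χ, τ) := by fun_prop
    exact this.eventually (lt_mem_nhds h2)
  filter_upwards [ha, e1, e2] with p hp h1 h2
  obtain ⟨y, hy, hy2, hc'⟩ := exists_chiC_param p.2
  have hy1 : v - η < y := by
    by_contra hcon
    have := mul_le_mul_of_nonneg_left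
      (pow_le_pow_left₀ hy.le (not_lt.1 hcon) 9) (by positivity : 0 ≤ 4 * p.2 ^ 2)
    linarith
  have hy3 : y < v + η := by
    by_contra hcon
    have := mul_le_mul_of_nonneg_left
      (pow_le_pow_left₀ (by linarith) (not_lt.1 hcon) 9) (by positivity : 0 ≤ 4 * p.2 ^ 2)
    linarith
  have hy4 : pb y := hball (by rw [Real.dist_eq, abs_lt]; constructor <;> linarith)
  have := hab hp hy4
  simp only [hc']
  simpa using this

/-! ### The lower end of the interval -/

/-- The double root of `R(z)²` at the lower end `λ₁` of the interval has modulus `√r`. -/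
theorem exists_lower_param {χ τ : ℝ} (h : chiC τ < χ) :
    ∃ r : ℝ, 0 < r ∧ 2 - 2 * τ ^ 2 * r ^ 3 = χ * r ∧ τ ^ 2 * r ^ 3 < 4 ∧
      r < 16 * (1 - τ ^ 2 * r ^ 3 / 4) ^ 3 := by
  obtain ⟨v, hv, hv2, hc⟩ := exists_chiC_param τ
  have hc' : chiC τ * v ^ 3 = 2 * v - 3 := by
    rw [hc]
    field_simp
  -- At r = 2v³ the expression equals 2(2v - 3 - χv³), which vanishes for χ = χ_c and is negative
  -- for χ > χ_c. So the root r lies strictly below 2v³.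
  have hg : 2 - 2 * τ ^ 2 * (2 * v ^ 3) ^ 3 - χ * (2 * v ^ 3) < 0 := by
    have : chiC τ * v ^ 3 < χ * v ^ 3 := mul_lt_mul_of_pos_right h (by positivity)
    nlinarith
  have hcont : ContinuousOn (fun r : ℝ => 2 - 2 * τ ^ 2 * r ^ 3 - χ * r)
    (Set.Icc 0 (2 * v ^ 3)) := by fun_prop
  obtain ⟨r, ⟨hr0, hr1⟩, hr⟩ := intermediate_value_Icc' (by positivity) hcont
    ⟨hg.le, by norm_num⟩
  simp only at hr
  have hr0 : 0 < r := by
    rcases hr0.lt_or_eq with h | rfl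
    · exact h
    · norm_num at hr
  have hr1 : r < 2 * v ^ 3 := by
    rcases hr1.lt_or_eq with h | rfl
    · exact h
    · linarith
  have h3 : τ ^ 2 * r ^ 3 ≤ τ ^ 2 * (2 * v ^ 3) ^ 3 :=
    mul_le_mul_of_nonneg_left (pow_le_pow_left₀ hr0.le hr1.le 3) (by positivity)
  -- At r = 2v³ this is an equality, by 4τ²v⁹ + v = 2. Cubing yields 16(1 - τ²r³/4)³ ≥ 2v³ > r.
  have h4 : v / 2 ≤ 1 - τ ^ 2 * r ^ 3 / 4 := by nlinarith
  refine ⟨r, hr0, by linarith, by linarith, ?_⟩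
  have := pow_le_pow_left₀ (by positivity) h4 3
  nlinarith

/-- Dividing the cubic 𝒟₂⁺ by its root factor λ + 2r² leaves a quadratic that is positive because
τ²r³ < 4; this makes λ₁ = -2r² the only real root and reads off the sign of 𝒟₂⁺. -/
theorem D2plus_factor {χ τ r : ℝ} (hr : 0 < r) (h : 2 - 2 * τ ^ 2 * r ^ 3 = χ * r)
    (h4 : τ ^ 2 * r ^ 3 < 4) (lam : ℝ) :
    ∃ q : ℝ, 0 < q ∧ D2plus χ τ lam = (lam + 2 * r ^ 2) * q := by
  obtain ⟨μ, rfl⟩ : ∃ μ, lam = μ - 2 * r ^ 2 := ⟨lam + 2 * r ^ 2, by ring⟩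
  have hχ : χ = 2 / r - 2 * τ ^ 2 * r ^ 2 := by
    field_simp
    linarith
  refine ⟨(τ ^ 2 * μ - (2 / r + r ^ 2 * τ ^ 2)) ^ 2 + (4 / r ^ 2 + 8 * τ ^ 2 * r
    - (2 / r + r ^ 2 * τ ^ 2) ^ 2), ?_, ?_⟩
  · have e : 4 / r ^ 2 + 8 * τ ^ 2 * r - (2 / r + r ^ 2 * τ ^ 2) ^ 2
        = τ ^ 2 * (r * (4 - τ ^ 2 * r ^ 3)) := by
      field_simp
      ring
    rw [e]
    rcases eq_or_ne τ 0 with rfl | hτ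
    · norm_num
      positivity
    · have : 0 < r * (4 - τ ^ 2 * r ^ 3) := mul_pos hr (by linarith)
      positivity
  · rw [D2plus, hχ]
    field_simp
    ring

theorem lambda1_eq {χ τ r : ℝ} (hr : 0 < r) (h : 2 - 2 * τ ^ 2 * r ^ 3 = χ * r)
    (h4 : τ ^ 2 * r ^ 3 < 4) : lambda1 χ τ = -2 * r ^ 2 := by
  have : {lam : ℝ | D2plus χ τ lam = 0} = {-2 * r ^ 2} := by
    ext lam
    obtain ⟨q, hq, e⟩ := D2plus_factor hr h h4 lam
    simp only [Set.mem_ofPred_eq, Set.mem_singleton_iff, e, mul_eq_zero, hq.ne', or_false]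
    constructor <;> intro h <;> linarith
  rw [lambda1, this, csInf_singleton]

theorem lambda1_lt_iff {χ τ : ℝ} (h : chiC τ < χ) (lam : ℝ) :
    lambda1 χ τ < lam ↔ 0 < D2plus χ τ lam := by
  obtain ⟨r, hr, h2, h4, -⟩ := exists_lower_param h
  obtain ⟨q, hq, e⟩ := D2plus_factor hr h2 h4 lam
  rw [lambda1_eq hr h2 h4, e, mul_pos_iff_of_pos_right hq]
  constructor <;> intro h <;> linarith

/-! ### The upper end of the interval -/

/-- Up to a constant 𝒟₁ is a perfect cube, so its sign is governed by the quadratic s(3s + χ) in s.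
-/
theorem D1_eq (χ τ lam : ℝ) : D1 χ τ lam
    = ((τ ^ 2 * lam - χ) * (3 * (τ ^ 2 * lam - χ) + χ)) ^ 3 - 864 * τ ^ 4 := by
  rw [D1]
  ring

/-- With c³ = 864τ⁴ the equation 𝒟₁ = 0 reads 3s² + χs - c = 0, whose roots are s = (-χ ± t)/6. -/
theorem lambda3_spec (χ : ℝ) {τ : ℝ} (hτ : τ ≠ 0) :
    ∃ c t : ℝ, 0 < c ∧ c ^ 3 = 864 * τ ^ 4 ∧ |χ| < t ∧ t ^ 2 = χ ^ 2 + 12 * c ∧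
      τ ^ 2 * lambda3 χ τ - χ = -(χ + t) / 6 := by
  obtain ⟨c, hc3⟩ := exists_cube_eq (864 * τ ^ 4)
  have hc : 0 < c := by
    have : 0 < c ^ 3 := by
      rw [hc3]
      positivity
    exact (Odd.pow_pos_iff (by decide)).1 this
  have ht2 : √(χ ^ 2 + 12 * c) ^ 2 = χ ^ 2 + 12 * c := Real.sq_sqrt (by positivity)
  have ht : |χ| < √(χ ^ 2 + 12 * c) := Real.lt_sqrt_of_sq_lt (by rw [sq_abs]; linarith)
  set t := √(χ ^ 2 + 12 * c)
  have hset : {lam : ℝ | D1 χ τ lam = 0}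
      = {(-(χ + t) / 6 + χ) / τ ^ 2, ((t - χ) / 6 + χ) / τ ^ 2} := by
    ext lam
    have hτ2 : τ ^ 2 ≠ 0 := pow_ne_zero 2 hτ
    simp only [Set.mem_ofPred_eq, Set.mem_insert_iff, Set.mem_singleton_iff, D1_eq, ← hc3,
      sub_eq_zero, (Odd.strictMono_pow (by decide : Odd 3)).injective.eq_iff, eq_div_iff hτ2]
    have e : (τ ^ 2 * lam - χ) * (3 * (τ ^ 2 * lam - χ) + χ) = c ↔
        (lam * τ ^ 2 - (-(χ + t) / 6 + χ)) * (lam * τ ^ 2 - ((t - χ) / 6 + χ)) = 0 := by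
      constructor <;> intro h
      · linear_combination h / 3 - ht2 / 36
      · linear_combination h * 3 + ht2 / 12
    rw [e, mul_eq_zero, sub_eq_zero, sub_eq_zero]
  refine ⟨c, t, hc, hc3, ht, ht2, ?_⟩
  have h0 : 0 < t := (abs_nonneg _).trans_lt ht
  have hle : (-(χ + t) / 6 + χ) / τ ^ 2 ≤ ((t - χ) / 6 + χ) / τ ^ 2 := by
    gcongr
    linarith
  rw [lambda3, hset, csInf_pair, inf_eq_left.2 hle]
  field_simp
  ring

/-- Since |χ| < t, the smaller root s lies below both 0 and -χ/3; the two sign conditions exclude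
the other side, where s(3s + χ) > c as well. -/
theorem lt_lambda3_iff {χ τ : ℝ} (hτ : τ ≠ 0) (lam : ℝ) :
    lam < lambda3 χ τ ↔ τ ^ 2 * lam - χ < 0 ∧ 3 * (τ ^ 2 * lam - χ) + χ < 0 ∧
      864 * τ ^ 4 < ((τ ^ 2 * lam - χ) * (3 * (τ ^ 2 * lam - χ) + χ)) ^ 3 := by
  obtain ⟨c, t, hc, hc3, ht, ht2, hs⟩ := lambda3_spec χ hτ
  have hτ2 : 0 < τ ^ 2 := by positivity
  have hl : lam < lambda3 χ τ ↔ τ ^ 2 * lam - χ < -(χ + t) / 6 := by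
    rw [← hs, sub_lt_sub_iff_right, mul_lt_mul_iff_right₀ hτ2]
  obtain ⟨ht1, ht3⟩ := abs_lt.1 ht
  rw [hl, ← hc3, (Odd.strictMono_pow (by decide : Odd 3)).lt_iff_lt]
  generalize τ ^ 2 * lam - χ = s
  constructor
  · intro h
    refine ⟨by linarith, by linarith, ?_⟩
    nlinarith
  · rintro ⟨h1, h2, h3⟩
    by_contra hcon
    nlinarith

theorem D2minus_neg_of_nonpos {χ τ lam : ℝ} (h : lam ≤ 0) : D2minus χ τ lam < 0 := by
  have : (χ - τ ^ 2 * lam) ^ 2 * lam ≤ 0 := mul_nonpos_of_nonneg_of_nonpos (sq_nonneg _) h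
  rw [D2minus]
  linarith

theorem bddBelow_D2minus (χ τ : ℝ) : BddBelow {lam : ℝ | D2minus χ τ lam = 0} := by
  refine ⟨0, fun lam h => ?_⟩
  by_contra hcon
  exact (D2minus_neg_of_nonpos (not_le.1 hcon).le).ne h

theorem continuous_D2minus (χ τ : ℝ) : Continuous (D2minus χ τ) := by
  unfold D2minus
  fun_prop

/-- 𝒟₂⁻ is negative for λ ≤ 0, so the intermediate value theorem places a root between 0 and any
point where it is nonnegative. In particular 𝒟₂⁻ < 0 to the left of λ₂. -/
theorem exists_D2minus_root_le {χ τ lam : ℝ} (h : 0 ≤ D2minus χ τ lam) :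
    ∃ l ≤ lam, D2minus χ τ l = 0 := by
  have h0 : 0 ≤ lam := by
    by_contra hcon
    exact absurd (D2minus_neg_of_nonpos (χ := χ) (τ := τ) (not_le.1 hcon).le) (not_lt.2 h)
  obtain ⟨l, hl, hl0⟩ := intermediate_value_Icc h0 (continuous_D2minus χ τ).continuousOn
    ⟨(D2minus_neg_of_nonpos le_rfl).le, h⟩
  exact ⟨l, hl.2, hl0⟩

theorem D2minus_neg_of_lt {χ τ lam : ℝ} (h : lam < lambda2 χ τ) : D2minus χ τ lam < 0 := by
  by_contra hcon
  obtain ⟨l, hl, hl0⟩ := exists_D2minus_root_le (not_lt.1 hcon)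
  exact absurd (csInf_le (bddBelow_D2minus χ τ) hl0) (not_le.2 (hl.trans_lt h))

theorem exists_D2minus_nonneg {χ τ : ℝ} (h : τ ≠ 0 ∨ χ ≠ 0) : ∃ lam, 0 ≤ D2minus χ τ lam := by
  rcases eq_or_ne τ 0 with rfl | hτ
  · have hχ : χ ≠ 0 := by simpa using h
    refine ⟨8 / χ ^ 2, ?_⟩
    rw [D2minus, show χ - 0 ^ 2 * (8 / χ ^ 2) = χ by ring]
    field_simp
    norm_num
  · have hτ2 : 0 < τ ^ 2 := by positivity
    refine ⟨8 + (|χ| + 1) / τ ^ 2, ?_⟩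
    have e : τ ^ 2 * (8 + (|χ| + 1) / τ ^ 2) = 8 * τ ^ 2 + |χ| + 1 := by
      field_simp
      ring
    have h1 : 1 ≤ (χ - τ ^ 2 * (8 + (|χ| + 1) / τ ^ 2)) ^ 2 := by
      rw [e]
      nlinarith [le_abs_self χ]
    have h2 : 0 ≤ (|χ| + 1) / τ ^ 2 := by positivity
    rw [D2minus]
    nlinarith

theorem D2minus_lambda2 {χ τ : ℝ} (h : τ ≠ 0 ∨ χ ≠ 0) : D2minus χ τ (lambda2 χ τ) = 0 := by
  obtain ⟨lam, hlam⟩ := exists_D2minus_nonneg h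
  obtain ⟨l, -, hl0⟩ := exists_D2minus_root_le hlam
  have hcl : IsClosed {lam : ℝ | D2minus χ τ lam = 0} :=
    isClosed_eq (continuous_D2minus χ τ) continuous_const
  exact hcl.csInf_mem ⟨l, hl0⟩ (bddBelow_D2minus χ τ)

/-! ### The region `R₁₂` in terms of polynomial inequalities -/

/-- The upper end of the interval of admissible `λ`. -/
def lambdaMax (χ τ : ℝ) : ℝ := if chi0 τ ≤ χ then lambda2 χ τ else lambda3 χ τ

theorem mem_R12_iff {χ τ lam : ℝ} :
    (χ, τ, lam) ∈ R12 ↔ chiC τ < χ ∧ lambda1 χ τ < lam ∧ lam < lambdaMax χ τ := Iff.rfl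

theorem ne_zero_or_of_chiC_lt {χ τ : ℝ} (h : chiC τ < χ) : τ ≠ 0 ∨ χ ≠ 0 := by
  obtain ⟨r, hr, h2, -⟩ := exists_lower_param h
  by_contra hcon
  push Not at hcon
  rw [hcon.1, hcon.2] at h2
  norm_num at h2

/-- In normalised variables the claim is 8m⁶w ≤ 1. For m² ≤ 1/2 it follows from w < 1, and for m² >
1/2 from 3m⁴ < 1 - 2m⁶w. It places λ on the first increasing branch of 𝒟₂⁻, whose λ-derivative is
s(3s + 2χ). -/
theorem Admissible.three_mul_le {χ τ lam : ℝ} (h : Admissible χ τ lam) :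
    3 * (τ ^ 2 * lam - χ) + 2 * χ ≤ 0 := by
  obtain ⟨ρ, m, w, hρ, rfl, rfl, rfl, hs⟩ := exists_normalization h.neg
  obtain ⟨h1, h2, h3, h4⟩ := h.normalized hρ
  rw [hs]
  have h8 : 8 * m ^ 6 * w ≤ 1 := by
    by_contra hcon
    push Not at hcon
    have h5 : 1 / 2 < m ^ 2 := by
      by_contra hm
      push Not at hm
      have h6 : (m ^ 2) ^ 3 ≤ (1 / 2) ^ 3 := pow_le_pow_left₀ (by positivity) hm 3
      have h7 : m ^ 6 * w ≤ m ^ 6 * 1 := mul_le_mul_of_nonneg_left h3.le (by positivity)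
      nlinarith
    nlinarith
  have e : 3 * (-2 / ρ ^ 2) + 2 * (2 / ρ ^ 2 * (1 + 4 * m ^ 6 * w))
      = 2 / ρ ^ 2 * (8 * m ^ 6 * w - 1) := by
    field_simp
    ring
  rw [e]
  exact mul_nonpos_of_nonneg_of_nonpos (by positivity) (by linarith)

/-- 𝒟₂⁻ is increasing on (-∞, λ]; the expansion in μ = λ - l makes this explicit with every
correction of the same sign. -/
theorem Admissible.D2minus_neg_of_le {χ τ lam l : ℝ} (h : Admissible χ τ lam) (hl : l ≤ lam) :
    D2minus χ τ l < 0 := by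
  obtain ⟨μ, hμ, rfl⟩ : ∃ μ, 0 ≤ μ ∧ l = lam - μ := ⟨lam - l, by linarith, by ring⟩
  have h1 := h.three_mul_le
  obtain ⟨h2, h3, -, -, h5, -⟩ := h
  set s := τ ^ 2 * lam - χ with hs
  have e : D2minus χ τ (lam - μ) = s ^ 2 * lam - 8 - μ * (s * (3 * s + 2 * χ)
      - (3 * s + χ) * (τ ^ 2 * μ) + (τ ^ 2 * μ) ^ 2) := by
    rw [D2minus, hs]
    ring
  have h6 : 0 ≤ s * (3 * s + 2 * χ) := mul_nonneg_of_nonpos_of_nonpos h2.le h1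
  have h7 : 0 ≤ -(3 * s + χ) * (τ ^ 2 * μ) := mul_nonneg (by linarith) (by positivity)
  have h8 : 0 ≤ μ * (s * (3 * s + 2 * χ) - (3 * s + χ) * (τ ^ 2 * μ) + (τ ^ 2 * μ) ^ 2) :=
    mul_nonneg hμ (by nlinarith [sq_nonneg (τ ^ 2 * μ)])
  rw [e]
  linarith

theorem Admissible.lt_lambdaMax {χ τ lam : ℝ} (h : Admissible χ τ lam) (hc : chiC τ < χ) :
    lam < lambdaMax χ τ := by
  rw [lambdaMax]
  split_ifs with h0
  · by_contra hcon
    exact (h.D2minus_neg_of_le (not_lt.1 hcon)).ne (D2minus_lambda2 (ne_zero_or_of_chiC_lt hc))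
  · have hτ : τ ≠ 0 := by
      rintro rfl
      refine h0 (chi0_le_iff.2 ?_)
      have := h.neg
      norm_num at this ⊢
      positivity
    exact (lt_lambda3_iff hτ lam).2 ⟨h.neg, h.neg', h.D1_pos⟩

/-- For χ ≥ χ₀ the local maximum of 𝒟₂⁻ is nonnegative, so λ < λ₂ stays to the left of it. That
bounds m² by 1/2 and forces 𝒟₁ > 0. -/
theorem admissible_of_chi0_le {χ τ lam : ℝ} (h0 : chi0 τ ≤ χ) (hc : τ ≠ 0 ∨ χ ≠ 0)
    (h1 : 0 < D2plus χ τ lam) (h2 : lam < lambda2 χ τ) : Admissible χ τ lam := by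
  have hχ3 := chi0_le_iff.1 h0
  have hχ : 0 < χ := by
    rcases eq_or_ne χ 0 with rfl | hχ
    · have hτ : τ ≠ 0 := by simpa using hc
      have : 0 < τ ^ 2 := by positivity
      norm_num at hχ3
      linarith
    · exact lt_of_le_of_ne ((chi0_nonneg τ).trans h0) hχ.symm
  have hD := D2minus_neg_of_lt h2
  have hs : 3 * (τ ^ 2 * lam - χ) + 2 * χ < 0 := by
    by_contra hcon
    push Not at hcon
    have hτ0 : τ ≠ 0 := by
      rintro rfl
      norm_num at hcon
      linarith
    have hτ : 0 < τ ^ 2 := by positivity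
    -- χ/(3τ²) is the local maximum point of 𝒟₂⁻, and the value there has the sign of χ³ - 54τ².
    have h3 : χ / (3 * τ ^ 2) ≤ lam := by
      rw [div_le_iff₀ (by positivity)]
      linarith
    have h4 := D2minus_neg_of_lt (h3.trans_lt h2)
    have e : D2minus χ τ (χ / (3 * τ ^ 2)) = 4 / (27 * τ ^ 2) * (χ ^ 3 - 54 * τ ^ 2) := by
      rw [D2minus]
      field_simp
      ring
    rw [e] at h4
    exact absurd h4 (not_lt.2 (mul_nonneg (by positivity) (by linarith)))
  have h8 : (τ ^ 2 * lam - χ) ^ 2 * lam < 8 := by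
    rw [D2minus] at hD
    linarith [sub_sq_comm (τ ^ 2 * lam) χ]
  have h9 : -8 < (τ ^ 2 * lam - χ) ^ 2 * lam := by
    rw [D2plus] at h1
    linarith [sub_sq_comm (τ ^ 2 * lam) χ]
  refine ⟨by linarith, by linarith, ?_, h9, h8, ?_⟩
  · obtain ⟨ρ, m, w, hρ, rfl, rfl, rfl, e⟩ :=
      exists_normalization (by linarith : τ ^ 2 * lam - χ < 0)
    rw [e] at hs h8 h9 ⊢
    have e4 : (-2 / ρ ^ 2) ^ 2 * (2 * w * ρ ^ 4) = 8 * w := by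
      field_simp
      ring
    rw [e4] at h8 h9
    have e3 : -2 / ρ ^ 2 * (3 * (-2 / ρ ^ 2) + 2 / ρ ^ 2 * (1 + 4 * m ^ 6 * w))
        = 8 / ρ ^ 4 * (1 - 2 * m ^ 6 * w) := by
      field_simp
      ring
    have e3' : 864 * (2 * m ^ 3 / ρ ^ 3) ^ 4 = (8 / ρ ^ 4 * (3 * m ^ 4)) ^ 3 := by
      field_simp
      ring
    rw [e3, e3', (Odd.strictMono_pow (by decide : Odd 3)).lt_iff_lt,
      mul_lt_mul_iff_right₀ (by positivity)]
    have e5 : 54 * (2 * m ^ 3 / ρ ^ 3) ^ 2 = (2 / ρ ^ 2 * (3 * m ^ 2)) ^ 3 := by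
      field_simp
      ring
    rw [e5, (Odd.strictMono_pow (by decide : Odd 3)).le_iff_le,
      mul_le_mul_iff_right₀ (by positivity)] at hχ3
    have e6 : 3 * (-2 / ρ ^ 2) + 2 * (2 / ρ ^ 2 * (1 + 4 * m ^ 6 * w))
        = 2 / ρ ^ 2 * (8 * m ^ 6 * w - 1) := by
      field_simp
      ring
    rw [e6] at hs
    have h10 : 8 * m ^ 6 * w - 1 < 0 := by
      by_contra hcon
      exact absurd hs (not_lt.2 (mul_nonneg (by positivity) (not_lt.1 hcon)))
    have h11 : m ^ 2 < 1 / 2 := by linarith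
    have h12 : m ^ 6 * w ≤ m ^ 6 * 1 := mul_le_mul_of_nonneg_left (by linarith) (by positivity)
    -- 1 - 2m⁶ - 3m⁴ = (1 - 2m²)(1 + m²)².
    nlinarith [mul_pos (by linarith : 0 < 1 - 2 * m ^ 2)
      (by positivity : 0 < (1 + m ^ 2) ^ 2)]
  · have : 0 ≤ 54 * τ ^ 2 := by positivity
    have : 0 < χ ^ 3 := by positivity
    linarith

/-- For χ < χ₀ the bound s²λ < 8 is automatic: τ²s²λ = s²(s + χ), and for χ > 0 its maximum over s <
0 is 4χ³/27 < 8τ², by 4χ³/27 - s²(s + χ) = (χ/3 - s)(s + 2χ/3)². -/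
theorem D2minus_bound {χ τ lam : ℝ} (h0 : χ ^ 3 < 54 * τ ^ 2) (hs : τ ^ 2 * lam - χ < 0)
    (hs' : 3 * (τ ^ 2 * lam - χ) + χ < 0) : (τ ^ 2 * lam - χ) ^ 2 * lam < 8 := by
  have hτ : 0 < τ ^ 2 := by
    rcases eq_or_ne τ 0 with rfl | hτ
    · norm_num at h0 hs hs'
      have : 0 < χ ^ 3 := by positivity
      linarith
    · positivity
  have e : τ ^ 2 * ((τ ^ 2 * lam - χ) ^ 2 * lam)
      = (τ ^ 2 * lam - χ) ^ 2 * ((τ ^ 2 * lam - χ) + χ) := by ring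
  have h : (τ ^ 2 * lam - χ) ^ 2 * ((τ ^ 2 * lam - χ) + χ) < τ ^ 2 * 8 := by
    generalize τ ^ 2 * lam - χ = s at *
    rcases le_or_gt χ 0 with hχ | hχ
    · have : s ^ 2 * (s + χ) ≤ 0 :=
        mul_nonpos_of_nonneg_of_nonpos (sq_nonneg s) (by linarith)
      linarith
    · nlinarith [mul_nonneg (by linarith : 0 ≤ χ / 3 - s) (sq_nonneg (s + 2 * χ / 3))]
  rw [← e] at h
  exact lt_of_mul_lt_mul_left h hτ.le

theorem ne_zero_of_lt_chi0 {χ τ : ℝ} (hc : chiC τ < χ) (h0 : ¬ chi0 τ ≤ χ) : τ ≠ 0 := by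
  rintro rfl
  have h1 := neg_pow_three_lt hc
  rw [chi0_le_iff] at h0
  norm_num at h0 h1
  linarith

/-- This replaces the infima that define λ₁, λ₂, λ₃ by polynomial inequalities. Only strict
inequalities between continuous functions occur, so nearby parameters remain admissible. -/
theorem mem_R12_iff_admissible {χ τ lam : ℝ} :
    (χ, τ, lam) ∈ R12 ↔ chiC τ < χ ∧ Admissible χ τ lam := by
  rw [mem_R12_iff]
  refine and_congr_right fun hc => ⟨?_, fun h => ⟨?_, h.lt_lambdaMax hc⟩⟩
  · rintro ⟨h1, h2⟩
    rw [lambda1_lt_iff hc] at h1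
    rw [lambdaMax] at h2
    split_ifs at h2 with h0
    · exact admissible_of_chi0_le h0 (ne_zero_or_of_chiC_lt hc) h1 h2
    · obtain ⟨h3, h4, h5⟩ := (lt_lambda3_iff (ne_zero_of_lt_chi0 hc h0) lam).1 h2
      rw [chi0_le_iff, not_le] at h0
      rw [D2plus, sub_sq_comm] at h1
      exact ⟨h3, h4, h5, by linarith, D2minus_bound h0 h3 h4, neg_pow_three_lt hc⟩
  · rw [lambda1_lt_iff hc, D2plus, sub_sq_comm]
    linarith [h.D2plus_pos]

/-- λ₁ = -2r² is negative, whereas 𝒟₂⁻ has no root λ ≤ 0. When the upper end is λ₃, it suffices that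
𝒟₁ is positive at λ₁, with the right signs of s and 3s + χ. -/
theorem lambda1_lt_lambdaMax {χ τ : ℝ} (hc : chiC τ < χ) : lambda1 χ τ < lambdaMax χ τ := by
  obtain ⟨r, hr, h2, h4, -⟩ := exists_lower_param hc
  rw [lambda1_eq hr h2 h4, lambdaMax]
  have hr2 : 0 < r ^ 2 := by positivity
  split_ifs with h0
  · have h3 := D2minus_lambda2 (ne_zero_or_of_chiC_lt hc)
    by_contra hcon
    exact (D2minus_neg_of_nonpos (by linarith)).ne h3
  · have hχ : χ = 2 / r - 2 * τ ^ 2 * r ^ 2 := by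
      field_simp
      linarith
    have hs : τ ^ 2 * (-2 * r ^ 2) - χ = -2 / r := by
      rw [hχ]
      ring
    have hτ := ne_zero_of_lt_chi0 hc h0
    rw [lt_lambda3_iff hτ, hs, hχ]
    have e : 3 * (-2 / r) + (2 / r - 2 * τ ^ 2 * r ^ 2) = -(4 / r + 2 * τ ^ 2 * r ^ 2) := by
      ring
    rw [e]
    refine ⟨div_neg_of_neg_of_pos (by norm_num) hr, neg_lt_zero.2 (by positivity), ?_⟩
    have e2 : (-2 / r * -(4 / r + 2 * τ ^ 2 * r ^ 2)) ^ 3 - 864 * τ ^ 4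
        = 512 / r ^ 6 * ((1 - τ ^ 2 * r ^ 3 / 4) ^ 2 * (1 + 2 * (τ ^ 2 * r ^ 3))) := by
      field_simp
      ring
    have h5 : 0 < 1 - τ ^ 2 * r ^ 3 / 4 := by linarith
    have h6 : 0 < 512 / r ^ 6 * ((1 - τ ^ 2 * r ^ 3 / 4) ^ 2 * (1 + 2 * (τ ^ 2 * r ^ 3))) := by
      positivity
    linarith

/-- At the upper end of the interval, `R(z)²` has a real root, but its two pairs of roots have
different real parts. -/
theorem lambdaMax_spec {χ τ : ℝ} (hc : chiC τ < χ) :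
    τ ^ 2 * lambdaMax χ τ - χ < 0 ∧ (∃ x : ℝ, rsq χ τ (lambdaMax χ τ) x = 0) ∧
      ∀ c a b : ℝ, ¬ IsSplit χ τ (lambdaMax χ τ) c a c b := by
  have h12 := lambda1_lt_lambdaMax hc
  rw [lambda1_lt_iff hc, D2plus, sub_sq_comm] at h12
  have hne := ne_zero_or_of_chiC_lt hc
  have h0 : chi0 τ ≤ χ ∧ D2minus χ τ (lambdaMax χ τ) = 0 ∨ ¬ chi0 τ ≤ χ ∧ τ ≠ 0 ∧
      ∃ c t : ℝ, 0 < c ∧ c ^ 3 = 864 * τ ^ 4 ∧ |χ| < t ∧ t ^ 2 = χ ^ 2 + 12 * c ∧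
        τ ^ 2 * lambdaMax χ τ - χ = -(χ + t) / 6 := by
    rw [lambdaMax]
    split_ifs with h0
    · exact Or.inl ⟨h0, D2minus_lambda2 hne⟩
    · have hτ := ne_zero_of_lt_chi0 hc h0
      exact Or.inr ⟨h0, hτ, lambda3_spec χ hτ⟩
  -- The upper end is a limit of admissible λ, for which s < 0.
  have hlim : chi0 τ ≤ χ → τ ^ 2 * lambdaMax χ τ - χ ≤ 0 := by
    intro h0
    rw [← not_lt]
    intro hcon
    have hopen : ∀ᶠ l in nhds (lambdaMax χ τ), 0 < τ ^ 2 * l - χ := by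
      have : ContinuousAt (fun l : ℝ => τ ^ 2 * l - χ) (lambdaMax χ τ) := by fun_prop
      exact this.eventually (lt_mem_nhds hcon)
    obtain ⟨l, hl, hl1, hl2⟩ := ((hopen.filter_mono nhdsWithin_le_nhds).and
      (Ioo_mem_nhdsLT (lambda1_lt_lambdaMax hc))).exists
    have := (mem_R12_iff_admissible.1 (mem_R12_iff.2 ⟨hc, hl1, hl2⟩)).2.neg
    linarith
  generalize lambdaMax χ τ = lam at *
  rcases h0 with ⟨h0, h2⟩ | ⟨h0, hτ, c, t, hc0, hc3, ht, ht2, hs⟩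
  · rw [D2minus, sub_sq_comm, sub_eq_zero] at h2
    have hs0 : τ ^ 2 * lam - χ ≠ 0 := by
      intro e
      rw [e] at h2
      norm_num at h2
    have hs : τ ^ 2 * lam - χ < 0 := lt_of_le_of_ne (hlim h0) hs0
    have hlam : 0 < lam := by
      by_contra hcon
      have := mul_nonpos_of_nonneg_of_nonpos (sq_nonneg (τ ^ 2 * lam - χ)) (not_lt.1 hcon)
      linarith
    refine ⟨hs, ?_, ?_⟩
    · obtain ⟨ρ, m, w, hρ, rfl, rfl, rfl, e⟩ := exists_normalization hs
      have hw : w = 1 := by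
        have e4 : (-2 / ρ ^ 2) ^ 2 * (2 * w * ρ ^ 4) = 8 * w := by
          field_simp
          ring
        rw [e, e4] at h2
        linarith
      -- For w = 1 the normalised quartic is (x² + 2m³x - 1)², and this is one of its double roots.
      refine ⟨ρ * (√(m ^ 6 + 1) - m ^ 3), ?_⟩
      have hsq : √(m ^ 6 + 1) ^ 2 = m ^ 6 + 1 := Real.sq_sqrt (by positivity)
      have h1 : (√(m ^ 6 + 1) - m ^ 3) ^ 2 + 2 * m ^ 3 * (√(m ^ 6 + 1) - m ^ 3) - 1 = 0 := by
        linear_combination hsq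
      rw [rsq_normalized hρ, hw]
      generalize √(m ^ 6 + 1) - m ^ 3 = x at *
      have : (x ^ 2 + 2 * 1 * m ^ 3 * x) ^ 2 - 2 * 1 * x ^ 2 - 4 * m ^ 3 * x + 1
        = (x ^ 2 + 2 * m ^ 3 * x - 1) ^ 2 := by ring
      rw [this, h1]
      ring
    · intro c a b hsp
      have h3 := hsp.coeff3
      have h4 := hsp.coeff2
      -- Equal real parts would make sλ a sum of squares, but here s < 0 < λ.
      have h5 : (τ ^ 2 * lam - χ) * lam = 4 * c ^ 2 + 2 * a ^ 2 + 2 * b ^ 2 := by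
        have : c = -(τ * lam) / 4 := by linarith
        subst this
        linarith
      have := mul_neg_of_neg_of_pos hs hlam
      nlinarith [sq_nonneg a, sq_nonneg b, sq_nonneg c]
  · obtain ⟨ht1, ht3⟩ := abs_lt.1 ht
    have hs0 : τ ^ 2 * lam - χ < 0 := by
      rw [hs]
      linarith
    have hs1 : 3 * (τ ^ 2 * lam - χ) + χ < 0 := by
      rw [hs]
      linarith
    have hD : ((τ ^ 2 * lam - χ) * (3 * (τ ^ 2 * lam - χ) + χ)) ^ 3 = 864 * τ ^ 4 := by
      rw [← hc3, hs]
      congr 1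
      linear_combination ht2 / 12
    rw [chi0_le_iff, not_le] at h0
    have h8 := D2minus_bound h0 hs0 hs1
    refine ⟨hs0, ?_, fun c a b hsp => ?_⟩
    · obtain ⟨ρ, m, w, hρ, rfl, rfl, rfl, e⟩ := exists_normalization hs0
      -- 𝒟₁ = 0 is the locus where x = m is a zero of the normalised quartic.
      refine ⟨ρ * m, ?_⟩
      rw [e] at hD
      have e3 : -2 / ρ ^ 2 * (3 * (-2 / ρ ^ 2) + 2 / ρ ^ 2 * (1 + 4 * m ^ 6 * w))
          = 8 / ρ ^ 4 * (1 - 2 * m ^ 6 * w) := by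
        field_simp
        ring
      have e3' : 864 * (2 * m ^ 3 / ρ ^ 3) ^ 4 = (8 / ρ ^ 4 * (3 * m ^ 4)) ^ 3 := by
        field_simp
        ring
      rw [e3, e3', (Odd.strictMono_pow (by decide : Odd 3)).injective.eq_iff] at hD
      have h1 := mul_left_cancel₀ (by positivity : 8 / ρ ^ 4 ≠ 0) hD
      rw [rsq_normalized hρ]
      have hm : m ^ 4 ≠ 0 := by
        intro e
        have : m = 0 := by simpa using e
        rw [this] at h1
        norm_num at h1
      have h2 : m ^ 4 * ((m ^ 2 + 2 * w * m ^ 3 * m) ^ 2 - 2 * w * m ^ 2 - 4 * m ^ 3 * m + 1)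
          = 0 := by
        have hw : 2 * m ^ 6 * w = 1 - 3 * m ^ 4 := by linarith
        linear_combination (2 * m ^ 6 * w - m ^ 4) * hw
      rw [(mul_eq_zero.1 h2).resolve_left hm, mul_zero]
    · have h1 := hsp.depressed hs0.ne
      have h3 := (mul_eq_zero.1 h1).resolve_left hτ
      nlinarith

/-! ### The principal square root -/

theorem sqrt_sq (z : ℂ) : Complex.sqrt z ^ 2 = z := by
  have := cpow_nat_inv_pow z two_ne_zero
  exact_mod_cast this

theorem sqrt_ne_zero {z : ℂ} (hz : z ≠ 0) : Complex.sqrt z ≠ 0 := by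
  intro h
  have := sqrt_sq z
  rw [h] at this
  exact hz (by simpa using this.symm)

theorem sqrt_re_nonneg (z : ℂ) : 0 ≤ (Complex.sqrt z).re := by
  rw [Complex.sqrt, cpow_inv_two_re]
  positivity

theorem norm_sqrt_sq (z : ℂ) : ‖Complex.sqrt z‖ ^ 2 = ‖z‖ := by
  rw [← norm_pow, sqrt_sq]

theorem sqrt_re_pos {z : ℂ} (hz : z ∈ slitPlane) : 0 < (Complex.sqrt z).re := by
  refine lt_of_le_of_ne (sqrt_re_nonneg z) fun h => ?_
  have e := sqrt_sq z
  have h1 : z = ((-(Complex.sqrt z).im ^ 2 : ℝ) : ℂ) := by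
    refine e.symm.trans ?_
    apply Complex.ext
    · simp only [sq, mul_re, ← h, ofReal_re]
      ring
    · simp only [sq, mul_im, ← h, ofReal_im]
      ring
  rw [h1, ofReal_mem_slitPlane] at hz
  nlinarith [sq_nonneg (Complex.sqrt z).im]

theorem eq_sqrt_of_sq {w z : ℂ} (h : w ^ 2 = z) (hw : 0 < w.re) : w = Complex.sqrt z := by
  have h1 : (w - Complex.sqrt z) * (w + Complex.sqrt z) = 0 := by
    linear_combination h - sqrt_sq z
  rcases mul_eq_zero.1 h1 with h2 | h2
  · exact sub_eq_zero.1 h2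
  · have := congrArg Complex.re h2
    rw [add_re, zero_re] at this
    linarith [sqrt_re_nonneg z]

theorem sqrt_ofReal_sq {x : ℝ} (hx : 0 < x) : Complex.sqrt ((x : ℂ) ^ 2) = x :=
  (eq_sqrt_of_sq rfl (by simpa using hx)).symm

/-! ### The function `R` -/

theorem rootFactor_eq (α β z : ℂ) : rootFactor α β z
    = (z - (α + β) / 2) * Complex.sqrt (1 - ((β - α) / 2 / (z - (α + β) / 2)) ^ 2) := by
  rw [rootFactor, Complex.sqrt, one_div]

theorem rootFactor_sq {α β z : ℂ} (hz : z ≠ (α + β) / 2) :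
    rootFactor α β z ^ 2 = (z - α) * (z - β) := by
  have : z - (α + β) / 2 ≠ 0 := sub_ne_zero.2 hz
  rw [rootFactor_eq, mul_pow, sqrt_sq, div_pow, mul_sub, mul_div_cancel₀ _ (pow_ne_zero 2 this)]
  ring

theorem R_conj (α β z : ℂ) : R α β (conj z) = conj (R α β z) := by
  rw [R, R, map_mul, conj_conj, conj_conj, mul_comm]

theorem R_sq {α β z : ℂ} (h1 : z ≠ (α + β) / 2) (h2 : conj z ≠ (α + β) / 2) :
    R α β z ^ 2 = ((z - α) * (z - conj α)) * ((z - β) * (z - conj β)) := by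
  rw [R, mul_pow, ← map_pow, rootFactor_sq h1, rootFactor_sq h2]
  simp only [map_mul, map_sub, conj_conj]
  ring

theorem ne_midpoint {α β z : ℂ} (hαβ : α.re < β.re) (hz : z.re ≤ α.re) : z ≠ (α + β) / 2 := by
  rintro rfl
  have : ((α + β) / 2).re = (α.re + β.re) / 2 := by
    rw [← add_re]
    exact div_ofNat_re (α + β) 2
  linarith

/-- 1 - u² meets the cut only for real u with |u| ≥ 1, which means that z lies on the segment from α
to β; comparison of real parts excludes this to the left of α. -/
theorem rootFactor_arg_mem_slitPlane {α β z : ℂ} (hαβ : α.re ≤ β.re) (hz : z.re < α.re) :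
    1 - ((β - α) / 2 / (z - (α + β) / 2)) ^ 2 ∈ slitPlane := by
  have hre : (z - (α + β) / 2).re = z.re - (α.re + β.re) / 2 := by
    rw [sub_re, ← add_re]
    congr 1
    exact div_ofNat_re (α + β) 2
  have hne : z - (α + β) / 2 ≠ 0 := by
    intro h
    rw [h, zero_re] at hre
    linarith
  obtain ⟨u, hu⟩ : ∃ u, u = (β - α) / 2 / (z - (α + β) / 2) := ⟨_, rfl⟩
  rw [← hu]
  rw [eq_div_iff hne] at hu
  by_contra hcon
  rw [mem_slitPlane_iff, not_or, not_lt, not_ne_iff] at hcon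
  obtain ⟨h1, h2⟩ := hcon
  simp only [sub_re, one_re, sub_im, one_im, sq, mul_re, mul_im] at h1 h2
  have h3 : u.im = 0 := by
    have : u.re * u.im = 0 := by linarith
    rcases mul_eq_zero.1 this with h | h
    · rw [h] at h1
      nlinarith [sq_nonneg u.im]
    · exact h
  have h4 := congrArg Complex.re hu
  have h5 : ((β - α) / 2).re = (β.re - α.re) / 2 := by
    rw [← sub_re]
    exact div_ofNat_re (β - α) 2
  rw [mul_re, h3, zero_mul, sub_zero, hre, h5] at h4
  rw [h3] at h1
  rcases le_or_gt 1 u.re with h6 | h6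
  · nlinarith
  · have : u.re ≤ -1 := by nlinarith
    nlinarith

theorem continuousOn_rootFactor {α β : ℂ} (hαβ : α.re ≤ β.re) :
    ContinuousOn (rootFactor α β) {z | z.re < α.re} := by
  intro z hz
  have hne : z - (α + β) / 2 ≠ 0 := by
    intro h
    have := rootFactor_arg_mem_slitPlane hαβ hz
    have h1 := congrArg Complex.re h
    have : ((α + β) / 2).re = (α.re + β.re) / 2 := by
      rw [← add_re]
      exact div_ofNat_re (α + β) 2
    rw [sub_re, this, zero_re] at h1
    have hz : z.re < α.re := hz
    linarith
  have h : ContinuousAt (fun z => (z - (α + β) / 2) *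
      Complex.sqrt (1 - ((β - α) / 2 / (z - (α + β) / 2)) ^ 2)) z := by
    refine ContinuousAt.mul (by fun_prop) (ContinuousAt.comp
      (g := Complex.sqrt) (f := fun z => 1 - ((β - α) / 2 / (z - (α + β) / 2)) ^ 2)
      (differentiableAt_sqrt (rootFactor_arg_mem_slitPlane hαβ hz)).continuousAt ?_)
    fun_prop (disch := assumption)
  exact (h.congr (.of_forall fun z => (rootFactor_eq α β z).symm)).continuousWithinAt

theorem continuousOn_R {α β : ℂ} (hαβ : α.re ≤ β.re) :
    ContinuousOn (R α β) {z | z.re < α.re} := by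
  refine (continuousOn_rootFactor hαβ).mul (continuous_conj.comp_continuousOn
    ((continuousOn_rootFactor hαβ).comp continuous_conj.continuousOn fun z hz => ?_))
  simpa using hz

/-- The quadratic polynomial with roots `c ± i a`. -/
def quad (c a : ℝ) (z : ℂ) : ℂ := (z - c) ^ 2 + (a : ℂ) ^ 2

/-- The imaginary part 2(Re z - c) Im z vanishes in Re z < c only for real z, and there the value is
positive. So the principal root of each quadratic factor is analytic on the half-plane. -/
theorem quad_mem_slitPlane {c a : ℝ} {z : ℂ} (hz : z.re < c) : quad c a z ∈ slitPlane := by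
  rw [mem_slitPlane_iff]
  have h1 : (quad c a z).re = (z.re - c) ^ 2 - z.im ^ 2 + a ^ 2 := by
    simp only [quad, sq, add_re, mul_re, sub_re, sub_im, ofReal_re, ofReal_im]
    ring
  have h2 : (quad c a z).im = 2 * (z.re - c) * z.im := by
    simp only [quad, sq, add_im, mul_im, sub_re, sub_im, ofReal_re, ofReal_im]
    ring
  rcases eq_or_ne z.im 0 with h | h
  · left
    rw [h1, h]
    have : 0 < (z.re - c) ^ 2 := sq_pos_of_neg (by linarith)
    nlinarith [sq_nonneg a]
  · right
    rw [h2]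
    exact mul_ne_zero (mul_ne_zero two_ne_zero (by linarith)) h

/-- An explicit formula for `R` to the left of the branch cuts. -/
def Rleft (c a d b : ℝ) (z : ℂ) : ℂ := Complex.sqrt (quad c a z) * Complex.sqrt (quad d b z)

theorem Rleft_sq (c a d b : ℝ) (z : ℂ) : Rleft c a d b z ^ 2 = quad c a z * quad d b z := by
  rw [Rleft, mul_pow, sqrt_sq, sqrt_sq]

theorem Rleft_ne_zero {c a d b : ℝ} (hcd : c ≤ d) {z : ℂ} (hz : z.re < c) :
    Rleft c a d b z ≠ 0 :=
  mul_ne_zero (sqrt_ne_zero (slitPlane_ne_zero (quad_mem_slitPlane hz)))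
    (sqrt_ne_zero (slitPlane_ne_zero (quad_mem_slitPlane (hz.trans_le hcd))))

theorem differentiable_quad (c a : ℝ) : Differentiable ℂ (quad c a) := by
  unfold quad
  fun_prop

theorem differentiableAt_Rleft {c a d b : ℝ} (hcd : c ≤ d) {z : ℂ} (hz : z.re < c) :
    DifferentiableAt ℂ (Rleft c a d b) z :=
  ((differentiableAt_sqrt (quad_mem_slitPlane hz)).comp z (differentiable_quad c a z)).mul
    ((differentiableAt_sqrt (quad_mem_slitPlane (hz.trans_le hcd))).comp z
      (differentiable_quad d b z))

theorem isPreconnected_re_lt (c : ℝ) : IsPreconnected {z : ℂ | z.re < c} :=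
  (convex_halfSpace_re_lt c).isPreconnected

theorem R_sq_of_re_lt {α β z : ℂ} (hαβ : α.re ≤ β.re) (hz : z.re < α.re) :
    R α β z ^ 2 = Rleft α.re α.im β.re β.im z ^ 2 := by
  have h0 : ∀ w : ℂ, w.re < α.re → w ≠ (α + β) / 2 := by
    rintro w hw rfl
    have : ((α + β) / 2).re = (α.re + β.re) / 2 := by
      rw [← add_re]
      exact div_ofNat_re (α + β) 2
    linarith
  rw [R_sq (h0 z hz) (h0 _ (by simpa using hz)), Rleft_sq, quad, quad, quadratic_eq_mul,
    quadratic_eq_mul]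

/-- Two continuous square roots of the same nonvanishing function on a connected half-plane agree
once they agree at one point; on the real axis both are nonnegative. -/
theorem R_eq_Rleft {α β z : ℂ} (hαβ : α.re ≤ β.re) (hz : z.re < α.re) :
    R α β z = Rleft α.re α.im β.re β.im z := by
  have hp : ((α.re - 1 : ℝ) : ℂ) ∈ {z : ℂ | z.re < α.re} := by
    change ((α.re - 1 : ℝ) : ℂ).re < _
    rw [ofReal_re]
    linarith
  refine (isPreconnected_re_lt α.re).eq_of_sq_eq (continuousOn_R hαβ)
    (fun z hz => (differentiableAt_Rleft hαβ hz).continuousAt.continuousWithinAt)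
    (fun z hz => R_sq_of_re_lt hαβ hz) (fun {z} hz => Rleft_ne_zero hαβ hz) hp ?_ hz
  have hsq := R_sq_of_re_lt hαβ hp
  generalize α.re - 1 = x at *
  have hq : ∀ c a x : ℝ, c ≠ x → ∃ t : ℝ, 0 < t ∧ Complex.sqrt (quad c a x) = t := by
    intro c a x hx
    have hpos : 0 < (x - c) ^ 2 + a ^ 2 := by
      have : 0 < (x - c) ^ 2 := sq_pos_of_ne_zero (sub_ne_zero.2 hx.symm)
      positivity
    refine ⟨√((x - c) ^ 2 + a ^ 2), Real.sqrt_pos.2 hpos, ?_⟩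
    rw [← sqrt_ofReal_sq (Real.sqrt_pos.2 hpos), ← ofReal_pow, Real.sq_sqrt hpos.le, quad]
    push_cast
    rfl
  have hx : x < α.re := by simpa using hp
  obtain ⟨t, ht, h1⟩ := hq α.re α.im x hx.ne'
  obtain ⟨u, hu, h2⟩ := hq β.re β.im x (hx.trans_le hαβ).ne'
  obtain ⟨y, hy, h3⟩ : ∃ y : ℝ, 0 ≤ y ∧ R α β x = y :=
    ⟨‖rootFactor α β x‖ ^ 2, by positivity, by
      rw [R, conj_ofReal, mul_conj, normSq_eq_norm_sq]⟩
  rw [Rleft, h1, h2, h3] at hsq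
  rw [Rleft, h1, h2, h3]
  norm_cast at hsq ⊢
  exact (pow_left_inj₀ hy (by positivity) two_ne_zero).1 hsq

open Filter Topology MeasureTheory

/-! ### Deformation of the polygonal path into a vertical segment -/

/-- Primitives of holomorphic functions are taken on discs, and the half-plane is exhausted by the
discs of centre c - N and radius N. The point z is inside when N exceeds ((c - Re z)² + (Im z)²) /
(2(c - Re z)). -/
theorem exists_ball_subset (c : ℝ) (S : Finset ℂ) (hS : ∀ z ∈ S, z.re < c) :
    ∃ (x : ℂ) (N : ℝ), Metric.ball x N ⊆ {z | z.re < c} ∧ ∀ z ∈ S, z ∈ Metric.ball x N := by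
  obtain ⟨M, hM⟩ : ∃ M : ℝ, ∀ z ∈ S, ((c - z.re) ^ 2 + z.im ^ 2) / (2 * (c - z.re)) < M := by
    induction S using Finset.induction_on with
    | empty => exact ⟨0, by simp⟩
    | insert w S _ ih =>
      obtain ⟨M, hM⟩ := ih fun z hz => hS z (Finset.mem_insert_of_mem hz)
      refine ⟨max M (((c - w.re) ^ 2 + w.im ^ 2) / (2 * (c - w.re)) + 1), fun z hz => ?_⟩
      rcases Finset.mem_insert.1 hz with rfl | hz
      · exact (lt_add_one _).trans_le (le_max_right _ _)
      · exact (hM z hz).trans_le (le_max_left _ _)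
  set N := max M 1
  have hN : 0 < N := one_pos.trans_le (le_max_right _ _)
  have hball : ∀ z : ℂ, z ∈ Metric.ball ((c - N : ℝ) : ℂ) N ↔
      (z.re - (c - N)) ^ 2 + z.im ^ 2 < N ^ 2 := by
    intro z
    rw [Metric.mem_ball, dist_eq_norm, ← pow_lt_pow_iff_left₀ (norm_nonneg _) hN.le two_ne_zero,
      ← normSq_eq_norm_sq, normSq_apply, sub_re, sub_im, ofReal_re, ofReal_im, sub_zero, ← sq, ← sq]
  refine ⟨((c - N : ℝ) : ℂ), N, fun z hz => ?_, fun z hz => ?_⟩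
  · rw [hball] at hz
    change z.re < c
    nlinarith [sq_nonneg z.im]
  · rw [hball]
    have h1 := (hM z hz).trans_le (le_max_left M 1)
    have h2 := hS z hz
    rw [div_lt_iff₀ (by linarith)] at h1
    change _ < N * _ at h1
    nlinarith

theorem hasDerivAt_line (p w : ℂ) (u : ℝ) :
    HasDerivAt (fun u : ℝ => p + u * (w - p)) (w - p) u := by
  have := ((hasDerivAt_id (u : ℂ)).mul_const (w - p)).const_add p
  rw [one_mul] at this
  exact this.comp_ofReal

theorem hasDerivAt_vertical (e y θ : ℝ) :
    HasDerivAt (fun θ : ℝ => (e + I * (y * Real.sin θ) : ℂ)) (I * (y * Real.cos θ)) θ := by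
  have := ((((Real.hasDerivAt_sin θ).ofReal_comp).const_mul (y : ℂ)).const_mul I).const_add (e : ℂ)
  exact this

/-- Cauchy's theorem for the triangle with apex p, cut off at t < 1 to stay off the branch points.
Only `g` is singular at 0; `F` is not, so its path may be moved across the origin to the vertical
chord, and `H` accounts for the difference. -/
theorem segment_sub_segment {c p : ℝ} {F g H : ℂ → ℂ}
    (hF : DifferentiableOn ℂ F {z | z.re < c})
    (hg : ContinuousOn g {z | z.re < c ∧ z ≠ 0})
    (hH : ∀ z : ℂ, z.re < c → z ≠ 0 → HasDerivAt H (g z - F z) z)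
    (hpc : p < c) (hp0 : p < 0) {α : ℂ} (hα : α.re = c) (hα' : 0 < α.im) {t : ℝ}
    (ht : t ∈ Set.Ico (0 : ℝ) 1) :
    (∫ u in (0 : ℝ)..t, g (p + u * (α - p)) * (α - p)) -
      (∫ u in (0 : ℝ)..t, g (p + u * (conj α - p)) * (conj α - p)) =
    (H (p + t * (α - p)) - H (p + t * (conj α - p))) +
      ∫ θ in (-(Real.pi / 2))..(Real.pi / 2),
        F ((p + t * (c - p) : ℝ) + I * ((t * α.im : ℝ) * Real.sin θ)) *
          (I * ((t * α.im : ℝ) * Real.cos θ)) := by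
  obtain ⟨ht0, ht1⟩ := ht
  have hline : ∀ w : ℂ, w.re = c → ∀ u : ℝ, u < 1 → (p + u * (w - p) : ℂ).re < c := by
    intro w hw u hu
    simp only [add_re, mul_re, sub_re, ofReal_re, ofReal_im, zero_mul, sub_zero, hw]
    nlinarith
  have hline0 : ∀ w : ℂ, w.im ≠ 0 → ∀ u : ℝ, (p + u * (w - p) : ℂ) ≠ 0 := by
    intro w hw u h
    have h1 := congrArg Complex.im h
    have h2 := congrArg Complex.re h
    simp only [add_re, mul_re, sub_re, ofReal_re, ofReal_im, zero_mul, sub_zero, add_im, mul_im,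
      sub_im, zero_re, zero_im, zero_add, add_zero] at h1 h2
    rcases mul_eq_zero.1 h1 with h | h
    · rw [h] at h2
      linarith
    · exact hw h
  have hγ : ((p + t * (α - p) : ℂ).re = p + t * (c - p)) ∧
      (p + t * (α - p) : ℂ).im = t * α.im := by
    constructor <;> simp [hα]
  have hγ' : (p + t * (conj α - p) : ℂ) = conj (p + t * (α - p) : ℂ) := by
    simp
  obtain ⟨x, N, hsub, hmem⟩ := exists_ball_subset c {(p : ℂ), p + t * (α - p), p + t * (conj α - p)}
    (by
      intro z hz
      simp only [Finset.mem_insert, Finset.mem_singleton] at hz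
      rcases hz with rfl | rfl | rfl
      · simpa using hpc
      · exact hline _ hα _ ht1
      · exact hline _ (by simpa using hα) _ ht1)
  obtain ⟨Φ, hΦ⟩ := (hF.mono hsub).isExactOn_ball
  have hconv : Convex ℝ (Metric.ball x N) := convex_ball x N
  have hmp : (p : ℂ) ∈ Metric.ball x N := hmem _ (by simp)
  -- On each slanted side `H + Φ` is a primitive of `g`, since those sides avoid the origin.
  have key : ∀ w : ℂ, w.re = c → w.im ≠ 0 → (p + t * (w - p) : ℂ) ∈ Metric.ball x N →
      ∫ u in (0 : ℝ)..t, g (p + u * (w - p)) * (w - p)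
        = (H (p + t * (w - p)) + Φ (p + t * (w - p))) - (H p + Φ p) := by
    intro w hw hw' hmw
    have hin : ∀ u ∈ Set.uIcc 0 t, (p + u * (w - p) : ℂ) ∈ Metric.ball x N := by
      intro u hu
      rw [Set.uIcc_of_le ht0] at hu
      rcases ht0.lt_or_eq with h0 | h0
      · have := hconv hmp hmw (a := 1 - u / t) (b := u / t)
          (by rw [sub_nonneg, div_le_one h0]; exact hu.2) (div_nonneg hu.1 ht0) (by ring)
        convert this using 1
        have : (t : ℂ) ≠ 0 := by exact_mod_cast h0.ne'
        simp only [real_smul]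
        push_cast
        field_simp
        ring
      · have : u = 0 := le_antisymm (by rw [h0]; exact hu.2) hu.1
        simpa [this] using hmp
    have hder : ∀ u ∈ Set.uIcc 0 t, HasDerivAt (fun u : ℝ => H (p + u * (w - p))
        + Φ (p + u * (w - p))) (g (p + u * (w - p)) * (w - p)) u := by
      intro u hu
      have h1 := hin u hu
      have h2 := (hH _ (hsub h1) (hline0 w hw' u)).add (hΦ _ h1)
      rw [sub_add_cancel] at h2
      exact h2.comp u (hasDerivAt_line p w u)
    have hint : ContinuousOn (fun u : ℝ => g (p + u * (w - p)) * (w - p)) (Set.uIcc 0 t) := by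
      refine ContinuousOn.mul (hg.comp (by fun_prop) fun u hu => ⟨hsub (hin u hu), hline0 w hw' u⟩)
        continuousOn_const
    rw [intervalIntegral.integral_eq_sub_of_hasDerivAt hder hint.intervalIntegrable]
    simp
  have hm1 : (p + t * (α - p) : ℂ) ∈ Metric.ball x N := hmem _ (by simp)
  have hm2 : (p + t * (conj α - p) : ℂ) ∈ Metric.ball x N := hmem _ (by simp)
  have hv : ∀ θ : ℝ, ((p + t * (c - p) : ℝ) + I * ((t * α.im : ℝ) * Real.sin θ) : ℂ) ∈
      Metric.ball x N := by
    intro θ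
    have h1 := Real.sin_le_one θ
    have h2 := Real.neg_one_le_sin θ
    have := hconv hm1 hm2 (a := (1 + Real.sin θ) / 2) (b := (1 - Real.sin θ) / 2)
      (by linarith) (by linarith) (by ring)
    convert this using 1
    rw [hγ']
    apply Complex.ext
    · simp [hα]
      ring
    · simp
      ring
  have hvert : ∫ θ in (-(Real.pi / 2))..(Real.pi / 2),
        F ((p + t * (c - p) : ℝ) + I * ((t * α.im : ℝ) * Real.sin θ)) *
          (I * ((t * α.im : ℝ) * Real.cos θ))
      = Φ (p + t * (α - p)) - Φ (p + t * (conj α - p)) := by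
    have hder : ∀ θ ∈ Set.uIcc (-(Real.pi / 2)) (Real.pi / 2), HasDerivAt
        (fun θ : ℝ => Φ ((p + t * (c - p) : ℝ) + I * ((t * α.im : ℝ) * Real.sin θ)))
        (F ((p + t * (c - p) : ℝ) + I * ((t * α.im : ℝ) * Real.sin θ)) *
          (I * ((t * α.im : ℝ) * Real.cos θ))) θ :=
      fun θ _ => (hΦ _ (hv θ)).comp θ (hasDerivAt_vertical _ _ θ)
    have hint : ContinuousOn (fun θ : ℝ =>
        F ((p + t * (c - p) : ℝ) + I * ((t * α.im : ℝ) * Real.sin θ)) *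
          (I * ((t * α.im : ℝ) * Real.cos θ))) (Set.uIcc (-(Real.pi / 2)) (Real.pi / 2)) := by
      refine ContinuousOn.mul (hF.continuousOn.comp (by fun_prop) fun θ _ => hsub (hv θ))
        (by fun_prop)
    rw [intervalIntegral.integral_eq_sub_of_hasDerivAt hder hint.intervalIntegrable]
    congr 2
    · apply Complex.ext <;> simp [hα]
    · apply Complex.ext <;> simp [hα]
  rw [key α hα hα'.ne' hm1, key (conj α) (by simpa using hα) (by simpa using hα'.ne') hm2, hvert]
  ring

/-! ### Reduction of `f` to an integral along a vertical segment -/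

/-- The polynomial `(2 τ R(z)² - s (R²)'(z) / 2) / z`, where `s = τ² λ - χ`. -/
def numer (χ τ lam : ℝ) (z : ℂ) : ℂ :=
  2 * τ * (z ^ 3 + (τ * lam : ℝ) * z ^ 2
      + (3 / 4 * τ ^ 2 * lam ^ 2 - 1 / 2 * χ * lam : ℝ) * z
      + (16 * τ / (τ ^ 2 * lam - χ) ^ 3 : ℝ))
    - (τ ^ 2 * lam - χ : ℝ) / 2 * (4 * z ^ 2 + 3 * (τ * lam : ℝ) * z
      + 2 * (3 / 4 * τ ^ 2 * lam ^ 2 - 1 / 2 * χ * lam : ℝ))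

/-- The derivative of `Rsq`. -/
def dRsq (χ τ lam : ℝ) (z : ℂ) : ℂ :=
  4 * z ^ 3 + 3 * (τ * lam : ℝ) * z ^ 2
    + 2 * (3 / 4 * τ ^ 2 * lam ^ 2 - 1 / 2 * χ * lam : ℝ) * z
    + (16 * τ / (τ ^ 2 * lam - χ) ^ 3 : ℝ)

theorem continuous_numer (χ τ lam : ℝ) : Continuous (numer χ τ lam) := by
  unfold numer
  fun_prop

theorem continuous_Rsq (χ τ lam : ℝ) : Continuous (Rsq χ τ lam) := by
  unfold Rsq
  fun_prop

/-- The constant terms on the right cancel: 2τ R²(0) = (s/2)(R²)'(0). This is the vanishing of the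
residue of h' at 0, and it makes `numer` a polynomial. -/
theorem mul_numer {χ τ lam : ℝ} (hs : τ ^ 2 * lam - χ ≠ 0) (z : ℂ) :
    z * numer χ τ lam z
      = 2 * τ * Rsq χ τ lam z - (τ ^ 2 * lam - χ : ℝ) / 2 * dRsq χ τ lam z := by
  have e : 2 * τ * (4 / (τ ^ 2 * lam - χ) ^ 2)
      = (τ ^ 2 * lam - χ) / 2 * (16 * τ / (τ ^ 2 * lam - χ) ^ 3) := by
    field_simp
    ring
  have e' : ((2 : ℝ) : ℂ) * τ * (4 / (τ ^ 2 * lam - χ) ^ 2 : ℝ)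
      = (τ ^ 2 * lam - χ : ℝ) / (2 : ℝ) * (16 * τ / (τ ^ 2 * lam - χ) ^ 3 : ℝ) := by
    exact_mod_cast e
  rw [ofReal_ofNat] at e'
  rw [numer, dRsq, Rsq_eq_coeff]
  generalize (((16 * τ / (τ ^ 2 * lam - χ) ^ 3 : ℝ)) : ℂ) = q1 at *
  generalize (((4 / (τ ^ 2 * lam - χ) ^ 2 : ℝ)) : ℂ) = q0 at *
  linear_combination -e'

theorem hasDerivAt_Rsq (χ τ lam : ℝ) (z : ℂ) :
    HasDerivAt (Rsq χ τ lam) (dRsq χ τ lam z) z := by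
  have h : HasDerivAt (fun z : ℂ => z ^ 4 + (τ * lam : ℝ) * z ^ 3
    + (3 / 4 * τ ^ 2 * lam ^ 2 - 1 / 2 * χ * lam : ℝ) * z ^ 2
    + (16 * τ / (τ ^ 2 * lam - χ) ^ 3 : ℝ) * z + (4 / (τ ^ 2 * lam - χ) ^ 2 : ℝ))
    (((4 : ℕ) * z ^ (4 - 1) + (τ * lam : ℝ) * ((3 : ℕ) * z ^ (3 - 1))
    + (3 / 4 * τ ^ 2 * lam ^ 2 - 1 / 2 * χ * lam : ℝ) * ((2 : ℕ) * z ^ (2 - 1))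
    + (16 * τ / (τ ^ 2 * lam - χ) ^ 3 : ℝ) * 1)) z :=
    ((((hasDerivAt_pow 4 z).add ((hasDerivAt_pow 3 z).const_mul _)).add
      ((hasDerivAt_pow 2 z).const_mul _)).add ((hasDerivAt_id' z).const_mul _)).add_const _
  have e : Rsq χ τ lam = (fun z : ℂ => z ^ 4 + (τ * lam : ℝ) * z ^ 3
    + (3 / 4 * τ ^ 2 * lam ^ 2 - 1 / 2 * χ * lam : ℝ) * z ^ 2
    + (16 * τ / (τ ^ 2 * lam - χ) ^ 3 : ℝ) * z + (4 / (τ ^ 2 * lam - χ) ^ 2 : ℝ)) :=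
    funext (Rsq_eq_coeff χ τ lam)
  rw [e]
  convert h using 1
  rw [dRsq]
  push_cast
  ring

section Quartet

variable {χ τ lam : ℝ} {α β : ℂ}

theorem IsQuartet.Rleft_sq (h : IsQuartet χ τ lam α β) (z : ℂ) :
    Rleft α.re α.im β.re β.im z ^ 2 = Rsq χ τ lam z := by
  rw [SpectralCurve.Rleft_sq, h.isSplit.Rsq_eq, quad, quad]

theorem IsQuartet.norm_R (h : IsQuartet χ τ lam α β) (hαβ : α.re < β.re) {z : ℂ}
    (hz : z.re ≤ α.re) : ‖R α β z‖ = √‖Rsq χ τ lam z‖ := by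
  have h1 := ne_midpoint hαβ hz
  have h2 := ne_midpoint hαβ (by simpa using hz : (conj z).re ≤ α.re)
  rw [h.Rsq_eq, ← R_sq h1 h2, norm_pow, Real.sqrt_sq (norm_nonneg _)]

theorem IsQuartet.hasDerivAt_Rleft (h : IsQuartet χ τ lam α β) {z : ℂ} (hz : z.re < α.re) :
    HasDerivAt (Rleft α.re α.im β.re β.im)
      (dRsq χ τ lam z / (2 * Rleft α.re α.im β.re β.im z)) z := by
  have hne := Rleft_ne_zero (a := α.im) (b := β.im) h.2.2.2.2.1 hz
  have h1 := (differentiableAt_Rleft (a := α.im) (b := β.im) h.2.2.2.2.1 hz).hasDerivAt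
  have h2 := h1.pow 2
  have e : Rleft α.re α.im β.re β.im ^ 2 = Rsq χ τ lam := funext h.Rleft_sq
  rw [e] at h2
  have h3 := h2.unique (hasDerivAt_Rsq χ τ lam z)
  refine h1.congr_deriv ?_
  rw [← h3, eq_div_iff (mul_ne_zero two_ne_zero hne)]
  push_cast
  ring

theorem IsQuartet.hPrime_eq (h : IsQuartet χ τ lam α β) (z : ℂ) :
    hPrime χ τ lam z = (2 * τ * z - (τ ^ 2 * lam - χ : ℝ)) / z ^ 2 * R α β z := by
  rw [hPrime, h.roots_eq]
  push_cast
  ring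

/-- h' - ∂_z(sR/z) = (2τR² - s(R²)'/2) / (zR), and `mul_numer` removes the factor z. -/
theorem IsQuartet.hasDerivAt_sub (h : IsQuartet χ τ lam α β) (hs : τ ^ 2 * lam - χ ≠ 0) {z : ℂ}
    (hz : z.re < α.re) (hz0 : z ≠ 0) :
    HasDerivAt (fun z => (τ ^ 2 * lam - χ : ℝ) * Rleft α.re α.im β.re β.im z / z)
      (hPrime χ τ lam z - numer χ τ lam z / Rleft α.re α.im β.re β.im z) z := by
  have hne := Rleft_ne_zero (a := α.im) (b := β.im) h.2.2.2.2.1 hz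
  have h1 := ((h.hasDerivAt_Rleft hz).const_mul ((τ ^ 2 * lam - χ : ℝ) : ℂ)).div
    (hasDerivAt_id' z) hz0
  refine h1.congr_deriv ?_
  rw [h.hPrime_eq, R_eq_Rleft h.2.2.2.2.1 hz]
  have h2 := mul_numer hs z
  rw [← h.Rleft_sq] at h2
  field_simp
  linear_combination 2 * z * h2

theorem line_ne_zero {p : ℝ} {w : ℂ} (hp0 : p < 0) (hw : w.im ≠ 0) (u : ℝ) :
    (p + u * (w - p) : ℂ) ≠ 0 := by
  intro h
  have h1 := congrArg Complex.im h
  have h2 := congrArg Complex.re h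
  simp only [add_re, mul_re, sub_re, ofReal_re, ofReal_im, zero_mul, sub_zero, add_im, mul_im,
    sub_im, zero_re, zero_im, zero_add, add_zero] at h1 h2
  rcases mul_eq_zero.1 h1 with h | h
  · rw [h] at h2
    linarith
  · exact hw h

theorem IsQuartet.continuousOn_hPrime (h : IsQuartet χ τ lam α β) :
    ContinuousOn (hPrime χ τ lam) {z | z.re < α.re ∧ z ≠ 0} := by
  have : ContinuousOn (fun z : ℂ => (2 * τ * z - (τ ^ 2 * lam - χ : ℝ)) / z ^ 2 * R α β z)
      {z | z.re < α.re ∧ z ≠ 0} := by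
    refine ContinuousOn.mul (ContinuousOn.div (by fun_prop) (by fun_prop)
      fun z hz => pow_ne_zero 2 hz.2) ((continuousOn_R h.2.2.2.2.1).mono fun z hz => hz.1)
  exact this.congr fun z _ => h.hPrime_eq z

theorem line_re (p : ℝ) (w : ℂ) (u : ℝ) :
    (p + u * (w - p) : ℂ).re = p + u * (w.re - p) := by
  simp

theorem IsQuartet.norm_hPrime (h : IsQuartet χ τ lam α β) (hαβ : α.re < β.re) {z : ℂ}
    (hz : z.re ≤ α.re) : ‖hPrime χ τ lam z‖
      = ‖(2 * τ * z - (τ ^ 2 * lam - χ : ℝ)) / z ^ 2‖ * √‖Rsq χ τ lam z‖ := by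
  rw [h.hPrime_eq, norm_mul, h.norm_R hαβ hz]

/-- The path ends on a branch cut, where R need not be continuous, but |R| = √|R²| is a continuous
bound along the whole path. -/
theorem IsQuartet.intervalIntegrable_hPrime (h : IsQuartet χ τ lam α β) (hαβ : α.re < β.re)
    {p : ℝ} (hpc : p < α.re) (hp0 : p < 0) {w : ℂ} (hw : w.re = α.re) (hw' : w.im ≠ 0) :
    IntervalIntegrable (fun u : ℝ => hPrime χ τ lam (p + u * (w - p)) * (w - p))
      volume 0 1 := by
  have hb : Continuous fun u : ℝ => ‖(2 * τ * (p + u * (w - p)) - (τ ^ 2 * lam - χ : ℝ))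
      / (p + u * (w - p)) ^ 2 * (w - p)‖ * √‖Rsq χ τ lam (p + u * (w - p))‖ := by
    refine Continuous.mul (Continuous.norm (Continuous.mul (Continuous.div (by fun_prop)
      (by fun_prop) fun u => pow_ne_zero 2 (line_ne_zero hp0 hw' u)) continuous_const)) ?_
    exact ((continuous_Rsq χ τ lam).comp (by fun_prop)).norm.sqrt
  have hmem : ∀ u ∈ Set.Ioo (0 : ℝ) 1, (p + u * (w - p) : ℂ).re < α.re := by
    intro u hu
    rw [line_re, hw]
    nlinarith [hu.1, hu.2]
  rw [intervalIntegrable_iff_integrableOn_Ioo_of_le zero_le_one]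
  have hb' := (hb.intervalIntegrable (μ := volume) 0 1)
  rw [intervalIntegrable_iff_integrableOn_Ioo_of_le zero_le_one] at hb'
  refine Integrable.mono' hb' ?_ ?_
  · refine ContinuousOn.aestronglyMeasurable (ContinuousOn.mul
      (h.continuousOn_hPrime.comp (by fun_prop) fun u hu => ⟨hmem u hu, ?_⟩) continuousOn_const)
      measurableSet_Ioo
    exact line_ne_zero hp0 hw' u
  · filter_upwards [ae_restrict_mem measurableSet_Ioo] with u hu
    rw [norm_mul, h.norm_hPrime hαβ (hmem u hu).le, norm_mul]
    apply le_of_eq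
    ring

end Quartet

theorem segmentIntegral_symm (g : ℂ → ℂ) (a b : ℂ) :
    segmentIntegral g a b = -segmentIntegral g b a := by
  have := intervalIntegral.integral_comp_sub_left (a := 0) (b := 1)
    (fun t : ℝ => g (a + t * (b - a)) * (b - a)) 1
  rw [sub_self, sub_zero] at this
  rw [segmentIntegral, segmentIntegral, ← this, ← intervalIntegral.integral_neg]
  congr 1
  funext t
  have e : a + ((1 - t : ℝ) : ℂ) * (b - a) = b + t * (a - b) := by
    push_cast
    ring
  rw [e]
  ring

/-- The integrand that results from the substitution `z = c + i a sin θ` in `∫ numer / R`. -/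
def vertical (χ τ lam c a d b θ : ℝ) : ℂ :=
  numer χ τ lam (c + I * (a * Real.sin θ)) / Complex.sqrt (quad d b (c + I * (a * Real.sin θ)))

/-- Dominated convergence as the chord reaches the branch points: the Jacobian ta cos θ is dominated
by |√`quad c a`|, and |√`quad d b`| ≥ d - c. -/
theorem tendsto_vertical {χ τ lam c a d b p : ℝ} (ha : 0 < a) (hcd : c < d) (hpc : p < c) :
    Tendsto (fun t : ℝ => ∫ θ in (-(Real.pi / 2))..(Real.pi / 2),
        numer χ τ lam ((p + t * (c - p) : ℝ) + I * ((t * a : ℝ) * Real.sin θ)) /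
          Rleft c a d b ((p + t * (c - p) : ℝ) + I * ((t * a : ℝ) * Real.sin θ)) *
          (I * ((t * a : ℝ) * Real.cos θ))) (𝓝[<] 1)
      (𝓝 (∫ θ in (-(Real.pi / 2))..(Real.pi / 2), I * vertical χ τ lam c a d b θ)) := by
  obtain ⟨M, hM⟩ := (isCompact_closedBall (0 : ℂ) (|p| + |c - p| + a)).exists_bound_of_continuousOn
    (continuous_numer χ τ lam).continuousOn
  have hev : ∀ᶠ t : ℝ in 𝓝[<] 1, t ∈ Set.Ioo (0 : ℝ) 1 := Ioo_mem_nhdsLT zero_lt_one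
  have hre : ∀ t θ : ℝ, ((p + t * (c - p) : ℝ) + I * ((t * a : ℝ) * Real.sin θ) : ℂ).re
      = p + t * (c - p) := by
    intro t θ
    rw [add_re, ofReal_re, ← ofReal_mul, I_mul_re, ofReal_im, neg_zero, add_zero]
  have him : ∀ t θ : ℝ, ((p + t * (c - p) : ℝ) + I * ((t * a : ℝ) * Real.sin θ) : ℂ).im
      = t * a * Real.sin θ := by
    intro t θ
    rw [add_im, ofReal_im, ← ofReal_mul, I_mul_im, ofReal_re, zero_add]
  have hlt : ∀ t θ : ℝ, t ∈ Set.Ioo (0 : ℝ) 1 →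
      ((p + t * (c - p) : ℝ) + I * ((t * a : ℝ) * Real.sin θ) : ℂ).re < c := by
    intro t θ ht
    rw [hre]
    nlinarith [ht.1, ht.2]
  refine intervalIntegral.tendsto_integral_filter_of_dominated_convergence
    (fun _ => M / (d - c)) ?_ ?_ intervalIntegrable_const ?_
  · filter_upwards [hev] with t ht
    refine Continuous.aestronglyMeasurable (Continuous.mul (Continuous.div
      ((continuous_numer χ τ lam).comp (by fun_prop)) ?_ fun θ => Rleft_ne_zero hcd.le (hlt t θ ht))
      (by fun_prop))
    refine continuous_iff_continuousAt.2 fun θ => ContinuousAt.comp (g := Rleft c a d b)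
      (f := fun θ : ℝ => ((p + t * (c - p) : ℝ) + I * ((t * a : ℝ) * Real.sin θ) : ℂ))
      (differentiableAt_Rleft hcd.le (hlt t θ ht)).continuousAt (by fun_prop)
  · filter_upwards [hev] with t ht
    refine .of_forall fun θ hθ => ?_
    have hlt' := hlt t θ ht
    have hz1 : ‖numer χ τ lam ((p + t * (c - p) : ℝ) + I * ((t * a : ℝ) * Real.sin θ))‖ ≤ M := by
      apply hM
      rw [mem_closedBall_zero_iff]
      refine (norm_add_le _ _).trans (add_le_add ?_ ?_)
      · rw [norm_real, Real.norm_eq_abs]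
        refine (abs_add_le _ _).trans (add_le_add_right ?_ _)
        rw [abs_mul, abs_of_pos ht.1]
        exact mul_le_of_le_one_left (abs_nonneg _) ht.2.le
      · rw [norm_mul, norm_I, one_mul, ← ofReal_mul, norm_real, Real.norm_eq_abs, abs_mul,
          abs_of_pos (mul_pos ht.1 ha)]
        have h1 := Real.abs_sin_le_one θ
        have h2 : t * a ≤ a := mul_le_of_le_one_left ha.le ht.2.le
        calc t * a * |Real.sin θ| ≤ t * a * 1 :=
              mul_le_mul_of_nonneg_left h1 (mul_pos ht.1 ha).le
          _ ≤ a := by linarith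
    have hre' := hre t θ
    have him' := him t θ
    generalize ((p + t * (c - p) : ℝ) + I * ((t * a : ℝ) * Real.sin θ) : ℂ) = z at *
    have hM0 : 0 ≤ M := (norm_nonneg _).trans hz1
    -- Re `quad c a z` = (Re z - c)² + a² - (ta sin θ)² ≥ (ta cos θ)², since t ≤ 1.
    have hq1 : |t * a * Real.cos θ| ≤ ‖Complex.sqrt (quad c a z)‖ := by
      refine abs_le_of_sq_le_sq' ?_ (norm_nonneg _) |> abs_le.2
      rw [norm_sqrt_sq]
      refine le_trans ?_ (re_le_norm _)
      have : (quad c a z).re = (z.re - c) ^ 2 - z.im ^ 2 + a ^ 2 := by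
        simp only [quad, sq, add_re, mul_re, sub_re, sub_im, ofReal_re, ofReal_im]
        ring
      rw [this, him']
      have h1 := Real.sin_sq_add_cos_sq θ
      have h2 : (t * a) ^ 2 ≤ a ^ 2 :=
        pow_le_pow_left₀ (mul_pos ht.1 ha).le (mul_le_of_le_one_left ha.le ht.2.le) 2
      have h3 : (t * a * Real.cos θ) ^ 2 + (t * a * Real.sin θ) ^ 2 = (t * a) ^ 2 := by
        linear_combination (t * a) ^ 2 * h1
      nlinarith [sq_nonneg (z.re - c)]
    have hq2 : d - c ≤ ‖Complex.sqrt (quad d b z)‖ := by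
      refine le_of_sq_le_sq ?_ (norm_nonneg _)
      rw [norm_sqrt_sq]
      have e : quad d b z = (z - d + I * b) * (z - d - I * b) := by
        rw [quad]
        linear_combination b ^ 2 * I_sq
      rw [e, norm_mul, sq]
      have h1 : ∀ s : ℂ, s.re = z.re - d → d - c ≤ ‖s‖ := by
        intro s hs
        have := abs_re_le_norm s
        have h2 := neg_le_abs s.re
        linarith
      exact mul_le_mul (h1 _ (by simp)) (h1 _ (by simp)) (by linarith) (norm_nonneg _)
    have hq1' : 0 < ‖Complex.sqrt (quad c a z)‖ :=
      norm_pos_iff.2 (sqrt_ne_zero (slitPlane_ne_zero (quad_mem_slitPlane hlt')))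
    rw [Rleft, norm_mul, norm_div, norm_mul, norm_mul, norm_I, one_mul, ← ofReal_mul, norm_real,
      Real.norm_eq_abs, div_mul_eq_mul_div, div_le_div_iff₀ (mul_pos hq1' ((sub_pos.2 hcd).trans_le hq2)) (by linarith)]
    calc _ ≤ M * ‖Complex.sqrt (quad c a z)‖ * (d - c) := by gcongr
      _ ≤ M * ‖Complex.sqrt (quad c a z)‖ * ‖Complex.sqrt (quad d b z)‖ := by gcongr
      _ = _ := by ring
  · have hae : ∀ᵐ θ : ℝ ∂volume, θ ≠ Real.pi / 2 := by
      simp [ae_iff]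
    filter_upwards [hae] with θ hθ hθ'
    rw [Set.uIoc_of_le (by linarith [Real.pi_pos])] at hθ'
    have hcos : 0 < Real.cos θ := Real.cos_pos_of_mem_Ioo ⟨hθ'.1, lt_of_le_of_ne hθ'.2 hθ⟩
    set x : ℂ := c + I * (a * Real.sin θ)
    have hx : Tendsto (fun t : ℝ => ((p + t * (c - p) : ℝ) + I * ((t * a : ℝ) * Real.sin θ) : ℂ))
        (𝓝[<] 1) (𝓝 x) := by
      have : Continuous fun t : ℝ =>
        ((p + t * (c - p) : ℝ) + I * ((t * a : ℝ) * Real.sin θ) : ℂ) := by fun_prop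
      convert (this.tendsto 1).mono_left nhdsWithin_le_nhds using 2
      simp [x]
    have hy : Tendsto (fun t : ℝ => I * ((t * a : ℝ) * Real.cos θ) : ℝ → ℂ) (𝓝[<] 1)
        (𝓝 (I * (a * Real.cos θ))) := by
      have : Continuous fun t : ℝ => (I * ((t * a : ℝ) * Real.cos θ) : ℂ) := by fun_prop
      convert (this.tendsto 1).mono_left nhdsWithin_le_nhds using 2
      simp
    -- In the limit √`quad c a` = a cos θ on the vertical segment, which cancels the Jacobian.
    have hqa : quad c a x = ((a * Real.cos θ : ℝ) : ℂ) ^ 2 := by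
      have h1 : ((Real.sin θ : ℝ) : ℂ) ^ 2 + ((Real.cos θ : ℝ) : ℂ) ^ 2 = 1 := by
        exact_mod_cast Real.sin_sq_add_cos_sq θ
      simp only [quad, x]
      push_cast at *
      linear_combination (a : ℂ) ^ 2 * (Complex.sin θ) ^ 2 * I_sq - (a : ℂ) ^ 2 * h1
    have hac : 0 < a * Real.cos θ := mul_pos ha hcos
    have hsa : quad c a x ∈ slitPlane := by
      rw [hqa, ← ofReal_pow, ofReal_mem_slitPlane]
      positivity
    have hxre : x.re = c := by
      simp only [x]
      rw [add_re, ofReal_re, ← ofReal_mul, I_mul_re, ofReal_im, neg_zero, add_zero]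
    have hsb : quad d b x ∈ slitPlane := quad_mem_slitPlane (by rw [hxre]; exact hcd)
    have hRc : ContinuousAt (Rleft c a d b) x :=
      (((differentiableAt_sqrt hsa).comp x (differentiable_quad c a x)).mul
        ((differentiableAt_sqrt hsb).comp x (differentiable_quad d b x))).continuousAt
    have hR0 : Rleft c a d b x ≠ 0 :=
      mul_ne_zero (sqrt_ne_zero (slitPlane_ne_zero hsa)) (sqrt_ne_zero (slitPlane_ne_zero hsb))
    have hlim := ((((continuous_numer χ τ lam).tendsto x).comp hx).div
      (hRc.tendsto.comp hx) hR0).mul hy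
    have h1 : ((a * Real.cos θ : ℝ) : ℂ) ≠ 0 := by exact_mod_cast hac.ne'
    have h2 := sqrt_ne_zero (slitPlane_ne_zero hsb)
    have e : numer χ τ lam x / Rleft c a d b x * (I * (a * Real.cos θ))
        = I * vertical χ τ lam c a d b θ := by
      change _ = I * (numer χ τ lam x / Complex.sqrt (quad d b x))
      rw [Rleft, hqa, sqrt_ofReal_sq hac, ← ofReal_mul]
      field_simp
    rw [e] at hlim
    exact hlim

/-- The limit t → 1 in `segment_sub_segment`: the slanted sides give the period, the vertical side
gives i ∫ `vertical`, and the exact part drops out. -/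
theorem Admissible.f_eq {χ τ lam : ℝ} {α β : ℂ} (hadm : Admissible χ τ lam)
    (h : IsQuartet χ τ lam α β) : f lam χ τ =
      (∫ θ in (-(Real.pi / 2))..(Real.pi / 2), vertical χ τ lam α.re α.im β.re β.im θ) - 2 := by
  have hαβ := hadm.re_lt h
  have hs := hadm.neg.ne
  have hα := h.2.2.1
  obtain ⟨p, hp⟩ : ∃ p : ℝ, p = min α.re 0 - 1 := ⟨_, rfl⟩
  have hpc : p < α.re := by
    rw [hp]
    linarith [min_le_left α.re 0]
  have hp0 : p < 0 := by
    rw [hp]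
    linarith [min_le_right α.re 0]
  have hperiod : periodIntegral χ τ lam
      = segmentIntegral (hPrime χ τ lam) p α - segmentIntegral (hPrime χ τ lam) p (conj α) := by
    rw [periodIntegral, h.roots_eq]
    change segmentIntegral (hPrime χ τ lam) (conj α) ((min α.re 0 - 1 : ℝ) : ℂ)
      + segmentIntegral (hPrime χ τ lam) ((min α.re 0 - 1 : ℝ) : ℂ) α = _
    rw [← hp, segmentIntegral_symm _ (conj α)]
    ring
  have hlim : ∀ w : ℂ, w.re = α.re → w.im ≠ 0 → Tendsto (fun t : ℝ =>
      ∫ u in (0 : ℝ)..t, hPrime χ τ lam (p + u * (w - p)) * (w - p)) (𝓝[<] 1)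
      (𝓝 (segmentIntegral (hPrime χ τ lam) p w)) := by
    intro w hw hw'
    have hint := h.intervalIntegrable_hPrime hαβ hpc hp0 hw hw'
    have hint' : IntegrableOn (fun u : ℝ => hPrime χ τ lam (p + u * (w - p)) * (w - p))
        (Set.uIcc 0 1) volume := by
      rw [Set.uIcc_of_le zero_le_one]
      exact (intervalIntegrable_iff_integrableOn_Icc_of_le zero_le_one).1 hint
    have hc := intervalIntegral.continuousOn_primitive_interval hint'
    rw [Set.uIcc_of_le zero_le_one] at hc
    have h1 := hc 1 (Set.right_mem_Icc.2 zero_le_one)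
    refine (h1.tendsto).mono_left (nhdsWithin_le_iff.2 ?_)
    exact mem_of_superset (Ioo_mem_nhdsLT zero_lt_one) Set.Ioo_subset_Icc_self
  -- The boundary term sR/z tends to 0 because R² vanishes at α and at α*.
  have hH : ∀ w : ℂ, w.re = α.re → w.im ≠ 0 → Rsq χ τ lam w = 0 → Tendsto (fun t : ℝ =>
      ((τ ^ 2 * lam - χ : ℝ) * Rleft α.re α.im β.re β.im (p + t * (w - p))
        / (p + t * (w - p)) : ℂ)) (𝓝[<] 1) (𝓝 0) := by
    intro w hw hw' hw0
    rw [tendsto_zero_iff_norm_tendsto_zero]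
    have e : ∀ t : ℝ, ‖((τ ^ 2 * lam - χ : ℝ) * Rleft α.re α.im β.re β.im (p + t * (w - p))
        / (p + t * (w - p)) : ℂ)‖ = ‖((τ ^ 2 * lam - χ : ℝ) : ℂ)‖ *
          √‖Rsq χ τ lam (p + t * (w - p))‖ / ‖(p + t * (w - p) : ℂ)‖ := by
      intro t
      rw [norm_div, norm_mul, ← h.Rleft_sq, norm_pow, Real.sqrt_sq (norm_nonneg _)]
    simp only [e]
    have hc : Continuous fun t : ℝ => ‖((τ ^ 2 * lam - χ : ℝ) : ℂ)‖ *
          √‖Rsq χ τ lam (p + t * (w - p))‖ / ‖(p + t * (w - p) : ℂ)‖ := by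
      refine Continuous.div (continuous_const.mul
        (((continuous_Rsq χ τ lam).comp (by fun_prop)).norm.sqrt)) (by fun_prop)
        fun t => norm_ne_zero_iff.2 (line_ne_zero hp0 hw' t)
    have := (hc.tendsto 1).mono_left (nhdsWithin_le_nhds (s := Set.Iio 1))
    simpa [hw0] using this
  have hF : DifferentiableOn ℂ (fun z => numer χ τ lam z / Rleft α.re α.im β.re β.im z)
      {z | z.re < α.re} := by
    intro z hz
    refine (DifferentiableAt.div ?_ (differentiableAt_Rleft hαβ.le hz)
      (Rleft_ne_zero hαβ.le hz)).differentiableWithinAt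
    unfold numer
    fun_prop
  have hleft := (hlim α rfl hα.ne').sub (hlim (conj α) (by simp) (by simpa using hα.ne'))
  have hright := ((hH α rfl hα.ne' h.1).sub (hH (conj α) (by simp) (by simpa using hα.ne')
    (by rw [Rsq_conj, h.1, map_zero]))).add
    (tendsto_vertical (χ := χ) (τ := τ) (lam := lam) (b := β.im) hα hαβ hpc)
  have heq := tendsto_nhds_unique (hleft.congr' (by
    filter_upwards [Ioo_mem_nhdsLT (zero_lt_one (α := ℝ))] with t ht
    exact segment_sub_segment hF h.continuousOn_hPrime
      (fun z hz hz0 => h.hasDerivAt_sub hs hz hz0) hpc hp0 rfl hα ⟨ht.1.le, ht.2⟩)) hright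
  rw [f, hperiod, heq, intervalIntegral.integral_const_mul]
  linear_combination -((∫ θ in (-(Real.pi / 2))..(Real.pi / 2),
    vertical χ τ lam α.re α.im β.re β.im θ) - 2) * I_sq

/-! ### Differentiation with respect to `λ` -/

/-- The derivative of `Rsq` with respect to `λ`. -/
def dlRsq (χ τ lam : ℝ) (z : ℂ) : ℂ :=
  τ * z ^ 3 + (3 / 2 * τ ^ 2 * lam - 1 / 2 * χ) * z ^ 2
    - 48 * τ ^ 3 / (τ ^ 2 * lam - χ) ^ 4 * z - 8 * τ ^ 2 / (τ ^ 2 * lam - χ) ^ 3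

/-- The derivative of `numer` with respect to `z`. -/
def dznumer (χ τ lam : ℝ) (z : ℂ) : ℂ :=
  2 * τ * (3 * z ^ 2 + 2 * (τ * lam) * z + (3 / 4 * τ ^ 2 * lam ^ 2 - 1 / 2 * χ * lam))
    - (τ ^ 2 * lam - χ) / 2 * (8 * z + 3 * (τ * lam))

/-- The derivative of `numer` with respect to `λ`. -/
def dlnumer (χ τ lam : ℝ) (z : ℂ) : ℂ :=
  2 * τ * (τ * z ^ 2 + (3 / 2 * τ ^ 2 * lam - 1 / 2 * χ) * z
      - 48 * τ ^ 3 / (τ ^ 2 * lam - χ) ^ 4)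
    - τ ^ 2 / 2 * (4 * z ^ 2 + 3 * (τ * lam) * z
      + 2 * (3 / 4 * τ ^ 2 * lam ^ 2 - 1 / 2 * χ * lam))
    - (τ ^ 2 * lam - χ) / 2 * (3 * τ * z + 2 * (3 / 2 * τ ^ 2 * lam - 1 / 2 * χ))

/-- The polynomial `∂_λ(s R) R / z`. -/
def corr (χ τ lam : ℝ) (z : ℂ) : ℂ :=
  τ ^ 2 * (z ^ 3 + τ * lam * z ^ 2 + (3 / 4 * τ ^ 2 * lam ^ 2 - 1 / 2 * χ * lam) * z
      + 16 * τ / (τ ^ 2 * lam - χ) ^ 3)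
    + (τ ^ 2 * lam - χ) / 2 * (τ * z ^ 2 + (3 / 2 * τ ^ 2 * lam - 1 / 2 * χ) * z
      - 48 * τ ^ 3 / (τ ^ 2 * lam - χ) ^ 4)

/-- The derivative of `corr` with respect to `z`. -/
def dcorr (χ τ lam : ℝ) (z : ℂ) : ℂ :=
  τ ^ 2 * (3 * z ^ 2 + 2 * (τ * lam) * z + (3 / 4 * τ ^ 2 * lam ^ 2 - 1 / 2 * χ * lam))
    + (τ ^ 2 * lam - χ) / 2 * (2 * τ * z + (3 / 2 * τ ^ 2 * lam - 1 / 2 * χ))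

/-- The coefficient `κ` in `∂_λ h' = κ / R`. -/
def kappa (χ τ lam : ℝ) : ℝ :=
  -(48 * τ ^ 4 / (τ ^ 2 * lam - χ) ^ 4) - (6 * (τ ^ 2 * lam - χ) ^ 2
    + 6 * (τ ^ 2 * lam - χ) * χ + χ ^ 2) / 4

theorem ofReal_s_ne_zero {χ τ lam : ℝ} (hs : τ ^ 2 * lam - χ ≠ 0) :
    ((τ : ℂ) ^ 2 * lam - χ) ≠ 0 := by
  exact_mod_cast hs

/-- Multiplied by R⁻³ this reads ∂_λ(`numer`/R) = κ/R - ∂_z(`corr`/R): the λ-derivative is κ/R up to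
an exact term. -/
theorem numer_identity {χ τ lam : ℝ} (hs : τ ^ 2 * lam - χ ≠ 0) (z : ℂ) :
    dlnumer χ τ lam z * Rsq χ τ lam z - numer χ τ lam z * dlRsq χ τ lam z / 2
      = kappa χ τ lam * Rsq χ τ lam z - dcorr χ τ lam z * Rsq χ τ lam z
        + corr χ τ lam z * dRsq χ τ lam z / 2 := by
  have hs' := ofReal_s_ne_zero hs
  simp only [dlnumer, Rsq, numer, dlRsq, kappa, dcorr, corr, dRsq]
  push_cast
  obtain ⟨s, h⟩ : ∃ s, (τ : ℂ) ^ 2 * lam - χ = s := ⟨_, rfl⟩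
  have hχ : (χ : ℂ) = τ ^ 2 * lam - s := by linear_combination -h
  rw [h] at hs' ⊢
  rw [hχ]
  field_simp
  ring

theorem mul_corr {χ τ lam : ℝ} (hs : τ ^ 2 * lam - χ ≠ 0) (z : ℂ) :
    z * corr χ τ lam z = τ ^ 2 * Rsq χ τ lam z + (τ ^ 2 * lam - χ) / 2 * dlRsq χ τ lam z := by
  have hs' := ofReal_s_ne_zero hs
  simp only [Rsq, dlRsq, corr]
  field_simp
  ring

theorem hasDerivAt_numer (χ τ lam : ℝ) (z : ℂ) :
    HasDerivAt (numer χ τ lam) (dznumer χ τ lam z) z := by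
  have h := ((((hasDerivAt_pow 3 z).add ((hasDerivAt_pow 2 z).const_mul
      ((τ * lam : ℝ) : ℂ))).add ((hasDerivAt_id' z).const_mul
      ((3 / 4 * τ ^ 2 * lam ^ 2 - 1 / 2 * χ * lam : ℝ) : ℂ))).add_const
      ((16 * τ / (τ ^ 2 * lam - χ) ^ 3 : ℝ) : ℂ)).const_mul (2 * τ : ℂ) |>.sub
    (((((hasDerivAt_pow 2 z).const_mul (4 : ℂ)).add
      ((hasDerivAt_id' z).const_mul (3 * ((τ * lam : ℝ) : ℂ)))).add_const
      (2 * ((3 / 4 * τ ^ 2 * lam ^ 2 - 1 / 2 * χ * lam : ℝ) : ℂ))).const_mul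
      (((τ ^ 2 * lam - χ : ℝ) : ℂ) / 2))
  refine h.congr_deriv ?_
  rw [dznumer]
  push_cast
  ring

theorem hasDerivAt_corr (χ τ lam : ℝ) (z : ℂ) :
    HasDerivAt (corr χ τ lam) (dcorr χ τ lam z) z := by
  have h := ((((hasDerivAt_pow 3 z).add ((hasDerivAt_pow 2 z).const_mul
      (τ * lam : ℂ))).add ((hasDerivAt_id' z).const_mul
      (3 / 4 * τ ^ 2 * lam ^ 2 - 1 / 2 * χ * lam : ℂ))).add_const
      (16 * τ / (τ ^ 2 * lam - χ) ^ 3 : ℂ)).const_mul (τ ^ 2 : ℂ) |>.add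
    (((((hasDerivAt_pow 2 z).const_mul (τ : ℂ)).add
      ((hasDerivAt_id' z).const_mul (3 / 2 * τ ^ 2 * lam - 1 / 2 * χ : ℂ))).sub_const
      (48 * τ ^ 3 / (τ ^ 2 * lam - χ) ^ 4 : ℂ)).const_mul ((τ ^ 2 * lam - χ : ℂ) / 2))
  refine h.congr_deriv ?_
  rw [dcorr]
  push_cast
  ring

/-! ### Derivatives of the coefficients with respect to λ -/

section Coefficients

variable {χ τ lam : ℝ}

theorem hasDerivAt_coeff3 : HasDerivAt (fun l : ℝ => ((τ * l : ℝ) : ℂ)) τ lam := by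
  simpa using ((hasDerivAt_id' lam).const_mul τ).ofReal_comp

theorem hasDerivAt_coeff2 :
    HasDerivAt (fun l : ℝ => ((3 / 4 * τ ^ 2 * l ^ 2 - 1 / 2 * χ * l : ℝ) : ℂ))
      (3 / 2 * τ ^ 2 * lam - 1 / 2 * χ) lam := by
  have h := (((hasDerivAt_pow 2 lam).const_mul (3 / 4 * τ ^ 2)).sub
    ((hasDerivAt_id' lam).const_mul (1 / 2 * χ))).ofReal_comp
  refine h.congr_deriv ?_
  push_cast
  ring

theorem hasDerivAt_s : HasDerivAt (fun l : ℝ => τ ^ 2 * l - χ) (τ ^ 2) lam := by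
  simpa using ((hasDerivAt_id' lam).const_mul (τ ^ 2)).sub_const χ

theorem hasDerivAt_coeff1 (hs : τ ^ 2 * lam - χ ≠ 0) :
    HasDerivAt (fun l : ℝ => ((16 * τ / (τ ^ 2 * l - χ) ^ 3 : ℝ) : ℂ))
      (-(48 * τ ^ 3 / (τ ^ 2 * lam - χ) ^ 4)) lam := by
  have h := ((hasDerivAt_const lam (16 * τ)).div (hasDerivAt_s.pow 3) (pow_ne_zero 3 hs)).ofReal_comp
  refine h.congr_deriv ?_
  have hs' := ofReal_s_ne_zero hs
  simp only [Pi.pow_apply]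
  push_cast
  field_simp
  ring

theorem hasDerivAt_coeff0 (hs : τ ^ 2 * lam - χ ≠ 0) :
    HasDerivAt (fun l : ℝ => ((4 / (τ ^ 2 * l - χ) ^ 2 : ℝ) : ℂ))
      (-(8 * τ ^ 2 / (τ ^ 2 * lam - χ) ^ 3)) lam := by
  have h := ((hasDerivAt_const lam 4).div (hasDerivAt_s.pow 2) (pow_ne_zero 2 hs)).ofReal_comp
  refine h.congr_deriv ?_
  have hs' := ofReal_s_ne_zero hs
  simp only [Pi.pow_apply]
  push_cast
  field_simp
  ring

theorem hasDerivAt_Rsq_lam (hs : τ ^ 2 * lam - χ ≠ 0) (z : ℂ) :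
    HasDerivAt (fun l : ℝ => Rsq χ τ l z) (dlRsq χ τ lam z) lam := by
  simp only [Rsq_eq_coeff]
  have h := ((((hasDerivAt_coeff3 (τ := τ) (lam := lam)).mul_const (z ^ 3)).const_add (z ^ 4)).add
    ((hasDerivAt_coeff2 (χ := χ) (τ := τ) (lam := lam)).mul_const (z ^ 2))).add
    ((hasDerivAt_coeff1 hs).mul_const z) |>.add (hasDerivAt_coeff0 hs)
  refine h.congr_deriv ?_
  rw [dlRsq]
  ring

theorem hasDerivAt_numer_lam (hs : τ ^ 2 * lam - χ ≠ 0) {x : ℝ → ℂ} {x' : ℂ}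
    (hx : HasDerivAt x x' lam) :
    HasDerivAt (fun l : ℝ => numer χ τ l (x l))
      (dlnumer χ τ lam (x lam) + dznumer χ τ lam (x lam) * x') lam := by
  have h3 := hasDerivAt_coeff3 (τ := τ) (lam := lam)
  have h2 := hasDerivAt_coeff2 (χ := χ) (τ := τ) (lam := lam)
  have h1 := hasDerivAt_coeff1 hs
  have h0 := (hasDerivAt_s (χ := χ) (τ := τ) (lam := lam)).ofReal_comp
  have h := (((((hx.pow 3).add (h3.mul (hx.pow 2))).add (h2.mul hx)).add h1).const_mul
    (2 * τ : ℂ)).sub ((h0.div_const 2).mul ((((hx.pow 2).const_mul 4).add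
      ((h3.const_mul 3).mul hx)).add (h2.const_mul 2)))
  refine h.congr_deriv ?_
  rw [dlnumer, dznumer]
  simp only [Pi.pow_apply, Pi.add_apply, Pi.mul_apply]
  push_cast
  ring

end Coefficients

/-- Derivatives of `c, a, d, b` with respect to `λ` for a split quartic. -/
structure IsSplitDeriv (χ τ lam c a d b c' a' d' b' : ℝ) : Prop where
  split : IsSplit χ τ lam c a d b
  deriv_eq : ∀ z : ℂ, dlRsq χ τ lam z = (-2 * (z - c) * c' + 2 * a * a') * quad d b z
    + quad c a z * (-2 * (z - d) * d' + 2 * b * b')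

theorem hasDerivAt_quad_lam {c a : ℝ → ℝ} {c' a' lam : ℝ} (hc : HasDerivAt c c' lam)
    (ha : HasDerivAt a a' lam) {x : ℝ → ℂ} {x' : ℂ} (hx : HasDerivAt x x' lam) :
    HasDerivAt (fun l => quad (c l) (a l) (x l))
      (2 * (x lam - c lam) * (x' - c') + 2 * a lam * a') lam := by
  have h := ((hx.sub hc.ofReal_comp).pow 2).add ((ha.ofReal_comp).pow 2)
  refine h.congr_deriv ?_
  simp

theorem isSplitDeriv_of_hasDerivAt {χ τ lam : ℝ} {c a d b : ℝ → ℝ} {c' a' d' b' : ℝ}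
    (hs : τ ^ 2 * lam - χ ≠ 0)
    (h : ∀ᶠ l in 𝓝 lam, IsSplit χ τ l (c l) (a l) (d l) (b l))
    (hc : HasDerivAt c c' lam) (ha : HasDerivAt a a' lam) (hd : HasDerivAt d d' lam)
    (hb : HasDerivAt b b' lam) :
    IsSplitDeriv χ τ lam (c lam) (a lam) (d lam) (b lam) c' a' d' b' := by
  refine ⟨h.self_of_nhds, fun z => ?_⟩
  have h1 := hasDerivAt_Rsq_lam hs z
  have h2 := (hasDerivAt_quad_lam hc ha (hasDerivAt_const lam z)).mul
    (hasDerivAt_quad_lam hd hb (hasDerivAt_const lam z))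
  have h3 := h2.congr_of_eventuallyEq (f₁ := fun l => Rsq χ τ l z) (by
    filter_upwards [h] with l hl
    exact hl.Rsq_eq z)
  rw [h1.unique h3]
  ring

/-! ### Polynomial identities for moving roots -/

section Split

variable {χ τ lam c a d b c' a' d' b' : ℝ}

/-- The velocity of the point `c + i a sin θ`. -/
def vel (c a c' a' : ℝ) (z : ℂ) : ℂ := c' + a' / a * (z - c)

/-- The quotient of `numer * vel - corr` by `quad c a`. -/
def quot (χ τ lam c a d b c' a' d' : ℝ) (z : ℂ) : ℂ :=
  2 * τ * (a' / a) * z ^ 2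
  + ((2 * τ * (c' - a' / a * c) - τ ^ 2 - (τ ^ 2 * lam - χ) * (a' / a)) - 2 * d * (2 * τ * (a' / a))
      - (τ ^ 2 * lam - χ) * (a' / a)) * z
  + ((d ^ 2 + b ^ 2) * (2 * τ * (a' / a))
      - 2 * d * (2 * τ * (c' - a' / a * c) - τ ^ 2 - (τ ^ 2 * lam - χ) * (a' / a))
      - (τ ^ 2 * lam - χ) * ((c' - a' / a * c) - d' - d * (a' / a)))

/-- The derivative of `quot`. -/
def dquot (χ τ lam c a d c' a' : ℝ) (z : ℂ) : ℂ :=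
  4 * τ * (a' / a) * z
  + ((2 * τ * (c' - a' / a * c) - τ ^ 2 - (τ ^ 2 * lam - χ) * (a' / a)) - 2 * d * (2 * τ * (a' / a))
      - (τ ^ 2 * lam - χ) * (a' / a))

theorem hasDerivAt_quot (z : ℂ) : HasDerivAt (quot χ τ lam c a d b c' a' d')
    (dquot χ τ lam c a d c' a' z) z := by
  have h := ((hasDerivAt_pow 2 z).const_mul (2 * τ * (a' / a) : ℂ)).add
    ((hasDerivAt_id' z).const_mul ((2 * τ * (c' - a' / a * c) - τ ^ 2
      - (τ ^ 2 * lam - χ) * (a' / a)) - 2 * d * (2 * τ * (a' / a))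
      - (τ ^ 2 * lam - χ) * (a' / a) : ℂ)) |>.add_const
    ((d ^ 2 + b ^ 2) * (2 * τ * (a' / a))
      - 2 * d * (2 * τ * (c' - a' / a * c) - τ ^ 2 - (τ ^ 2 * lam - χ) * (a' / a))
      - (τ ^ 2 * lam - χ) * ((c' - a' / a * c) - d' - d * (a' / a)) : ℂ)
  refine h.congr_deriv ?_
  rw [dquot]
  push_cast
  ring

theorem hasDerivAt_quad (z : ℂ) : HasDerivAt (quad c a) (2 * (z - c)) z := by
  have h := (((hasDerivAt_id' z).sub_const (c : ℂ)).pow 2).add_const ((a : ℂ) ^ 2)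
  refine h.congr_deriv ?_
  simp

theorem IsSplit.dRsq_eq (h : IsSplit χ τ lam c a d b) (z : ℂ) :
    dRsq χ τ lam z = 2 * (z - c) * quad d b z + quad c a z * (2 * (z - d)) := by
  have e : Rsq χ τ lam = quad c a * quad d b := funext fun z => h.Rsq_eq z
  have h1 := hasDerivAt_Rsq χ τ lam z
  rw [e] at h1
  exact h1.unique ((hasDerivAt_quad z).mul (hasDerivAt_quad z))

/-- At α and α* the quantity z(`numer`·`vel` - `corr`) reduces to -(s/2) times the total
λ-derivative of R² along the moving root, which is 0. So `quad c a` divides, and the boundary term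
in `integral_dvertical` vanishes at both endpoints. -/
theorem IsSplitDeriv.quad_mul_quot (h : IsSplitDeriv χ τ lam c a d b c' a' d' b')
    (hs : τ ^ 2 * lam - χ ≠ 0) (ha : a ≠ 0) (z : ℂ) :
    quad c a z * quot χ τ lam c a d b c' a' d' z
      = numer χ τ lam z * vel c a c' a' z - corr χ τ lam z := by
  have hs' := ofReal_s_ne_zero hs
  have ha' : (a : ℂ) ≠ 0 := by exact_mod_cast ha
  have hM : ∀ z : ℂ, z * (numer χ τ lam z * vel c a c' a' z - corr χ τ lam z)
      = quad c a z * (quad d b z * (2 * τ * vel c a c' a' z - τ ^ 2 - (τ ^ 2 * lam - χ) * (a' / a))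
        - (τ ^ 2 * lam - χ) * ((z - d) * (vel c a c' a' z - d') + b * b')) := by
    intro z
    have h1 := mul_numer hs z
    have h2 := mul_corr hs z
    have h3 := h.deriv_eq z
    have h4 := h.split.dRsq_eq z
    have h5 : Rsq χ τ lam z = quad c a z * quad d b z := h.split.Rsq_eq z
    have h6 : -2 * (z - c) * c' + 2 * a * a' + 2 * (z - c) * vel c a c' a' z
        = 2 * (a' / a) * quad c a z := by
      rw [vel, quad]
      field_simp
      ring
    rw [h3, h5] at h2
    rw [h4, h5] at h1
    push_cast at h1
    linear_combination vel c a c' a' z * h1 - h2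
      - (τ ^ 2 * lam - χ) / 2 * quad d b z * h6
  -- The cofactor in `hM` must itself be divisible by z. Its value at 0 vanishes because `quad c a
  -- 0` = c² + a² ≠ 0.
  have hM0 : quad d b 0 * (2 * τ * vel c a c' a' 0 - τ ^ 2 - (τ ^ 2 * lam - χ) * (a' / a))
        - (τ ^ 2 * lam - χ) * ((0 - d) * (vel c a c' a' 0 - d') + b * b') = 0 := by
    have h1 := hM 0
    rw [zero_mul] at h1
    refine (mul_eq_zero.1 h1.symm).resolve_left ?_
    have e : quad c a 0 = ((c ^ 2 + a ^ 2 : ℝ) : ℂ) := by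
      rw [quad]
      push_cast
      ring
    rw [e]
    have : c ^ 2 + a ^ 2 ≠ 0 := by positivity
    exact_mod_cast this
  have hne : ∀ z : ℂ, z ≠ 0 → quad c a z * quot χ τ lam c a d b c' a' d' z
      = numer χ τ lam z * vel c a c' a' z - corr χ τ lam z := by
    intro z hz
    refine mul_left_cancel₀ hz ?_
    rw [hM z]
    have e : z * quot χ τ lam c a d b c' a' d' z
        = (quad d b z * (2 * τ * vel c a c' a' z - τ ^ 2 - (τ ^ 2 * lam - χ) * (a' / a))
          - (τ ^ 2 * lam - χ) * ((z - d) * (vel c a c' a' z - d') + b * b'))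
        - (quad d b 0 * (2 * τ * vel c a c' a' 0 - τ ^ 2 - (τ ^ 2 * lam - χ) * (a' / a))
          - (τ ^ 2 * lam - χ) * ((0 - d) * (vel c a c' a' 0 - d') + b * b')) := by
      simp only [quot, quad, vel]
      ring
    rw [hM0, sub_zero] at e
    rw [← e]
    ring
  have hcont1 : Continuous fun z => quad c a z * quot χ τ lam c a d b c' a' d' z := by
    unfold quad quot
    fun_prop
  have hcont2 : Continuous fun z => numer χ τ lam z * vel c a c' a' z - corr χ τ lam z := by
    unfold numer vel corr
    fun_prop
  have hdense : Dense {z : ℂ | z ≠ 0} := dense_compl_singleton 0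
  exact congrFun (hcont1.ext_on hdense hcont2 fun z hz => hne z hz) z

/-- The numerator of the λ-derivative of `vertical` is rewritten as κ/√`quad d b` plus a
θ-derivative, with denominators cleared. It combines `numer_identity` with the z-derivative of
`quad_mul_quot`. -/
theorem IsSplitDeriv.numer_deriv (h : IsSplitDeriv χ τ lam c a d b c' a' d' b')
    (hs : τ ^ 2 * lam - χ ≠ 0) (ha : a ≠ 0) {z : ℂ} (hz : quad c a z ≠ 0) :
    (dlnumer χ τ lam z + dznumer χ τ lam z * vel c a c' a' z) * quad d b z
      - numer χ τ lam z * ((z - d) * (vel c a c' a' z - d') + b * b')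
    = kappa χ τ lam * quad d b z
      + ((z - c) * quot χ τ lam c a d b c' a' d' z
        + quad c a z * dquot χ τ lam c a d c' a' z) * quad d b z
      - quad c a z * quot χ τ lam c a d b c' a' d' z * (z - d) := by
  have ha' : (a : ℂ) ≠ 0 := by exact_mod_cast ha
  have hE := h.quad_mul_quot hs ha
  have hvel : HasDerivAt (vel c a c' a') ((a' : ℂ) / a) z := by
    have := (((hasDerivAt_id' z).sub_const (c : ℂ)).const_mul ((a' : ℂ) / a)).const_add (c' : ℂ)
    rw [mul_one] at this
    exact this
  have hE' : 2 * (z - c) * quot χ τ lam c a d b c' a' d' z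
      + quad c a z * dquot χ τ lam c a d c' a' z
      = dznumer χ τ lam z * vel c a c' a' z + numer χ τ lam z * (a' / a) - dcorr χ τ lam z := by
    have h1 := (hasDerivAt_quad (c := c) (a := a) z).mul (hasDerivAt_quot (χ := χ) (τ := τ)
      (lam := lam) (c := c) (a := a) (d := d) (b := b) (c' := c') (a' := a') (d' := d') z)
    have h2 := ((hasDerivAt_numer χ τ lam z).mul hvel).sub (hasDerivAt_corr χ τ lam z)
    have e : quad c a * quot χ τ lam c a d b c' a' d'
        = numer χ τ lam * vel c a c' a' - corr χ τ lam := funext hE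
    rw [e] at h1
    exact h1.unique h2
  have hI := numer_identity hs z
  have h3 := h.deriv_eq z
  have h4 := h.split.dRsq_eq z
  have h5 : Rsq χ τ lam z = quad c a z * quad d b z := h.split.Rsq_eq z
  have h6 : -2 * (z - c) * c' + 2 * a * a' + 2 * (z - c) * vel c a c' a' z
      = 2 * (a' / a) * quad c a z := by
    rw [vel, quad]
    field_simp
    ring
  have hEz := hE z
  rw [h3, h4, h5] at hI
  refine mul_left_cancel₀ hz ?_
  generalize quad c a z = A at *
  generalize quad d b z = B at *
  generalize quot χ τ lam c a d b c' a' d' z = q at *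
  generalize dquot χ τ lam c a d c' a' z = q' at *
  generalize numer χ τ lam z = N at *
  generalize vel c a c' a' z = v at *
  generalize corr χ τ lam z = Y at *
  linear_combination hI - A * B * hE' + N * B / 2 * h6
    + ((z - c) * B + (z - d) * A) * hEz

end Split

/-! ### The derivative of the integral along the vertical segment -/

theorem hasDerivAt_sqrt_inv {z : ℂ} (hz : z ∈ slitPlane) :
    HasDerivAt Complex.sqrt (1 / (2 * Complex.sqrt z)) z := by
  have h1 := (differentiableAt_sqrt hz).hasDerivAt
  have h2 := h1.pow 2
  have e : Complex.sqrt ^ 2 = fun z => z := funext sqrt_sq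
  rw [e] at h2
  have h3 := h2.unique (hasDerivAt_id' z)
  refine h1.congr_deriv ?_
  rw [eq_div_iff (mul_ne_zero two_ne_zero (sqrt_ne_zero (slitPlane_ne_zero hz))), ← h3]
  push_cast
  ring

/-- The point `c + i a sin θ`. -/
def pt (c a θ : ℝ) : ℂ := c + I * (a * Real.sin θ)

theorem pt_re (c a θ : ℝ) : (pt c a θ).re = c := by
  rw [pt, add_re, ofReal_re, ← ofReal_mul, I_mul_re, ofReal_im, neg_zero, add_zero]

theorem continuous_pt (c a : ℝ) : Continuous (pt c a) := by
  unfold pt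
  fun_prop

theorem quad_pt_mem {c a d b : ℝ} (hcd : c < d) (θ : ℝ) : quad d b (pt c a θ) ∈ slitPlane :=
  quad_mem_slitPlane (by rwa [pt_re])

theorem vertical_eq (χ τ lam c a d b θ : ℝ) : vertical χ τ lam c a d b θ
    = numer χ τ lam (pt c a θ) / Complex.sqrt (quad d b (pt c a θ)) := rfl

theorem continuous_sqrt_quad {c a d b : ℝ} (hcd : c < d) :
    Continuous fun θ => Complex.sqrt (quad d b (pt c a θ)) := by
  refine continuous_iff_continuousAt.2 fun θ => ?_
  exact ContinuousAt.comp (g := Complex.sqrt) (f := fun θ => quad d b (pt c a θ))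
    (differentiableAt_sqrt (quad_pt_mem hcd θ)).continuousAt
    ((differentiable_quad d b).continuous.comp (continuous_pt c a)).continuousAt

theorem sqrt_quad_ne_zero {c a d b : ℝ} (hcd : c < d) (θ : ℝ) :
    Complex.sqrt (quad d b (pt c a θ)) ≠ 0 :=
  sqrt_ne_zero (slitPlane_ne_zero (quad_pt_mem hcd θ))

theorem quad_pt (c a θ : ℝ) : quad c a (pt c a θ) = (a * Real.cos θ : ℂ) ^ 2 := by
  have h1 : ((Real.sin θ : ℝ) : ℂ) ^ 2 + ((Real.cos θ : ℝ) : ℂ) ^ 2 = 1 := by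
    exact_mod_cast Real.sin_sq_add_cos_sq θ
  simp only [quad, pt]
  push_cast at *
  linear_combination (a : ℂ) ^ 2 * (Complex.sin θ) ^ 2 * I_sq - (a : ℂ) ^ 2 * h1

/-- The derivative of `vertical` with respect to `λ`. -/
def dvertical (χ τ lam c a d b c' a' d' b' θ : ℝ) : ℂ :=
  ((dlnumer χ τ lam (pt c a θ) + dznumer χ τ lam (pt c a θ) * vel c a c' a' (pt c a θ))
      * quad d b (pt c a θ)
    - numer χ τ lam (pt c a θ) * ((pt c a θ - d) * (vel c a c' a' (pt c a θ) - d') + b * b'))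
    / (Complex.sqrt (quad d b (pt c a θ)) * quad d b (pt c a θ))

theorem hasDerivAt_vertical_lam {χ τ lam : ℝ} {c a d b : ℝ → ℝ} {c' a' d' b' : ℝ}
    (hs : τ ^ 2 * lam - χ ≠ 0) (ha0 : a lam ≠ 0) (hcd : c lam < d lam)
    (hc : HasDerivAt c c' lam) (ha : HasDerivAt a a' lam) (hd : HasDerivAt d d' lam)
    (hb : HasDerivAt b b' lam) (θ : ℝ) :
    HasDerivAt (fun l => vertical χ τ l (c l) (a l) (d l) (b l) θ)
      (dvertical χ τ lam (c lam) (a lam) (d lam) (b lam) c' a' d' b' θ) lam := by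
  have ha0' : (a lam : ℂ) ≠ 0 := by exact_mod_cast ha0
  have hx : HasDerivAt (fun l => pt (c l) (a l) θ)
      (vel (c lam) (a lam) c' a' (pt (c lam) (a lam) θ)) lam := by
    have := hc.ofReal_comp.add ((ha.ofReal_comp.mul_const (Real.sin θ : ℂ)).const_mul I)
    refine this.congr_deriv ?_
    rw [vel, pt]
    field_simp
    ring
  have hmem := quad_pt_mem (a := a lam) (b := b lam) hcd θ
  have hS0 := sqrt_quad_ne_zero (a := a lam) (b := b lam) hcd θ
  have hB0 := slitPlane_ne_zero hmem
  have hS := (hasDerivAt_sqrt_inv hmem).comp lam (hasDerivAt_quad_lam hd hb hx)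
  have h := (hasDerivAt_numer_lam (χ := χ) hs hx).div hS hS0
  refine h.congr_deriv ?_
  have hsq := sqrt_sq (quad (d lam) (b lam) (pt (c lam) (a lam) θ))
  rw [dvertical]
  simp only [Function.comp_apply]
  rw [div_eq_div_iff (pow_ne_zero 2 hS0) (mul_ne_zero hS0 hB0)]
  generalize quad (d lam) (b lam) (pt (c lam) (a lam) θ) = B at *
  generalize Complex.sqrt B = S at *
  subst hsq
  field_simp

/-- The integrand is κ/S plus the θ-derivative of a cos θ · `quot`/(iS), and cos θ vanishes at ±π/2.
-/
theorem IsSplitDeriv.integral_dvertical {χ τ lam c a d b c' a' d' b' : ℝ}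
    (h : IsSplitDeriv χ τ lam c a d b c' a' d' b') (hs : τ ^ 2 * lam - χ ≠ 0) (ha : a ≠ 0)
    (hcd : c < d) :
    ∫ θ in (-(Real.pi / 2))..(Real.pi / 2), dvertical χ τ lam c a d b c' a' d' b' θ
      = kappa χ τ lam * ∫ θ in (-(Real.pi / 2))..(Real.pi / 2),
          1 / Complex.sqrt (quad d b (pt c a θ)) := by
  have hS0 := sqrt_quad_ne_zero (a := a) (b := b) hcd
  have hSc := continuous_sqrt_quad (a := a) (b := b) hcd
  set S : ℝ → ℂ := fun θ => Complex.sqrt (quad d b (pt c a θ)) with hS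
  set q := quot χ τ lam c a d b c' a' d' with hq
  set q' := dquot χ τ lam c a d c' a' with hq'
  set D : ℝ → ℂ := fun θ => ((pt c a θ - c) * q (pt c a θ) + (a * Real.cos θ) ^ 2 * q' (pt c a θ)) / S θ
    - (a * Real.cos θ) ^ 2 * q (pt c a θ) * (pt c a θ - d) / S θ ^ 3 with hD
  have hqc : Continuous q := by
    simp only [hq]
    unfold quot
    fun_prop
  have hq'c : Continuous q' := by
    simp only [hq']
    unfold dquot
    fun_prop
  have hptc := continuous_pt c a
  have hDc : Continuous D := by
    have h1 := hqc.comp hptc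
    have h2 := hq'c.comp hptc
    simp only [hD]
    refine Continuous.sub (Continuous.div ?_ hSc hS0)
      (Continuous.div ?_ (hSc.pow 3) fun θ => pow_ne_zero 3 (hS0 θ))
    · exact ((hptc.sub continuous_const).mul h1).add
        (Continuous.mul (by fun_prop) h2)
    · exact (Continuous.mul (by fun_prop) h1).mul (hptc.sub continuous_const)
  have hpt : ∀ θ, HasDerivAt (pt c a) (I * (a * Real.cos θ)) θ := fun θ =>
    hasDerivAt_vertical c a θ
  have hderiv : ∀ θ : ℝ, HasDerivAt (fun θ : ℝ => (a * Real.cos θ) * q (pt c a θ) / (I * S θ))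
      (D θ) θ := by
    intro θ
    have h1 := ((Real.hasDerivAt_cos θ).ofReal_comp).const_mul (a : ℂ)
    have h2 : HasDerivAt (fun θ => q (pt c a θ)) (q' (pt c a θ) * (I * (a * Real.cos θ))) θ :=
      (hasDerivAt_quot (pt c a θ)).comp θ (hpt θ)
    have h3 : HasDerivAt (fun θ => quad d b (pt c a θ))
        (2 * (pt c a θ - d) * (I * (a * Real.cos θ))) θ :=
      (hasDerivAt_quad (pt c a θ)).comp θ (hpt θ)
    have h4 : HasDerivAt S (1 / (2 * S θ) * (2 * (pt c a θ - d) * (I * (a * Real.cos θ)))) θ :=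
      HasDerivAt.comp (h₂ := Complex.sqrt) θ (hasDerivAt_sqrt_inv (quad_pt_mem hcd θ)) h3
    have h5 := (h1.mul h2).div (h4.const_mul I) (mul_ne_zero I_ne_zero (hS0 θ))
    refine h5.congr_deriv ?_
    have hSθ := hS0 θ
    have e : pt c a θ - c = I * (a * Real.sin θ) := by
      rw [pt]
      ring
    change _ = (_ : ℂ)
    simp only [hD, e, Pi.mul_apply]
    change ((_ : ℂ) * (I * S θ) - _ * (I * (1 / (2 * S θ) * _))) / (I * S θ) ^ 2 = _
    generalize S θ = s at *
    push_cast
    field_simp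
    linear_combination -((a : ℂ) * Complex.sin θ * q (pt c a θ) * s ^ 2 / s ^ 3) * I_sq
  have hFTC := intervalIntegral.integral_eq_sub_of_hasDerivAt
    (a := -(Real.pi / 2)) (b := Real.pi / 2) (fun θ _ => hderiv θ)
    (hDc.intervalIntegrable _ _)
  simp only [Real.cos_neg, Real.cos_pi_div_two, ofReal_zero, mul_zero, zero_mul, zero_div,
    sub_zero] at hFTC
  -- The open interval is needed because `numer_deriv` divides by `quad c a` = (a cos θ)².
  have hVD : ∀ θ ∈ Set.Ioo (-(Real.pi / 2)) (Real.pi / 2),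
      dvertical χ τ lam c a d b c' a' d' b' θ = kappa χ τ lam * (1 / S θ) + D θ := by
    intro θ hθ
    have hcos : 0 < Real.cos θ := Real.cos_pos_of_mem_Ioo hθ
    have hA := quad_pt c a θ
    have hA0 : quad c a (pt c a θ) ≠ 0 := by
      rw [hA]
      refine pow_ne_zero 2 (mul_ne_zero ?_ ?_)
      · exact_mod_cast ha
      · exact_mod_cast hcos.ne'
    have key := h.numer_deriv hs ha hA0
    have hSθ := hS0 θ
    have hsq : quad d b (pt c a θ) = S θ ^ 2 := (sqrt_sq _).symm
    rw [dvertical, key, hA]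
    simp only [hD]
    change _ / (S θ * _) = _
    rw [hsq]
    generalize S θ = s at *
    field_simp
    ring
  have hSinv : Continuous fun θ => 1 / S θ := continuous_const.div hSc hS0
  have hk : Continuous fun θ => kappa χ τ lam * (1 / S θ) := continuous_const.mul hSinv
  have hae : ∀ᵐ θ : ℝ ∂volume, θ ≠ Real.pi / 2 := by
    simp [ae_iff]
  rw [intervalIntegral.integral_congr_ae (g := fun θ => kappa χ τ lam * (1 / S θ) + D θ),
    intervalIntegral.integral_add (hk.intervalIntegrable _ _)
      (hDc.intervalIntegrable _ _), hFTC, intervalIntegral.integral_const_mul, add_zero]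
  filter_upwards [hae] with θ hθ hθ'
  rw [Set.uIoc_of_le (by linarith [Real.pi_pos])] at hθ'
  exact hVD θ ⟨hθ'.1, lt_of_le_of_ne hθ'.2 hθ⟩

theorem integral_inv_sqrt_re_pos {c a d b : ℝ} (hcd : c < d) :
    0 < (∫ θ in (-(Real.pi / 2))..(Real.pi / 2),
      1 / Complex.sqrt (quad d b (pt c a θ))).re := by
  have hc : Continuous fun θ => 1 / Complex.sqrt (quad d b (pt c a θ)) :=
    continuous_const.div (continuous_sqrt_quad hcd) (sqrt_quad_ne_zero hcd)
  have e := reCLM.intervalIntegral_comp_comm (hc.intervalIntegrable (μ := volume)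
    (-(Real.pi / 2)) (Real.pi / 2))
  rw [← reCLM_apply, ← e]
  refine intervalIntegral.intervalIntegral_pos_of_pos
    ((reCLM.continuous.comp hc).intervalIntegrable _ _) (fun θ => ?_) (by linarith [Real.pi_pos])
  rw [reCLM_apply, one_div, inv_re]
  exact div_pos (sqrt_re_pos (quad_pt_mem hcd θ)) (normSq_pos.2 (sqrt_quad_ne_zero hcd θ))

/-- Since s + χ = τ²λ and |s²λ| < 8, one has 192τ⁴ ≥ 3s⁴(s + χ)², while 3(s + χ)² + 6s² + 6sχ + χ² =
(3s + 2χ)². The inequality is strict for τ ≠ 0; for τ = 0 or λ = 0, χ = -s and the quadratic form is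
s². -/
theorem kappa_neg {χ τ lam : ℝ} (hs : τ ^ 2 * lam - χ ≠ 0)
    (h1 : -8 < (τ ^ 2 * lam - χ) ^ 2 * lam) (h2 : (τ ^ 2 * lam - χ) ^ 2 * lam < 8) :
    kappa χ τ lam < 0 := by
  obtain ⟨s, hs'⟩ : ∃ s, s = τ ^ 2 * lam - χ := ⟨_, rfl⟩
  rw [← hs'] at hs h1 h2
  have hχ : χ = τ ^ 2 * lam - s := by linarith
  have e : kappa χ τ lam = -(192 * τ ^ 4 + s ^ 4 * (6 * s ^ 2 + 6 * s * χ + χ ^ 2)) / (4 * s ^ 4) := by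
    rw [kappa, ← hs']
    field_simp
    ring
  rw [e]
  have hs4 : 0 < s ^ 4 := by positivity
  refine div_neg_of_neg_of_pos (neg_lt_zero.2 ?_) (by positivity)
  have h3 : (s ^ 2 * lam) ^ 2 ≤ 64 := by nlinarith
  have h4 : s ^ 4 * (3 * (s + χ) ^ 2) ≤ 192 * τ ^ 4 := by
    have : s + χ = τ ^ 2 * lam := by linarith
    rw [this]
    have := mul_le_mul_of_nonneg_left h3 (by positivity : 0 ≤ 3 * τ ^ 4)
    linarith
  rcases eq_or_ne τ 0 with rfl | hτ
  · have : χ = -s := by linarith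
    rw [this]
    have : 6 * s ^ 2 + 6 * s * -s + (-s) ^ 2 = s ^ 2 := by ring
    rw [this]
    positivity
  · rcases eq_or_ne lam 0 with rfl | hl
    · have : χ = -s := by linarith
      rw [this]
      have : 6 * s ^ 2 + 6 * s * -s + (-s) ^ 2 = s ^ 2 := by ring
      rw [this]
      positivity
    · have h3' : (s ^ 2 * lam) ^ 2 < 64 := by nlinarith
      have h4' : s ^ 4 * (3 * (s + χ) ^ 2) < 192 * τ ^ 4 := by
        have : s + χ = τ ^ 2 * lam := by linarith
        rw [this]
        have := mul_lt_mul_of_pos_left h3' (by positivity : 0 < 3 * τ ^ 4)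
        linarith
      nlinarith [mul_nonneg hs4.le (sq_nonneg (3 * s + 2 * χ))]

open ContDiff

/-! ### Analytic dependence of the roots on the parameters -/

theorem Admissible.eventually {χ τ lam : ℝ} (h : Admissible χ τ lam) :
    ∀ᶠ q : ℝ × ℝ × ℝ in 𝓝 (χ, τ, lam), Admissible q.1 q.2.1 q.2.2 := by
  have aux : ∀ {u v : ℝ × ℝ × ℝ → ℝ}, Continuous u → Continuous v →
      u (χ, τ, lam) < v (χ, τ, lam) → ∀ᶠ q in 𝓝 (χ, τ, lam), u q < v q :=
    fun hu hv h => hu.continuousAt.eventually_lt hv.continuousAt h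
  filter_upwards [aux (u := fun q => q.2.1 ^ 2 * q.2.2 - q.1) (by fun_prop) continuous_const h.neg,
    aux (u := fun q => 3 * (q.2.1 ^ 2 * q.2.2 - q.1) + q.1) (by fun_prop) continuous_const h.neg',
    aux (u := fun q => 864 * q.2.1 ^ 4) (v := fun q =>
      ((q.2.1 ^ 2 * q.2.2 - q.1) * (3 * (q.2.1 ^ 2 * q.2.2 - q.1) + q.1)) ^ 3) (by fun_prop)
      (by fun_prop) h.D1_pos,
    aux (u := fun _ => -8) (v := fun q => (q.2.1 ^ 2 * q.2.2 - q.1) ^ 2 * q.2.2) (by fun_prop)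
      (by fun_prop) h.D2plus_pos,
    aux (u := fun q => (q.2.1 ^ 2 * q.2.2 - q.1) ^ 2 * q.2.2) (v := fun _ => 8) (by fun_prop)
      (by fun_prop) h.D2minus_neg,
    aux (u := fun q => -q.1 ^ 3) (v := fun q => 54 * q.2.1 ^ 2) (by fun_prop)
      (by fun_prop) h.chi_gt] with q h1 h2 h3 h4 h5 h6
  exact ⟨h1, h2, h3, h4, h5, h6⟩

theorem contDiffAt_Rsq {χ τ lam : ℝ} (hs : τ ^ 2 * lam - χ ≠ 0) (z : ℂ) :
    ContDiffAt ℝ ω (fun v : (ℝ × ℝ × ℝ) × ℂ => Rsq v.1.1 v.1.2.1 v.1.2.2 v.2)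
      ((χ, τ, lam), z) := by
  have h1 : ContDiffAt ℝ ω (fun v : (ℝ × ℝ × ℝ) × ℂ => v.2 ^ 4 + (v.1.2.1 * v.1.2.2) • v.2 ^ 3
      + (3 / 4 * v.1.2.1 ^ 2 * v.1.2.2 ^ 2 - 1 / 2 * v.1.1 * v.1.2.2) • v.2 ^ 2
      + (16 * v.1.2.1 / (v.1.2.1 ^ 2 * v.1.2.2 - v.1.1) ^ 3) • v.2
      + (4 / (v.1.2.1 ^ 2 * v.1.2.2 - v.1.1) ^ 2) • (1 : ℂ)) ((χ, τ, lam), z) := by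
    fun_prop (disch := simpa using hs)
  refine h1.congr_of_eventuallyEq (Eventually.of_forall fun v => ?_)
  simp only [Rsq_eq_coeff, real_smul, mul_one]

/-- Multiplication by a unit, as a continuous linear equivalence. -/
def mulUnitEquiv {A : Type*} [NormedCommRing A] [NormedAlgebra ℝ A] (u : Aˣ) : A ≃L[ℝ] A :=
  ContinuousLinearEquiv.equivOfInverse (ContinuousLinearMap.mul ℝ A u)
    (ContinuousLinearMap.mul ℝ A (u⁻¹ : Aˣ)) (fun x => by simp) (fun x => by simp)

/-- Implicit function theorem at a simple root: the partial derivative is multiplication by (R²)'(z)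
≠ 0, viewed as a real-linear map of ℂ. -/
theorem exists_analytic_root {χ τ lam : ℝ} (hs : τ ^ 2 * lam - χ ≠ 0) {z : ℂ}
    (hz : Rsq χ τ lam z = 0) (hz' : dRsq χ τ lam z ≠ 0) :
    ∃ φ : ℝ × ℝ × ℝ → ℂ, ContDiffAt ℝ ω φ (χ, τ, lam) ∧ φ (χ, τ, lam) = z ∧
      ∀ᶠ q in 𝓝 (χ, τ, lam), Rsq q.1 q.2.1 q.2.2 (φ q) = 0 := by
  have hF := contDiffAt_Rsq hs z
  have hinv : (fderiv ℝ (fun v : (ℝ × ℝ × ℝ) × ℂ => Rsq v.1.1 v.1.2.1 v.1.2.2 v.2)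
      ((χ, τ, lam), z) ∘L .inr ℝ (ℝ × ℝ × ℝ) ℂ).IsInvertible := by
    refine ⟨mulUnitEquiv (Units.mk0 _ hz'), ?_⟩
    have h1 := (hF.differentiableAt (by simp)).hasFDerivAt
    have h2 := h1.comp z (hasFDerivAt_prodMk_right (𝕜 := ℝ) (χ, τ, lam) z)
    have h3 := ((hasDerivAt_Rsq χ τ lam z).hasFDerivAt).restrictScalars ℝ
    have h4 := h3.unique h2
    rw [← h4]
    ext x
    simp [mulUnitEquiv, mul_comm]
  refine ⟨hF.implicitFunction (by simp) hinv, hF.contDiffAt_implicitFunction (by simp) hinv,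
    hF.implicitFunction_apply_self (by simp) hinv, ?_⟩
  filter_upwards [hF.eventually_apply_implicitFunction (by simp) hinv] with q hq
  exact hq.trans hz

theorem IsQuartet.dRsq_ne_zero {χ τ lam : ℝ} {α β : ℂ} (h : IsQuartet χ τ lam α β)
    (hne : α ≠ β) : dRsq χ τ lam α ≠ 0 ∧ dRsq χ τ lam β ≠ 0 := by
  have h3 := h.2.2.1
  have h4 := h.2.2.2.1
  have aux : ∀ γ δ : ℂ, 0 < γ.im → 0 < δ.im → γ - conj δ ≠ 0 := by
    intro γ δ hγ hδ e
    have := congrArg Complex.im e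
    simp only [sub_im, conj_im, zero_im] at this
    linarith
  have hre : ∀ γ : ℂ, 2 * (γ - γ.re) = γ - conj γ := by
    intro γ
    have := Complex.add_conj γ
    push_cast at this
    linear_combination this
  have hquad : ∀ γ z : ℂ, quad γ.re γ.im z = (z - γ) * (z - conj γ) := quadratic_eq_mul
  rw [h.isSplit.dRsq_eq, h.isSplit.dRsq_eq, hquad, hquad, hquad, hquad, hre, hre, sub_self,
    sub_self, zero_mul, zero_mul, zero_mul, add_zero, mul_zero, zero_add]
  exact ⟨mul_ne_zero (aux _ _ h3 h3) (mul_ne_zero (sub_ne_zero.2 hne) (aux _ _ h3 h4)),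
    mul_ne_zero (mul_ne_zero (sub_ne_zero.2 hne.symm) (aux _ _ h4 h3)) (aux _ _ h4 h4)⟩

/-- The strict inequality Re α < Re β persists nearby, so the analytic continuations keep their
labels. -/
theorem Admissible.exists_analytic_quartet {χ τ lam : ℝ} {α β : ℂ} (hadm : Admissible χ τ lam)
    (h : IsQuartet χ τ lam α β) :
    ∃ αf βf : ℝ × ℝ × ℝ → ℂ, ContDiffAt ℝ ω αf (χ, τ, lam) ∧ ContDiffAt ℝ ω βf (χ, τ, lam) ∧
      αf (χ, τ, lam) = α ∧ βf (χ, τ, lam) = β ∧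
      ∀ᶠ q in 𝓝 (χ, τ, lam), IsQuartet q.1 q.2.1 q.2.2 (αf q) (βf q) := by
  have hre := hadm.re_lt h
  have hne : α ≠ β := fun e => hre.ne (congrArg Complex.re e)
  obtain ⟨h1, h2⟩ := h.dRsq_ne_zero hne
  obtain ⟨αf, hα, hα0, hα1⟩ := exists_analytic_root hadm.neg.ne h.1 h1
  obtain ⟨βf, hβ, hβ0, hβ1⟩ := exists_analytic_root hadm.neg.ne h.2.1 h2
  refine ⟨αf, βf, hα, hβ, hα0, hβ0, ?_⟩
  have c1 := hα.continuousAt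
  have c2 := hβ.continuousAt
  have e1 := (Complex.continuous_im.continuousAt.comp c1).eventually_const_lt
    (show (0 : ℝ) < (αf (χ, τ, lam)).im by rw [hα0]; exact h.2.2.1)
  have e2 := (Complex.continuous_im.continuousAt.comp c2).eventually_const_lt
    (show (0 : ℝ) < (βf (χ, τ, lam)).im by rw [hβ0]; exact h.2.2.2.1)
  have e3 := (Complex.continuous_re.continuousAt.comp c1).eventually_lt
    (Complex.continuous_re.continuousAt.comp c2)
    (show (αf (χ, τ, lam)).re < (βf (χ, τ, lam)).re by rwa [hα0, hβ0])
  filter_upwards [hα1, hβ1, e1, e2, e3] with q q1 q2 q3 q4 q5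
  exact ⟨q1, q2, q3, q4, q5.le, fun e => absurd e q5.ne⟩

/-! ### Analytic dependence of the integral on the parameters -/

/-! ### Analytic square roots in the algebra C(X, ℂ) -/

section ContinuousMap

variable {X : Type*} [TopologicalSpace X] [CompactSpace X]
  {E : Type*} [NormedAddCommGroup E] [NormedSpace ℝ E]

theorem hasFDerivAt_mul_self (S : C(X, ℂ)ˣ) (T : C(X, ℂ)ˣ) (hT : (T : C(X, ℂ)) = S + S) :
    HasFDerivAt (fun v : C(X, ℂ) => v * v) (mulUnitEquiv T : C(X, ℂ) →L[ℝ] C(X, ℂ))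
      (S : C(X, ℂ)) := by
  have h := (hasFDerivAt_id (𝕜 := ℝ) (S : C(X, ℂ))).mul (hasFDerivAt_id (𝕜 := ℝ) (S : C(X, ℂ)))
  refine h.congr_fderiv ?_
  ext x
  simp [mulUnitEquiv, hT]

/-- The pointwise principal square root of an analytic family of functions is analytic. -/
theorem exists_contDiffAt_sqrt {u : E → C(X, ℂ)} {q : E} (hu : ContDiffAt ℝ ω u q)
    (hslit : ∀ x, u q x ∈ slitPlane) :
    ∃ v : E → C(X, ℂ), ContDiffAt ℝ ω v q ∧ IsUnit (v q) ∧
      ∀ᶠ p in 𝓝 q, ∀ x, v p x = Complex.sqrt (u p x) := by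
  obtain ⟨S, hS⟩ : ∃ S : C(X, ℂ), ∀ x, S x = Complex.sqrt (u q x) :=
    ⟨⟨fun x => Complex.sqrt (u q x), continuous_iff_continuousAt.2 fun x =>
      ContinuousAt.comp (g := Complex.sqrt) (differentiableAt_sqrt (hslit x)).continuousAt
        (u q).continuous.continuousAt⟩, fun x => rfl⟩
  have hSu : S * S = u q := by
    ext x
    rw [ContinuousMap.mul_apply, hS, ← sq, sqrt_sq]
  have hunit : IsUnit S := by
    rw [ContinuousMap.isUnit_iff_forall_ne_zero]
    intro x
    rw [hS]
    exact sqrt_ne_zero (slitPlane_ne_zero (hslit x))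
  have hunit2 : IsUnit (S + S) := by
    rw [ContinuousMap.isUnit_iff_forall_ne_zero]
    intro x
    rw [ContinuousMap.add_apply, hS, ← two_mul]
    exact mul_ne_zero two_ne_zero (sqrt_ne_zero (slitPlane_ne_zero (hslit x)))
  obtain ⟨S', hS'⟩ := hunit
  obtain ⟨T, hT⟩ := hunit2
  -- Squaring has derivative multiplication by 2S at S, a unit, so it is locally invertible with
  -- analytic inverse.
  have hd := hasFDerivAt_mul_self S' T (by rw [hT, hS'])
  have hc : ContDiffAt ℝ ω (fun v : C(X, ℂ) => v * v) (S' : C(X, ℂ)) := by fun_prop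
  have hinv := hc.to_localInverse hd (by simp)
  have hSS : (S' : C(X, ℂ)) * S' = u q := by rw [hS', hSu]
  have happ := hc.localInverse_apply_image hd (by simp)
  have hright := (hc.hasStrictFDerivAt' hd (by simp)).eventually_right_inverse
  simp only [hSS] at hinv happ hright
  have hv : ContDiffAt ℝ ω (fun p => hc.localInverse hd (by simp) (u p)) q := hinv.comp q hu
  refine ⟨_, hv, ?_, ?_⟩
  · rw [happ]
    exact S'.isUnit
  -- Within uniform distance δ of S every value keeps positive real part, which identifies the local
  -- inverse with the principal root.
  obtain ⟨δ, hδ, hpos⟩ : ∃ δ > 0, ∀ x, δ ≤ (S x).re := by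
    rcases isEmpty_or_nonempty X with hX | hX
    · exact ⟨1, one_pos, fun x => (hX.false x).elim⟩
    obtain ⟨x0, -, hx0⟩ := isCompact_univ.exists_isMinOn Set.univ_nonempty
      (Complex.continuous_re.comp S.continuous).continuousOn
    exact ⟨(S x0).re, by rw [hS]; exact sqrt_re_pos (hslit x0), fun x => hx0 (Set.mem_univ x)⟩
  have hev : ∀ᶠ p in 𝓝 q, dist (hc.localInverse hd (by simp) (u p)) S' < δ := by
    have := hv.continuousAt.tendsto
    simp only [happ] at this
    exact this (Metric.ball_mem_nhds _ hδ)
  filter_upwards [hev, hu.continuousAt.tendsto.eventually hright] with p h1 h2 x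
  apply eq_sqrt_of_sq
  · have := congrArg (fun g : C(X, ℂ) => g x) h2
    rw [sq]
    exact this
  · have h3 := (ContinuousMap.dist_apply_le_dist (f := hc.localInverse hd (by simp) (u p))
      (g := (S' : C(X, ℂ))) x)
    have h4 := abs_le.1 ((Complex.abs_re_le_norm _).trans_eq
      (dist_eq_norm ((hc.localInverse hd (by simp) (u p)) x) ((S' : C(X, ℂ)) x)).symm)
    rw [sub_re] at h4
    have := hpos x
    rw [← hS'] at this
    linarith [h4.1]

end ContinuousMap

/-- Integration over an interval, as a continuous linear functional on continuous functions. -/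
def integralCLM {a b : ℝ} (h : a ≤ b) : C(Set.Icc a b, ℂ) →L[ℝ] ℂ :=
  LinearMap.mkContinuous
    { toFun := fun g => ∫ t in a..b, Set.IccExtend h g t
      map_add' := fun g k => by
        rw [← intervalIntegral.integral_add]
        · rfl
        · exact (g.continuous.Icc_extend' (h := h)).intervalIntegrable _ _
        · exact (k.continuous.Icc_extend' (h := h)).intervalIntegrable _ _
      map_smul' := fun c g => by
        rw [RingHom.id_apply, ← intervalIntegral.integral_smul]
        rfl }
    (b - a) fun g => by
      have := intervalIntegral.norm_integral_le_of_norm_le_const (a := a) (b := b)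
        (f := Set.IccExtend h g) (C := ‖g‖) fun t _ => g.norm_coe_le_norm _
      rwa [abs_of_nonneg (sub_nonneg.2 h), mul_comm] at this

theorem integralCLM_apply {a b : ℝ} (h : a ≤ b) (g : C(Set.Icc a b, ℂ)) (k : ℝ → ℂ)
    (hgk : ∀ x : Set.Icc a b, g x = k x) : integralCLM h g = ∫ t in a..b, k t := by
  refine intervalIntegral.integral_congr fun t ht => ?_
  rw [Set.uIcc_of_le h] at ht
  simp only [Set.IccExtend_of_mem h g ht]
  exact hgk ⟨t, ht⟩

theorem neg_pi_div_two_le : -(Real.pi / 2) ≤ Real.pi / 2 := by linarith [Real.pi_pos]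

/-- `i sin θ` as a continuous function on `[-π/2, π/2]`. -/
def sinMap : C(Set.Icc (-(Real.pi / 2)) (Real.pi / 2), ℂ) :=
  ⟨fun θ => I * Real.sin θ, by fun_prop⟩

/-- The integrand is built inside the Banach algebra of continuous functions of θ, so analyticity in
the parameters passes through the integral by composition with a continuous linear functional. -/
theorem exists_contDiffAt_vertical {E : Type*} [NormedAddCommGroup E] [NormedSpace ℝ E]
    {χ τ lam c a d b : E → ℝ} {q₀ : E} (hs : τ q₀ ^ 2 * lam q₀ - χ q₀ ≠ 0)
    (hχ : ContDiffAt ℝ ω χ q₀) (hτ : ContDiffAt ℝ ω τ q₀) (hlam : ContDiffAt ℝ ω lam q₀)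
    (hc : ContDiffAt ℝ ω c q₀) (ha : ContDiffAt ℝ ω a q₀) (hd : ContDiffAt ℝ ω d q₀)
    (hb : ContDiffAt ℝ ω b q₀) (hcd : c q₀ < d q₀) :
    ∃ G : E → C(Set.Icc (-(Real.pi / 2)) (Real.pi / 2), ℂ),
      ContDiffAt ℝ ω G q₀ ∧ ∀ᶠ q in 𝓝 q₀, ∀ θ,
        G q θ = vertical (χ q) (τ q) (lam q) (c q) (a q) (d q) (b q) θ := by
  set X : E → C(Set.Icc (-(Real.pi / 2)) (Real.pi / 2), ℂ) :=
    fun q => c q • 1 + a q • sinMap with hX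
  have hXc : ContDiffAt ℝ ω X q₀ := by fun_prop
  have hXa : ∀ q θ, X q θ = pt (c q) (a q) θ := by
    intro q θ
    simp [hX, sinMap, pt]
    ring
  set U : E → C(Set.Icc (-(Real.pi / 2)) (Real.pi / 2), ℂ) :=
    fun q => (X q - d q • 1) ^ 2 + (b q ^ 2) • 1 with hU
  have hUc : ContDiffAt ℝ ω U q₀ := by fun_prop
  have hUa : ∀ q θ, U q θ = quad (d q) (b q) (pt (c q) (a q) θ) := by
    intro q θ
    simp [hU, quad, hXa]
  set N : E → C(Set.Icc (-(Real.pi / 2)) (Real.pi / 2), ℂ) := fun q =>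
    (2 * τ q) • (X q ^ 3 + (τ q * lam q) • X q ^ 2
      + (3 / 4 * τ q ^ 2 * lam q ^ 2 - 1 / 2 * χ q * lam q) • X q
      + (16 * τ q / (τ q ^ 2 * lam q - χ q) ^ 3) • 1)
    - ((τ q ^ 2 * lam q - χ q) / 2) • ((4 : ℝ) • X q ^ 2 + (3 * (τ q * lam q)) • X q
      + (2 * (3 / 4 * τ q ^ 2 * lam q ^ 2 - 1 / 2 * χ q * lam q)) • 1) with hN
  have hNc : ContDiffAt ℝ ω N q₀ := by fun_prop (disch := simpa using hs)
  have hNa : ∀ q θ, N q θ = numer (χ q) (τ q) (lam q) (pt (c q) (a q) θ) := by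
    intro q θ
    simp [hN, numer, hXa]
    ring
  obtain ⟨S, hSc, hSu, hSa⟩ := exists_contDiffAt_sqrt hUc fun θ => by
    rw [hUa]
    exact quad_pt_mem hcd θ
  obtain ⟨S0, hS0⟩ := hSu
  have hinv : ContDiffAt ℝ ω (fun q => Ring.inverse (S q)) q₀ := by
    have := contDiffAt_ringInverse ℝ S0 (n := ω)
    rw [hS0] at this
    exact this.comp _ hSc
  have hSunit : ∀ᶠ q in 𝓝 q₀, IsUnit (S q) :=
    hSc.continuousAt.eventually (by rw [← hS0]; exact S0.nhds)
  refine ⟨_, hNc.mul hinv, ?_⟩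
  filter_upwards [hSa, hSunit] with q h1 h2 θ
  have h3 := congrArg (fun g : C(Set.Icc (-(Real.pi / 2)) (Real.pi / 2), ℂ) => g θ)
    (Ring.mul_inverse_cancel _ h2)
  have h4 : S q θ * Ring.inverse (S q) θ = 1 := h3
  rw [vertical_eq, ContinuousMap.mul_apply, hNa, ← hUa, ← h1, eq_div_iff (left_ne_zero_of_mul_eq_one h4),
    mul_assoc, mul_comm (Ring.inverse (S q) θ), h4, mul_one]

theorem Admissible.exists_contDiffAt {χ τ lam : ℝ} (h : Admissible χ τ lam) :
    ∃ αf βf : ℝ × ℝ × ℝ → ℂ, ∃ G : ℝ × ℝ × ℝ → C(Set.Icc (-(Real.pi / 2)) (Real.pi / 2), ℂ),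
      ContDiffAt ℝ ω αf (χ, τ, lam) ∧ ContDiffAt ℝ ω βf (χ, τ, lam) ∧
      ContDiffAt ℝ ω G (χ, τ, lam) ∧
      (∀ᶠ q in 𝓝 (χ, τ, lam), IsQuartet q.1 q.2.1 q.2.2 (αf q) (βf q)) ∧
      (∀ᶠ q in 𝓝 (χ, τ, lam), ∀ θ, G q θ
        = vertical q.1 q.2.1 q.2.2 (αf q).re (αf q).im (βf q).re (βf q).im θ) ∧
      ∀ᶠ q in 𝓝 (χ, τ, lam), f q.2.2 q.1 q.2.1 = integralCLM neg_pi_div_two_le (G q) - 2 := by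
  obtain ⟨α, β, hq⟩ := h.exists_isQuartet
  obtain ⟨αf, βf, hα, hβ, hα0, hβ0, hev⟩ := h.exists_analytic_quartet hq
  have hre : (αf (χ, τ, lam)).re < (βf (χ, τ, lam)).re := by
    rw [hα0, hβ0]
    exact h.re_lt hq
  have hR := fun (g : ℝ × ℝ × ℝ → ℂ) (hg : ContDiffAt ℝ ω g (χ, τ, lam)) =>
    (reCLM.contDiff (n := ω)).contDiffAt.comp _ hg
  have hI := fun (g : ℝ × ℝ × ℝ → ℂ) (hg : ContDiffAt ℝ ω g (χ, τ, lam)) =>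
    (imCLM.contDiff (n := ω)).contDiffAt.comp _ hg
  obtain ⟨G, hG, hGe⟩ := exists_contDiffAt_vertical (χ := fun q => q.1)
    (τ := fun q => q.2.1) (lam := fun q => q.2.2) h.neg.ne (by fun_prop) (by fun_prop)
    (by fun_prop) (hR αf hα) (hI αf hα) (hR βf hβ)
    (hI βf hβ) hre
  refine ⟨αf, βf, G, hα, hβ, hG, hev, hGe, ?_⟩
  filter_upwards [h.eventually, hev, hGe] with q h1 h2 h3
  rw [h1.f_eq h2, integralCLM_apply _ _ _ h3]
  rfl

theorem Admissible.contDiffAt_f {χ τ lam : ℝ} (h : Admissible χ τ lam) :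
    ContDiffAt ℝ ω (fun q : ℝ × ℝ × ℝ => f q.2.2 q.1 q.2.1) (χ, τ, lam) := by
  obtain ⟨αf, βf, G, -, -, hG, -, -, hf⟩ := h.exists_contDiffAt
  exact ((((integralCLM neg_pi_div_two_le).contDiff (n := ω)).contDiffAt.comp _ hG).sub
    (contDiffAt_const (c := (2 : ℂ)))).congr_of_eventuallyEq hf

/-! ### The derivative with respect to `λ` -/

/-- The derivative of f is the integral of `dvertical`, that is, κ < 0 times a number with positive
real part. -/
theorem Admissible.hasDerivAt_f {χ τ lam : ℝ} (h : Admissible χ τ lam) :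
    ∃ f' : ℂ, HasDerivAt (fun l => f l χ τ) f' lam ∧ f'.re < 0 := by
  obtain ⟨αf, βf, G, hα, hβ, hG, hq, hGe, hf⟩ := h.exists_contDiffAt
  have hline : HasDerivAt (fun l : ℝ => (χ, τ, l)) (0, 0, 1) lam :=
    (hasDerivAt_const lam χ).prodMk ((hasDerivAt_const lam τ).prodMk (hasDerivAt_id' lam))
  have htend := hline.continuousAt.tendsto
  have hqs := hq.self_of_nhds
  have hs := h.neg.ne
  have hre := h.re_lt hqs
  have hα' := (hα.differentiableAt (by simp)).hasFDerivAt.comp_hasDerivAt lam hline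
  have hβ' := (hβ.differentiableAt (by simp)).hasFDerivAt.comp_hasDerivAt lam hline
  have hG' := (hG.differentiableAt (by simp)).hasFDerivAt.comp_hasDerivAt lam hline
  have c1 := reCLM.hasFDerivAt.comp_hasDerivAt lam hα'
  have c2 := imCLM.hasFDerivAt.comp_hasDerivAt lam hα'
  have c3 := reCLM.hasFDerivAt.comp_hasDerivAt lam hβ'
  have c4 := imCLM.hasFDerivAt.comp_hasDerivAt lam hβ'
  have hsplit := isSplitDeriv_of_hasDerivAt hs
    ((htend.eventually hq).mono fun l hl => hl.isSplit) c1 c2 c3 c4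
  have hint := hsplit.integral_dvertical hs hqs.2.2.1.ne' hre
  refine ⟨integralCLM neg_pi_div_two_le (fderiv ℝ G (χ, τ, lam) (0, 0, 1)), ?_, ?_⟩
  · have := ((integralCLM neg_pi_div_two_le).hasFDerivAt.comp_hasDerivAt lam hG').sub_const 2
    exact this.congr_of_eventuallyEq (htend.eventually hf)
  · rw [integralCLM_apply _ _ _ fun θ => ?_, hint, re_ofReal_mul]
    · exact mul_neg_of_neg_of_pos (kappa_neg hs h.D2plus_pos h.D2minus_neg)
        (integral_inv_sqrt_re_pos hre)
    -- Evaluation at θ is continuous and linear, so the derivative of the function-valued map agrees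
    -- pointwise with `dvertical`.
    · have h1 := (ContinuousMap.evalCLM ℝ θ).hasFDerivAt.comp_hasDerivAt lam hG'
      have h2 := hasDerivAt_vertical_lam hs hqs.2.2.1.ne' hre c1 c2 c3 c4 θ
      exact h1.unique (h2.congr_of_eventuallyEq ((htend.eventually hGe).mono fun l hl => hl θ))

/-! ### Reality of `f` -/

theorem numer_conj (χ τ lam : ℝ) (z : ℂ) :
    numer χ τ lam (conj z) = conj (numer χ τ lam z) := by
  simp only [numer, map_sub, map_add, map_mul, map_div₀, map_pow, conj_ofReal, map_ofNat]

theorem sqrt_conj {z : ℂ} (hz : z ∈ slitPlane) :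
    Complex.sqrt (conj z) = conj (Complex.sqrt z) := by
  refine (eq_sqrt_of_sq ?_ ?_).symm
  · rw [← map_pow, sqrt_sq]
  · rw [conj_re]
    exact sqrt_re_pos hz

theorem vertical_neg (χ τ lam : ℝ) {c a d b : ℝ} (hcd : c < d) (θ : ℝ) :
    vertical χ τ lam c a d b (-θ) = conj (vertical χ τ lam c a d b θ) := by
  have h1 : pt c a (-θ) = conj (pt c a θ) := by
    simp [pt, -Complex.ofReal_sin]
  have h2 : quad d b (conj (pt c a θ)) = conj (quad d b (pt c a θ)) := by
    simp [quad]
  rw [vertical_eq, vertical_eq, map_div₀, h1, h2, sqrt_conj (quad_pt_mem hcd θ), numer_conj]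

/-- The substitution θ ↦ -θ conjugates the integrand. -/
theorem Admissible.f_im {χ τ lam : ℝ} (h : Admissible χ τ lam) : (f lam χ τ).im = 0 := by
  obtain ⟨α, β, hq⟩ := h.exists_isQuartet
  have e : conj (f lam χ τ) = f lam χ τ := by
    rw [h.f_eq hq, map_sub, map_ofNat]
    congr 1
    set v := vertical χ τ lam α.re α.im β.re β.im
    have h1 := intervalIntegral.integral_comp_neg (a := -(Real.pi / 2)) (b := Real.pi / 2) v
    rw [neg_neg] at h1
    have h2 : ∀ θ, v (-θ) = conj (v θ) := vertical_neg χ τ lam (h.re_lt hq)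
    simp only [h2] at h1
    rw [intervalIntegral.integral_of_le neg_pi_div_two_le,
      intervalIntegral.integral_of_le neg_pi_div_two_le, integral_conj] at h1
    rw [intervalIntegral.integral_of_le neg_pi_div_two_le, h1]
  exact conj_eq_iff_im.1 e

/-! ### Limits of quartets -/

/-- A bound on the roots by the coefficients, used to extract convergent subsequences. -/
theorem norm_le_of_Rsq_eq_zero {χ τ lam B : ℝ} {z : ℂ} (h : Rsq χ τ lam z = 0)
    (h3 : |τ * lam| ≤ B) (h2 : |3 / 4 * τ ^ 2 * lam ^ 2 - 1 / 2 * χ * lam| ≤ B)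
    (h1 : |16 * τ / (τ ^ 2 * lam - χ) ^ 3| ≤ B) (h0 : |4 / (τ ^ 2 * lam - χ) ^ 2| ≤ B) :
    ‖z‖ ≤ 1 + 4 * B := by
  have hB : 0 ≤ B := (abs_nonneg _).trans h3
  by_contra! hlt
  have hz1 : 1 ≤ ‖z‖ := by linarith
  rw [Rsq_eq_coeff] at h
  generalize τ * lam = q3 at *
  generalize 3 / 4 * τ ^ 2 * lam ^ 2 - 1 / 2 * χ * lam = q2 at *
  generalize 16 * τ / (τ ^ 2 * lam - χ) ^ 3 = q1 at *
  generalize 4 / (τ ^ 2 * lam - χ) ^ 2 = q0 at *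
  have e : z ^ 4 = -(q3 * z ^ 3 + q2 * z ^ 2 + q1 * z + q0) := by linear_combination h
  have hn : ‖z‖ ^ 4 ≤ B * ‖z‖ ^ 3 + B * ‖z‖ ^ 2 + B * ‖z‖ + B := by
    rw [← norm_pow, e, norm_neg]
    refine (norm_add_le _ _).trans (add_le_add ((norm_add_le _ _).trans (add_le_add
      ((norm_add_le _ _).trans (add_le_add ?_ ?_)) ?_)) ?_)
    · rw [norm_mul, norm_pow, norm_real]
      exact mul_le_mul_of_nonneg_right h3 (by positivity)
    · rw [norm_mul, norm_pow, norm_real]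
      exact mul_le_mul_of_nonneg_right h2 (by positivity)
    · rw [norm_mul, norm_real]
      exact mul_le_mul_of_nonneg_right h1 (by positivity)
    · rw [norm_real]
      exact h0
  have p1 : ‖z‖ ≤ ‖z‖ ^ 3 := le_self_pow₀ hz1 (by norm_num)
  have p2 : ‖z‖ ^ 2 ≤ ‖z‖ ^ 3 := pow_le_pow_right₀ hz1 (by norm_num)
  have p3 : 1 ≤ ‖z‖ ^ 3 := one_le_pow₀ hz1
  have h4 : ‖z‖ ^ 4 ≤ 4 * B * ‖z‖ ^ 3 := by nlinarith
  have h5 : 4 * B * ‖z‖ ^ 3 < ‖z‖ * ‖z‖ ^ 3 := mul_lt_mul_of_pos_right (by linarith) (by linarith)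
  linarith [show ‖z‖ * ‖z‖ ^ 3 = ‖z‖ ^ 4 by ring]

/-- A sequence of quartets has a subsequence converging to a possibly degenerate splitting. -/
theorem exists_limit_isSplit {χ τ lam : ℝ} (hs : τ ^ 2 * lam - χ ≠ 0) {l : ℕ → ℝ}
    (hl : Tendsto l atTop (𝓝 lam)) {α β : ℕ → ℂ} (hq : ∀ n, IsQuartet χ τ (l n) (α n) (β n)) :
    ∃ (α' β' : ℂ) (φ : ℕ → ℕ), StrictMono φ ∧ Tendsto (α ∘ φ) atTop (𝓝 α') ∧
      Tendsto (β ∘ φ) atTop (𝓝 β') ∧ IsSplit χ τ lam α'.re α'.im β'.re β'.im ∧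
      0 ≤ α'.im ∧ 0 ≤ β'.im ∧ α'.re ≤ β'.re := by
  have t3 : Tendsto (fun n => τ * l n) atTop (𝓝 (τ * lam)) := hl.const_mul τ
  have t2 : Tendsto (fun n => 3 / 4 * τ ^ 2 * l n ^ 2 - 1 / 2 * χ * l n) atTop
      (𝓝 (3 / 4 * τ ^ 2 * lam ^ 2 - 1 / 2 * χ * lam)) :=
    ((hl.pow 2).const_mul _).sub (hl.const_mul _)
  have ts : Tendsto (fun n => τ ^ 2 * l n - χ) atTop (𝓝 (τ ^ 2 * lam - χ)) :=
    (hl.const_mul _).sub_const χ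
  have t1 : Tendsto (fun n => 16 * τ / (τ ^ 2 * l n - χ) ^ 3) atTop
      (𝓝 (16 * τ / (τ ^ 2 * lam - χ) ^ 3)) := tendsto_const_nhds.div (ts.pow 3) (pow_ne_zero 3 hs)
  have t0 : Tendsto (fun n => 4 / (τ ^ 2 * l n - χ) ^ 2) atTop
      (𝓝 (4 / (τ ^ 2 * lam - χ) ^ 2)) := tendsto_const_nhds.div (ts.pow 2) (pow_ne_zero 2 hs)
  have hbdd : ∃ C, ∀ n, ‖(α n, β n)‖ ≤ C := by
    obtain ⟨B3, h3⟩ := t3.abs.bddAbove_range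
    obtain ⟨B2, h2⟩ := t2.abs.bddAbove_range
    obtain ⟨B1, h1⟩ := t1.abs.bddAbove_range
    obtain ⟨B0, h0⟩ := t0.abs.bddAbove_range
    refine ⟨1 + 4 * (max (max B3 B2) (max B1 B0)), fun n => ?_⟩
    have b3 := (h3 ⟨n, rfl⟩).trans ((le_max_left B3 B2).trans (le_max_left _ (max B1 B0)))
    have b2 := (h2 ⟨n, rfl⟩).trans ((le_max_right B3 B2).trans (le_max_left _ (max B1 B0)))
    have b1 := (h1 ⟨n, rfl⟩).trans ((le_max_left B1 B0).trans (le_max_right (max B3 B2) _))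
    have b0 := (h0 ⟨n, rfl⟩).trans ((le_max_right B1 B0).trans (le_max_right (max B3 B2) _))
    exact max_le (norm_le_of_Rsq_eq_zero (hq n).1 b3 b2 b1 b0)
      (norm_le_of_Rsq_eq_zero (hq n).2.1 b3 b2 b1 b0)
  obtain ⟨C, hC⟩ := hbdd
  obtain ⟨⟨α', β'⟩, -, φ, hφ, hlim⟩ := (isCompact_closedBall (0 : ℂ × ℂ) C).tendsto_subseq
    (x := fun n => (α n, β n)) fun n => by simpa using hC n
  have hφ' := hφ.tendsto_atTop
  have hα : Tendsto (α ∘ φ) atTop (𝓝 α') := (continuous_fst.tendsto _).comp hlim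
  have hβ : Tendsto (β ∘ φ) atTop (𝓝 β') := (continuous_snd.tendsto _).comp hlim
  have c1 : Tendsto (fun n => (α (φ n)).re) atTop (𝓝 α'.re) := (continuous_re.tendsto _).comp hα
  have c2 : Tendsto (fun n => (α (φ n)).im) atTop (𝓝 α'.im) := (continuous_im.tendsto _).comp hα
  have c3 : Tendsto (fun n => (β (φ n)).re) atTop (𝓝 β'.re) := (continuous_re.tendsto _).comp hβ
  have c4 : Tendsto (fun n => (β (φ n)).im) atTop (𝓝 β'.im) := (continuous_im.tendsto _).comp hβ
  refine ⟨α', β', φ, hφ, hα, hβ, ⟨?_, ?_, ?_, ?_⟩,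
    ge_of_tendsto' c2 fun n => (hq (φ n)).2.2.1.le,
    ge_of_tendsto' c4 fun n => (hq (φ n)).2.2.2.1.le,
    le_of_tendsto_of_tendsto' c1 c3 fun n => (hq (φ n)).2.2.2.2.1⟩
  · refine tendsto_nhds_unique (t3.comp hφ') (((c1.add c3).const_mul (-2)).congr fun n => ?_)
    exact (hq (φ n)).isSplit.coeff3.symm
  · refine tendsto_nhds_unique (t2.comp hφ') ((((((c1.pow 2).add (c2.pow 2)).add (c3.pow 2)).add
      (c4.pow 2)).add ((c1.const_mul 4).mul c3)).congr fun n => ?_)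
    exact (hq (φ n)).isSplit.coeff2.symm
  · refine tendsto_nhds_unique (t1.comp hφ') (((((c1.mul ((c3.pow 2).add (c4.pow 2))).add
      (c3.mul ((c1.pow 2).add (c2.pow 2))))).const_mul (-2)).congr fun n => ?_)
    exact (hq (φ n)).isSplit.coeff1.symm
  · refine tendsto_nhds_unique (t0.comp hφ') ((((c1.pow 2).add (c2.pow 2)).mul
      ((c3.pow 2).add (c4.pow 2))).congr fun n => ?_)
    exact (hq (φ n)).isSplit.coeff0.symm

/-! ### The upper endpoint -/

/-- Here c, a, d, b are independent variables subject only to c < d, so the limit may have a = 0 or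
b = 0. -/
theorem tendsto_integral_vertical {χ τ lam c a d b : ℝ} (hs : τ ^ 2 * lam - χ ≠ 0) (hcd : c < d) :
    Tendsto (fun q : ℝ × ℝ × ℝ × ℝ × ℝ => ∫ θ in (-(Real.pi / 2))..(Real.pi / 2),
        vertical χ τ q.1 q.2.1 q.2.2.1 q.2.2.2.1 q.2.2.2.2 θ) (𝓝 (lam, c, a, d, b))
      (𝓝 (∫ θ in (-(Real.pi / 2))..(Real.pi / 2), vertical χ τ lam c a d b θ)) := by
  obtain ⟨G, hG, hGe⟩ := exists_contDiffAt_vertical (E := ℝ × ℝ × ℝ × ℝ × ℝ)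
    (χ := fun _ => χ) (τ := fun _ => τ) (lam := fun q => q.1) (c := fun q => q.2.1)
    (a := fun q => q.2.2.1) (d := fun q => q.2.2.2.1) (b := fun q => q.2.2.2.2)
    (q₀ := (lam, c, a, d, b)) hs (by fun_prop) (by fun_prop) (by fun_prop) (by fun_prop)
    (by fun_prop) (by fun_prop) (by fun_prop) hcd
  have h := ((integralCLM neg_pi_div_two_le).continuous.tendsto _).comp hG.continuousAt
  rw [integralCLM_apply _ _ _ hGe.self_of_nhds] at h
  refine h.congr' ?_
  filter_upwards [hGe] with q hq
  exact integralCLM_apply _ _ _ hq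

/-- At a real double root both R² and (R²)' vanish, so c · `numer` is 0 there; and c ≠ 0 because the
constant coefficient is nonzero. -/
theorem IsSplit.numer_left_eq_zero {χ τ lam c d b : ℝ} (h : IsSplit χ τ lam c 0 d b)
    (hs : τ ^ 2 * lam - χ ≠ 0) : numer χ τ lam c = 0 := by
  have hc : (c : ℂ) ≠ 0 := by
    intro e
    have h0 := h.coeff0
    rw [ofReal_eq_zero.1 e] at h0
    simp [hs] at h0
  have h1 := mul_numer hs (c : ℂ)
  have h2 : quad c 0 c = 0 := by simp [quad]
  rw [h.dRsq_eq, h.Rsq_eq, h2, sub_self] at h1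
  simpa [hc] using h1

theorem IsSplit.numer_eq_mul {χ τ lam c a d : ℝ} (h : IsSplit χ τ lam c a d 0)
    (hs : τ ^ 2 * lam - χ ≠ 0) (z : ℂ) :
    numer χ τ lam z = (z - d) * (2 * τ * z ^ 2 + (-2 * τ * (d + 2 * c)
      - 2 * (τ ^ 2 * lam - χ) : ℝ) * z + (2 * τ * (c ^ 2 + a ^ 2 + 2 * c * d)
      + (τ ^ 2 * lam - χ) * (3 * c + d) : ℝ)) := by
  obtain ⟨h3, h2, h1, h0⟩ := h
  have hd : d ≠ 0 := by
    rintro rfl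
    simp [hs] at h0
  have h01 : 2 * τ * (4 / (τ ^ 2 * lam - χ) ^ 2)
      = (τ ^ 2 * lam - χ) / 2 * (16 * τ / (τ ^ 2 * lam - χ) ^ 3) := by
    field_simp
    ring
  rw [h0, h1] at h01
  have hrel : 2 * τ * (c ^ 2 + a ^ 2) * d + (τ ^ 2 * lam - χ) * (c * d + (c ^ 2 + a ^ 2)) = 0 := by
    apply mul_left_cancel₀ hd
    linear_combination h01
  have hrel' := congrArg (fun x : ℝ => (x : ℂ)) hrel
  rw [numer, h3, h2, h1]
  push_cast at hrel' ⊢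
  linear_combination -hrel'

/-- If a = 0 the segment degenerates to the double root c, where `numer` vanishes. If b = 0 the root
√`quad d b` = d - z divides `numer`, leaving a quadratic polynomial whose integral is elementary. -/
theorem IsSplit.integral_vertical_eq_zero {χ τ lam c a d b : ℝ} (h : IsSplit χ τ lam c a d b)
    (hs : τ ^ 2 * lam - χ ≠ 0) (hcd : c < d) (hab : a = 0 ∨ b = 0) :
    ∫ θ in (-(Real.pi / 2))..(Real.pi / 2), vertical χ τ lam c a d b θ = 0 := by
  rcases hab with rfl | rfl
  · have hv : vertical χ τ lam c 0 d b = 0 := by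
      funext θ
      have e : pt c 0 θ = c := by simp [pt]
      rw [vertical_eq, e, h.numer_left_eq_zero hs, zero_div, Pi.zero_apply]
    rw [hv]
    simp
  · obtain ⟨e1, he1⟩ : ∃ e1 : ℝ, e1 = -2 * τ * (d + 2 * c) - 2 * (τ ^ 2 * lam - χ) := ⟨_, rfl⟩
    -- For a quadratic P with leading coefficient 2τ, ∫ P(c + ia sin θ) dθ = π(P(c) - τa²). The
    -- condition P(c) = τa² comes from the two top coefficients of R², which encode the absence of a
    -- residue at infinity.
    have hsum : 2 * τ * c ^ 2 + e1 * c + (2 * τ * (c ^ 2 + a ^ 2 + 2 * c * d)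
      + (τ ^ 2 * lam - χ) * (3 * c + d)) = τ * a ^ 2 := by
      have h3 := h.coeff3
      have h2 := h.coeff2
      rw [he1]
      linear_combination (-τ) * h2 + (τ * (3 / 4 * (τ * lam) - (c + d) / 2)
        - χ / 2) * h3
    have hv : ∀ θ, vertical χ τ lam c a d 0 θ = -(τ * a ^ 2 * (Real.cos θ ^ 2 - Real.sin θ ^ 2)
        + (4 * τ * c + e1) * (I * a) * Real.sin θ) := by
      intro θ
      have hS : Complex.sqrt (quad d 0 (pt c a θ)) = d - pt c a θ := by
        refine (eq_sqrt_of_sq ?_ ?_).symm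
        · simp [quad]
          ring
        · rw [sub_re, pt_re, ofReal_re]
          linarith
      have hne : (d : ℂ) - pt c a θ ≠ 0 := hS ▸ sqrt_quad_ne_zero hcd θ
      have h1 : ((Real.sin θ : ℝ) : ℂ) ^ 2 + ((Real.cos θ : ℝ) : ℂ) ^ 2 = 1 := by
        exact_mod_cast Real.sin_sq_add_cos_sq θ
      have hsum' := congrArg (fun x : ℝ => (x : ℂ)) hsum
      rw [vertical_eq, hS, h.numer_eq_mul hs, div_eq_iff hne, ← he1, pt]
      push_cast at hsum' h1 ⊢
      linear_combination (c + I * (a * Complex.sin θ) - d) * (hsum' - τ * a ^ 2 * h1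
        + 2 * τ * a ^ 2 * Complex.sin θ ^ 2 * I_sq)
    have hder : ∀ θ ∈ Set.uIcc (-(Real.pi / 2)) (Real.pi / 2), HasDerivAt (fun θ : ℝ =>
        -(τ * a ^ 2 * (Real.sin θ * Real.cos θ : ℝ) - (4 * τ * c + e1) * (I * a) * Real.cos θ))
        (vertical χ τ lam c a d 0 θ) θ := by
      intro θ _
      have h1 := ((Real.hasDerivAt_sin θ).mul (Real.hasDerivAt_cos θ)).ofReal_comp
      have h2 := (Real.hasDerivAt_cos θ).ofReal_comp
      refine ((h1.const_mul (τ * a ^ 2 : ℂ)).sub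
        (h2.const_mul ((4 * τ * c + e1) * (I * a) : ℂ))).neg.congr_deriv ?_
      rw [hv]
      push_cast
      ring
    have hcont : Continuous (vertical χ τ lam c a d 0) := by
      simp only [funext hv]
      fun_prop
    rw [intervalIntegral.integral_eq_sub_of_hasDerivAt hder (hcont.intervalIntegrable _ _)]
    simp

theorem Admissible.of_mem {χ τ lam : ℝ} (hc : chiC τ < χ) (h1 : lambda1 χ τ < lam)
    (h2 : lam < lambdaMax χ τ) : Admissible χ τ lam :=
  (mem_R12_iff_admissible.1 (mem_R12_iff.2 ⟨hc, h1, h2⟩)).2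

/-- Along a sequence of λ increasing to the upper end, the limiting split has c < d and a real root,
so f → 0 - 2. -/
theorem exists_f_re_neg {χ τ : ℝ} (hc : chiC τ < χ) :
    ∃ lam, lambda1 χ τ < lam ∧ lam < lambdaMax χ τ ∧ (f lam χ τ).re < 0 := by
  obtain ⟨hs, ⟨x, hx⟩, hsplit⟩ := lambdaMax_spec hc
  obtain ⟨l, -, hlI, hlt⟩ := exists_seq_strictMono_tendsto' (lambda1_lt_lambdaMax hc)
  have hadm := fun n => Admissible.of_mem hc (hlI n).1 (hlI n).2
  choose α β hq using fun n => (hadm n).exists_isQuartet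
  obtain ⟨α', β', φ, hφ, hα, hβ, hsp, hα', hβ', hle⟩ := exists_limit_isSplit hs.ne hlt hq
  have hcd : α'.re < β'.re := by
    refine lt_of_le_of_ne hle fun e => ?_
    rw [← e] at hsp
    exact hsplit _ _ _ hsp
  have hab : α'.im = 0 ∨ β'.im = 0 := by
    have h1 : Rsq χ τ (lambdaMax χ τ) x = 0 := by
      rw [Rsq_ofReal, hx, ofReal_zero]
    rw [hsp.Rsq_eq] at h1
    have h2 : ((x - α'.re) ^ 2 + α'.im ^ 2) * ((x - β'.re) ^ 2 + β'.im ^ 2) = 0 := by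
      exact_mod_cast h1
    rcases mul_eq_zero.1 h2 with h | h
    · exact Or.inl (by nlinarith [sq_nonneg (x - α'.re), sq_nonneg α'.im])
    · exact Or.inr (by nlinarith [sq_nonneg (x - β'.re), sq_nonneg β'.im])
  have hpar : Tendsto (fun n => (l (φ n), (α (φ n)).re, (α (φ n)).im, (β (φ n)).re, (β (φ n)).im))
      atTop (𝓝 (lambdaMax χ τ, α'.re, α'.im, β'.re, β'.im)) :=
    (hlt.comp hφ.tendsto_atTop).prodMk_nhds (((continuous_re.tendsto _).comp hα).prodMk_nhds
      (((continuous_im.tendsto _).comp hα).prodMk_nhds (((continuous_re.tendsto _).comp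
        hβ).prodMk_nhds ((continuous_im.tendsto _).comp hβ))))
  have hlim := (tendsto_integral_vertical (a := α'.im) (b := β'.im) hs.ne hcd).comp hpar
  rw [hsp.integral_vertical_eq_zero hs.ne hcd hab] at hlim
  have hre := (continuous_re.tendsto _).comp (hlim.sub_const 2)
  obtain ⟨n, hn⟩ := (hre.eventually_lt_const (show ((0 : ℂ) - 2).re < 0 by simp)).exists
  refine ⟨l (φ n), (hlI _).1, (hlI _).2, ?_⟩
  rw [(hadm (φ n)).f_eq (hq (φ n))]
  exact hn

/-! ### The lower endpoint -/

theorem hPrime_conj {χ τ lam : ℝ} {α β : ℂ} (h : IsQuartet χ τ lam α β) (z : ℂ) :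
    hPrime χ τ lam (conj z) = conj (hPrime χ τ lam z) := by
  simp only [h.hPrime_eq, R_conj, map_mul, map_div₀, map_sub, map_pow, conj_ofReal, map_ofNat]

/-- Schwarz symmetry pairs the two segments. This form is used at the lower end, where d - c → 0 and
`tendsto_vertical`'s bound degenerates. -/
theorem IsQuartet.f_eq_im {χ τ lam : ℝ} {α β : ℂ} (h : IsQuartet χ τ lam α β) :
    f lam χ τ = (2 * (segmentIntegral (hPrime χ τ lam) (min α.re 0 - 1 : ℝ) α).im - 2 : ℝ) := by
  have hc : segmentIntegral (hPrime χ τ lam) (min α.re 0 - 1 : ℝ) (conj α)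
      = conj (segmentIntegral (hPrime χ τ lam) (min α.re 0 - 1 : ℝ) α) := by
    rw [segmentIntegral, segmentIntegral, intervalIntegral.integral_of_le zero_le_one,
      intervalIntegral.integral_of_le zero_le_one, ← integral_conj]
    refine integral_congr_ae (Eventually.of_forall fun t => ?_)
    simp only [map_mul, ← hPrime_conj h, map_add, map_sub, conj_ofReal]
  have h2 := Complex.sub_conj (segmentIntegral (hPrime χ τ lam) (min α.re 0 - 1 : ℝ) α)
  rw [f, periodIntegral, h.roots_eq, segmentIntegral_symm, hc]
  push_cast at h2 ⊢
  linear_combination (-I) * h2 - (2 * ((segmentIntegral (hPrime χ τ lam)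
    (((min α.re 0 : ℝ) : ℂ) - 1) α).im : ℂ) - 2) * I_sq

theorem tendsto_rootFactor {α β z : ℕ → ℂ} {ξ w : ℂ} (hα : Tendsto α atTop (𝓝 ξ))
    (hβ : Tendsto β atTop (𝓝 ξ)) (hz : Tendsto z atTop (𝓝 w)) (hw : w ≠ ξ) :
    Tendsto (fun n => rootFactor (α n) (β n) (z n)) atTop (𝓝 (w - ξ)) := by
  have hm : Tendsto (fun n => z n - (α n + β n) / 2) atTop (𝓝 (w - ξ)) := by
    have := hz.sub ((hα.add hβ).div_const 2)
    rwa [add_self_div_two] at this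
  have hr : Tendsto (fun n => 1 - ((β n - α n) / 2 / (z n - (α n + β n) / 2)) ^ 2) atTop
      (𝓝 1) := by
    have := ((((hβ.sub hα).div_const 2).div hm (sub_ne_zero.2 hw)).pow 2).const_sub 1
    simpa using this
  have hp := ((continuousAt_cpow_const (b := (1 : ℂ) / 2) one_mem_slitPlane).tendsto).comp hr
  rw [one_cpow] at hp
  have := hm.mul hp
  rwa [mul_one] at this

/-- Compactness of `K` makes the bound uniform in t; it supplies the dominating constant for the
next limit. -/
theorem exists_eventually_le {X : Type*} [TopologicalSpace X] {K : Set ℝ} (hK : IsCompact K)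
    {F : X × ℝ → ℝ} {x₀ : X} (hF : ∀ t ∈ K, ContinuousAt F (x₀, t)) :
    ∃ C, ∀ᶠ x in 𝓝 x₀, ∀ t ∈ K, F (x, t) ≤ C := by
  have hcont : ContinuousOn (fun t => F (x₀, t)) K := fun t ht =>
    ((hF t ht).comp (f := fun t => (x₀, t)) (by fun_prop)).continuousWithinAt
  obtain ⟨C, hC⟩ := hK.bddAbove_image hcont
  refine ⟨C + 1, hK.eventually_forall_of_forall_eventually fun t ht => ?_⟩
  have : F (x₀, t) < C + 1 := by linarith [hC ⟨t, ht, rfl⟩]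
  exact ((hF t ht).eventually_lt_const this).mono fun z hz => hz.le

/-- When α and β merge at ξ the cut shrinks to a point and R(z) → (z - ξ)(z - ξ*) off the limit. The
identity |R|² = |R²| gives a uniform bound up to the endpoint. -/
theorem tendsto_segmentIntegral {χ τ lam : ℝ} (hs : τ ^ 2 * lam - χ ≠ 0) {ξ : ℂ} (hξ : 0 < ξ.im)
    {l : ℕ → ℝ} (hl : Tendsto l atTop (𝓝 lam)) {α β : ℕ → ℂ} (hα : Tendsto α atTop (𝓝 ξ))
    (hβ : Tendsto β atTop (𝓝 ξ)) (hq : ∀ n, IsQuartet χ τ (l n) (α n) (β n))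
    (hre : ∀ n, (α n).re < (β n).re) {p : ℕ → ℝ} {P : ℝ} (hp : Tendsto p atTop (𝓝 P))
    (hp0 : ∀ n, p n < 0) (hpα : ∀ n, p n < (α n).re) (hP0 : P < 0) (hPξ : P < ξ.re) :
    Tendsto (fun n => segmentIntegral (hPrime χ τ (l n)) (p n) (α n)) atTop
      (𝓝 (segmentIntegral (fun z => (2 * τ * z - (τ ^ 2 * lam - χ : ℝ)) / z ^ 2
        * ((z - ξ) * (z - conj ξ))) P ξ)) := by
  have hz : ∀ t : ℝ, Tendsto (fun n => (p n + t * (α n - p n) : ℂ)) atTop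
      (𝓝 (P + t * (ξ - P))) := fun t => by
    have hp' := (continuous_ofReal.tendsto P).comp hp
    exact hp'.add ((hα.sub hp').const_mul _)
  obtain ⟨C, hC⟩ := exists_eventually_le (X := ℝ × ℝ × ℂ) (K := Set.Icc 0 1) isCompact_Icc
    (F := fun v => ‖(2 * τ * (v.1.2.1 + v.2 * (v.1.2.2 - v.1.2.1)) - (τ ^ 2 * v.1.1 - χ : ℝ))
      / (v.1.2.1 + v.2 * (v.1.2.2 - v.1.2.1) : ℂ) ^ 2 * (v.1.2.2 - v.1.2.1)‖
      * √‖Rsq χ τ v.1.1 (v.1.2.1 + v.2 * (v.1.2.2 - v.1.2.1))‖) (x₀ := (lam, P, ξ)) fun t _ => by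
    refine ContinuousAt.mul (ContinuousAt.norm (ContinuousAt.mul (ContinuousAt.div (by fun_prop)
      (by fun_prop) (pow_ne_zero 2 (line_ne_zero hP0 hξ.ne' t))) (by fun_prop))) ?_
    have hR := (contDiffAt_Rsq hs (P + t * (ξ - P))).continuousAt
    exact (hR.comp_of_eq (f := fun v : (ℝ × ℝ × ℂ) × ℝ =>
      ((χ, τ, v.1.1), (v.1.2.1 + v.2 * (v.1.2.2 - v.1.2.1) : ℂ))) (x := ((lam, P, ξ), t))
      (by fun_prop) rfl).norm.sqrt
  have hev := (hl.prodMk_nhds (hp.prodMk_nhds hα)).eventually hC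
  refine intervalIntegral.tendsto_integral_filter_of_dominated_convergence (fun _ => C) ?_ ?_ ?_ ?_
  · refine Eventually.of_forall fun n => ?_
    exact ((hq n).intervalIntegrable_hPrime (hre n) (hpα n) (hp0 n) rfl
      (hq n).2.2.1.ne').def'.aestronglyMeasurable
  · filter_upwards [hev] with n hn
    refine Eventually.of_forall fun t ht => ?_
    rw [Set.uIoc_of_le zero_le_one] at ht
    have hzre : (p n + t * (α n - p n) : ℂ).re ≤ (α n).re := by
      rw [line_re]
      nlinarith [ht.2, hpα n]
    rw [norm_mul, (hq n).norm_hPrime (hre n) hzre, mul_right_comm, ← norm_mul]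
    exact hn t ⟨ht.1.le, ht.2⟩
  · exact intervalIntegrable_const
  · have hae : ∀ᵐ t : ℝ, t ≠ 1 := by
      rw [ae_iff]
      simp
    filter_upwards [hae] with t ht1 ht
    rw [Set.uIoc_of_le zero_le_one] at ht
    have htlt : t < 1 := lt_of_le_of_ne ht.2 ht1
    have hlt : (P + t * (ξ - P) : ℂ).re < ξ.re := by
      rw [line_re]
      nlinarith
    have hne : (P + t * (ξ - P) : ℂ) ≠ ξ := fun e => hlt.ne (congrArg Complex.re e)
    have hne' : conj (P + t * (ξ - P) : ℂ) ≠ ξ := fun e =>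
      hlt.ne (by rw [← conj_re (P + t * (ξ - P) : ℂ), e])
    have r1 := tendsto_rootFactor hα hβ (hz t) hne
    have r2 := (continuous_conj.tendsto _).comp (tendsto_rootFactor hα hβ
      ((continuous_conj.tendsto _).comp (hz t)) hne')
    rw [map_sub, conj_conj] at r2
    have hp' := (continuous_ofReal.tendsto P).comp hp
    have hs' : Tendsto (fun n => ((τ ^ 2 * l n - χ : ℝ) : ℂ)) atTop
        (𝓝 ((τ ^ 2 * lam - χ : ℝ) : ℂ)) :=
      (continuous_ofReal.tendsto _).comp ((hl.const_mul _).sub_const χ)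
    have := ((((((hz t).const_mul (2 * τ : ℂ)).sub hs').div ((hz t).pow 2)
      (pow_ne_zero 2 (line_ne_zero hP0 hξ.ne' t))).mul (r1.mul r2))).mul (hα.sub hp')
    refine this.congr fun n => ?_
    rw [(hq n).hPrime_eq]
    rfl

theorem hasDerivAt_vartheta (χ τ : ℝ) {z : ℂ} (hz : z ≠ 0) :
    HasDerivAt (vartheta χ τ) (χ + 2 * τ * z + 2 / z ^ 2) z := by
  have h : DifferentiableAt ℂ (vartheta χ τ) z := by
    unfold vartheta
    fun_prop (disch := assumption)
  rw [← deriv_vartheta χ τ hz]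
  exact h.hasDerivAt

/-- At λ₁ the quartic is the square of the quadratic factor of z²ϑ'(z). -/
theorem Rsq_lower {χ τ r : ℝ} (hr : 0 < r) (h : 2 - 2 * τ ^ 2 * r ^ 3 = χ * r) (z : ℂ) :
    Rsq χ τ (-2 * r ^ 2) z = (z ^ 2 - τ * r ^ 2 * z + r) ^ 2 := by
  have hs : τ ^ 2 * (-2 * r ^ 2) - χ = -2 / r := by
    field_simp
    linarith
  have hχ : χ = (2 - 2 * τ ^ 2 * r ^ 3) / r := by
    field_simp
    linarith
  have e2 : 3 / 4 * τ ^ 2 * (-2 * r ^ 2) ^ 2 - 1 / 2 * χ * (-2 * r ^ 2)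
      = τ ^ 2 * r ^ 4 + 2 * r := by
    rw [hχ]
    field_simp
    ring
  have e1 : 16 * τ / (-2 / r) ^ 3 = -2 * τ * r ^ 3 := by
    field_simp
    ring
  have e0 : 4 / (-2 / r) ^ 2 = r ^ 2 := by
    field_simp
    ring
  rw [Rsq_eq_coeff, hs, e2, e1, e0]
  push_cast
  ring

theorem double_root_spec {τ r : ℝ} (hr : 0 < r) (h4 : τ ^ 2 * r ^ 3 < 4) {w : ℂ}
    (hw : w ^ 2 - τ * r ^ 2 * w + r = 0) (him : 0 ≤ w.im) :
    w.re = τ * r ^ 2 / 2 ∧ w.im = √(r * (1 - τ ^ 2 * r ^ 3 / 4)) := by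
  have h1 := congrArg Complex.im hw
  have h2 := congrArg Complex.re hw
  rw [← ofReal_pow, ← ofReal_mul] at h1 h2
  simp only [sq, add_im, sub_im, mul_im, ofReal_re, ofReal_im, zero_im, add_zero, zero_mul] at h1
  simp only [sq, add_re, sub_re, mul_re, ofReal_re, ofReal_im, zero_re, zero_mul, sub_zero] at h2
  have hne : w.im ≠ 0 := by
    intro e
    rw [e] at h2
    have h5 : (w.re - τ * r ^ 2 / 2) ^ 2 + r * (1 - τ ^ 2 * r ^ 3 / 4) = 0 := by
      linear_combination h2
    have h6 : 0 < r * (1 - τ ^ 2 * r ^ 3 / 4) := mul_pos hr (by linarith)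
    nlinarith [sq_nonneg (w.re - τ * r ^ 2 / 2)]
  have hc : w.re = τ * r ^ 2 / 2 := by
    apply mul_left_cancel₀ hne
    linear_combination h1 / 2
  refine ⟨hc, ?_⟩
  rw [eq_comm, Real.sqrt_eq_iff_mul_self_eq_of_pos (lt_of_le_of_ne him hne.symm)]
  rw [hc] at h2
  linear_combination -h2

/-- The limiting integrand is exactly ϑ', so ϑ is a primitive along the segment, which avoids 0. -/
theorem segmentIntegral_vartheta {χ τ r : ℝ} (hr : 0 < r) (h : 2 - 2 * τ ^ 2 * r ^ 3 = χ * r)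
    {ξ : ℂ} (hξ : ξ ^ 2 - τ * r ^ 2 * ξ + r = 0) (hξ' : 0 < ξ.im) (hre : ξ.re = τ * r ^ 2 / 2)
    {P : ℝ} (hP : P < 0) :
    segmentIntegral (fun z => (2 * τ * z - (τ ^ 2 * (-2 * r ^ 2) - χ : ℝ)) / z ^ 2
        * ((z - ξ) * (z - conj ξ))) P ξ = vartheta χ τ ξ - vartheta χ τ P := by
  have hs : τ ^ 2 * (-2 * r ^ 2) - χ = -2 / r := by
    field_simp
    linarith
  have hχ : χ = (2 - 2 * τ ^ 2 * r ^ 3) / r := by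
    field_simp
    linarith
  have hr' : (r : ℂ) ≠ 0 := by exact_mod_cast hr.ne'
  have hquad : ∀ z : ℂ, (z - ξ) * (z - conj ξ) = z ^ 2 - τ * r ^ 2 * z + r := by
    intro z
    have e1 := Complex.add_conj ξ
    rw [hre] at e1
    push_cast at e1
    linear_combination (ξ - z) * e1 - hξ
  have hint : ∀ z : ℂ, z ≠ 0 → (2 * τ * z - (τ ^ 2 * (-2 * r ^ 2) - χ : ℝ)) / z ^ 2
      * ((z - ξ) * (z - conj ξ)) = χ + 2 * τ * z + 2 / z ^ 2 := by
    intro z hz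
    rw [hquad, hs, hχ]
    push_cast
    field_simp
    ring
  have hne := line_ne_zero hP hξ'.ne'
  have hder : ∀ t ∈ Set.uIcc (0 : ℝ) 1, HasDerivAt
      (fun t : ℝ => vartheta χ τ (P + t * (ξ - P)))
      ((2 * τ * (P + t * (ξ - P)) - (τ ^ 2 * (-2 * r ^ 2) - χ : ℝ)) / (P + t * (ξ - P)) ^ 2
        * ((P + t * (ξ - P) - ξ) * (P + t * (ξ - P) - conj ξ)) * (ξ - P)) t := by
    intro t _
    rw [hint _ (hne t)]
    exact (hasDerivAt_vartheta χ τ (hne t)).comp t (hasDerivAt_line P ξ t)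
  have hcont : Continuous fun t : ℝ => (2 * τ * (P + t * (ξ - P)) - (τ ^ 2 * (-2 * r ^ 2) - χ : ℝ))
      / (P + t * (ξ - P) : ℂ) ^ 2 * ((P + t * (ξ - P) - ξ) * (P + t * (ξ - P) - conj ξ))
      * (ξ - P) :=
    ((Continuous.div (by fun_prop) (by fun_prop) fun t => pow_ne_zero 2 (hne t)).mul
      (by fun_prop)).mul continuous_const
  rw [segmentIntegral, intervalIntegral.integral_eq_sub_of_hasDerivAt hder
    (hcont.intervalIntegrable _ _)]
  simp

theorem vartheta_im {χ τ r : ℝ} (hr : 0 < r) (h : 2 - 2 * τ ^ 2 * r ^ 3 = χ * r)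
    {ξ : ℂ} (hre : ξ.re = τ * r ^ 2 / 2) (hn : normSq ξ = r) :
    (vartheta χ τ ξ).im = ξ.im * (4 / r) * (1 - τ ^ 2 * r ^ 3 / 4) := by
  have hχ : χ = (2 - 2 * τ ^ 2 * r ^ 3) / r := by
    field_simp
    linarith
  have : (vartheta χ τ ξ).im = χ * ξ.im + τ * (2 * ξ.re * ξ.im) + 2 * (ξ.im / normSq ξ) := by
    simp only [vartheta, sub_im, add_im, mul_im, ofReal_re, ofReal_im, sq, inv_im, re_ofNat,
      im_ofNat]
    ring
  rw [this, hn, hre, hχ]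
  field_simp
  ring

/-- The limit of f at λ₁ is 2(Im ϑ(ξ) - 1). The base point is real, so ϑ there contributes no
imaginary part. -/
theorem exists_f_re_pos {χ τ : ℝ} (hc : chiC τ < χ) :
    ∃ lam, lambda1 χ τ < lam ∧ lam < lambdaMax χ τ ∧ 0 < (f lam χ τ).re := by
  obtain ⟨r, hr, hpar, h4, hlt⟩ := exists_lower_param hc
  have hlam := lambda1_eq hr hpar h4
  obtain ⟨l, -, hlI, hltend⟩ := exists_seq_strictAnti_tendsto' (lambda1_lt_lambdaMax hc)
  have hadm := fun n => Admissible.of_mem hc (hlI n).1 (hlI n).2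
  choose α β hq using fun n => (hadm n).exists_isQuartet
  have hs : τ ^ 2 * (-2 * r ^ 2) - χ ≠ 0 := by
    have : τ ^ 2 * (-2 * r ^ 2) - χ = -2 / r := by
      field_simp
      linarith
    rw [this]
    exact div_ne_zero (by norm_num) hr.ne'
  rw [hlam] at hltend
  obtain ⟨ξ, β', φ, hφ, hα, hβ, hsp, hα', hβ', -⟩ := exists_limit_isSplit hs hltend hq
  have hroot : ∀ w : ℂ, Rsq χ τ (-2 * r ^ 2) w = 0 → w ^ 2 - τ * r ^ 2 * w + r = 0 := by
    intro w hw
    rw [Rsq_lower hr hpar] at hw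
    exact pow_eq_zero_iff two_ne_zero |>.1 hw
  have hquad : ∀ γ : ℂ, (γ - γ.re) ^ 2 + (γ.im : ℂ) ^ 2 = 0 := by
    intro γ
    rw [quadratic_eq_mul, sub_self, zero_mul]
  have hξ := hroot ξ (by rw [hsp.Rsq_eq, hquad, zero_mul])
  obtain ⟨ξre, ξim⟩ := double_root_spec hr h4 hξ hα'
  obtain ⟨βre, βim⟩ := double_root_spec hr h4
    (hroot β' (by rw [hsp.Rsq_eq, hquad, mul_zero])) hβ'
  -- The quadratic has a single root with nonnegative imaginary part, so both sequences have the
  -- same limit.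
  have hβξ : β' = ξ := Complex.ext (βre.trans ξre.symm) (βim.trans ξim.symm)
  rw [hβξ] at hβ
  have hk : 0 < 1 - τ ^ 2 * r ^ 3 / 4 := by linarith
  have ξpos : 0 < ξ.im := by
    rw [ξim]
    positivity
  have hsq : ξ.im ^ 2 = r * (1 - τ ^ 2 * r ^ 3 / 4) := by
    rw [ξim, Real.sq_sqrt (by positivity)]
  have hnorm : normSq ξ = r := by
    rw [normSq_apply, ξre]
    linear_combination hsq
  have hP : Tendsto (fun n => min (α (φ n)).re 0 - 1) atTop (𝓝 (min ξ.re 0 - 1)) :=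
    (((continuous_re.tendsto _).comp hα).min tendsto_const_nhds).sub_const 1
  have hneg : ∀ x : ℝ, min x 0 - 1 < 0 := fun x => by linarith [min_le_right x 0]
  have hlt' : ∀ x : ℝ, min x 0 - 1 < x := fun x => by linarith [min_le_left x 0]
  have hlim := tendsto_segmentIntegral hs ξpos (hltend.comp hφ.tendsto_atTop) hα hβ
    (fun n => hq (φ n)) (fun n => (hadm (φ n)).re_lt (hq (φ n))) hP (fun n => hneg _)
    (fun n => hlt' _) (hneg _) (hlt' _)
  rw [segmentIntegral_vartheta hr hpar hξ ξpos ξre (hneg _)] at hlim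
  have him := (continuous_im.tendsto _).comp hlim
  have hreal : (vartheta χ τ (min ξ.re 0 - 1 : ℝ)).im = 0 := by
    have : vartheta χ τ (min ξ.re 0 - 1 : ℝ) = (χ * (min ξ.re 0 - 1) + τ * (min ξ.re 0 - 1) ^ 2
        - 2 * (min ξ.re 0 - 1)⁻¹ : ℝ) := by
      rw [vartheta]
      push_cast
      ring
    rw [this, ofReal_im]
  rw [sub_im, hreal, sub_zero, vartheta_im hr hpar ξre hnorm] at him
  -- (Im ϑ(ξ))² = 16(1 - τ²r³/4)³ / r, so the last inequality of `exists_lower_param` is what is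
  -- needed.
  have hgt : 1 < ξ.im * (4 / r) * (1 - τ ^ 2 * r ^ 3 / 4) := by
    rw [← one_lt_sq_iff₀ (by positivity)]
    have : (ξ.im * (4 / r) * (1 - τ ^ 2 * r ^ 3 / 4)) ^ 2
        = 16 * (1 - τ ^ 2 * r ^ 3 / 4) ^ 3 / r := by
      rw [mul_pow, mul_pow, hsq]
      field_simp
      ring
    rw [this, one_lt_div hr]
    exact hlt
  obtain ⟨n, hn⟩ := (him.eventually_const_lt hgt).exists
  refine ⟨l (φ n), (hlI _).1, (hlI _).2, ?_⟩
  rw [(hq (φ n)).f_eq_im, ofReal_re]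
  simp only [Function.comp_apply] at hn
  linarith

/-! ### The zero of `f` and its analyticity -/

theorem Admissible.hasDerivAt_f_re {χ τ lam : ℝ} (h : Admissible χ τ lam) :
    ∃ f' < 0, HasDerivAt (fun l => (f l χ τ).re) f' lam := by
  obtain ⟨f', hf, hneg⟩ := h.hasDerivAt_f
  exact ⟨f'.re, hneg, reCLM.hasFDerivAt.comp_hasDerivAt lam hf⟩

theorem strictAntiOn_f_re {χ τ : ℝ} (hc : chiC τ < χ) :
    StrictAntiOn (fun l => (f l χ τ).re) (Set.Ioo (lambda1 χ τ) (lambdaMax χ τ)) := by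
  refine strictAntiOn_of_deriv_neg (convex_Ioo _ _) (fun l hl => ?_) fun l hl => ?_
  · obtain ⟨f', -, h⟩ := (Admissible.of_mem hc hl.1 hl.2).hasDerivAt_f_re
    exact h.continuousAt.continuousWithinAt
  · rw [interior_Ioo] at hl
    obtain ⟨f', hneg, h⟩ := (Admissible.of_mem hc hl.1 hl.2).hasDerivAt_f_re
    rwa [h.deriv]

theorem existsUnique_f_eq_zero {χ τ : ℝ} (hc : chiC τ < χ) :
    ∃! lam, (χ, τ, lam) ∈ R12 ∧ f lam χ τ = 0 := by
  have hanti := strictAntiOn_f_re hc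
  obtain ⟨l₁, h1, h1', hpos⟩ := exists_f_re_pos hc
  obtain ⟨l₂, h2, h2', hneg⟩ := exists_f_re_neg hc
  have hlt : l₁ < l₂ := (hanti.lt_iff_gt ⟨h2, h2'⟩ ⟨h1, h1'⟩).1 (hneg.trans hpos)
  have hcont : ContinuousOn (fun l => (f l χ τ).re) (Set.Icc l₁ l₂) := fun l hl => by
    obtain ⟨f', -, h⟩ := (Admissible.of_mem hc (h1.trans_le hl.1)
      (hl.2.trans_lt h2')).hasDerivAt_f_re
    exact h.continuousAt.continuousWithinAt
  obtain ⟨lam, hl, hzero⟩ := intermediate_value_Icc' hlt.le hcont ⟨hneg.le, hpos.le⟩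
  have hmem : lam ∈ Set.Ioo (lambda1 χ τ) (lambdaMax χ τ) :=
    ⟨h1.trans_le hl.1, hl.2.trans_lt h2'⟩
  refine ⟨lam, ⟨mem_R12_iff.2 ⟨hc, hmem.1, hmem.2⟩, Complex.ext hzero
    (Admissible.of_mem hc hmem.1 hmem.2).f_im⟩, ?_⟩
  rintro l ⟨hl, hl0⟩
  obtain ⟨-, hl1, hl2⟩ := mem_R12_iff.1 hl
  refine hanti.injOn ⟨hl1, hl2⟩ hmem ?_
  simp only [hl0, zero_re]
  exact hzero.symm

/-- The implicit function theorem is applied to Re f, whose λ-derivative is nonzero; as f is real at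
admissible parameters, a zero of Re f is a zero of f. -/
theorem exists_contDiffAt_zero {χ τ lam : ℝ} (h : Admissible χ τ lam) (hf : f lam χ τ = 0) :
    ∃ φ : ℝ × ℝ → ℝ, ContDiffAt ℝ ω φ (χ, τ) ∧
      ∀ᶠ p in 𝓝 (χ, τ), Admissible p.1 p.2 (φ p) ∧ f (φ p) p.1 p.2 = 0 := by
  have hF : ContDiffAt ℝ ω (fun v : (ℝ × ℝ) × ℝ => (f v.2 v.1.1 v.1.2).re) ((χ, τ), lam) := by
    have h1 : ContDiffAt ℝ ω (fun v : (ℝ × ℝ) × ℝ => (v.1.1, v.1.2, v.2)) ((χ, τ), lam) := by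
      fun_prop
    exact reCLM.contDiff.contDiffAt.comp _
      (ContDiffAt.comp (g := fun q : ℝ × ℝ × ℝ => f q.2.2 q.1 q.2.1) ((χ, τ), lam)
        h.contDiffAt_f h1)
  have hinv : (fderiv ℝ (fun v : (ℝ × ℝ) × ℝ => (f v.2 v.1.1 v.1.2).re) ((χ, τ), lam)
      ∘L .inr ℝ (ℝ × ℝ) ℝ).IsInvertible := by
    obtain ⟨f', hneg, hf'⟩ := h.hasDerivAt_f_re
    refine ⟨mulUnitEquiv (Units.mk0 f' hneg.ne), ?_⟩
    have h1 := (hF.differentiableAt (by simp)).hasFDerivAt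
    have h2 := h1.comp lam (hasFDerivAt_prodMk_right (𝕜 := ℝ) (χ, τ) lam)
    rw [← hf'.hasFDerivAt.unique h2]
    ext
    simp [mulUnitEquiv]
  have h0 := hF.implicitFunction_apply_self (by simp) hinv
  have hφ := hF.contDiffAt_implicitFunction (by simp) hinv
  have hcont : ContinuousAt (fun p : ℝ × ℝ =>
      (p.1, p.2, hF.implicitFunction (by simp) hinv p)) (χ, τ) :=
    continuousAt_fst.prodMk (continuousAt_snd.prodMk hφ.continuousAt)
  have hadm := hcont.tendsto.eventually (by simp only [h0]; exact h.eventually)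
  refine ⟨_, hφ, ?_⟩
  filter_upwards [hadm, hF.eventually_apply_implicitFunction (by simp) hinv] with p h1 h2
  exact ⟨h1, Complex.ext (h2.trans (by rw [hf])) h1.f_im⟩

end SpectralCurve

end

/-! ### The proposition -/

theorem proposition2p4 :
    (∀ χ τ lam : ℝ, (χ, τ, lam) ∈ SpectralCurve.R12 →
      ∃ α β : ℂ, SpectralCurve.IsQuartet χ τ lam α β) ∧
    ∃ L : ℝ × ℝ → ℝ,
      AnalyticOnNhd ℝ L {p : ℝ × ℝ | SpectralCurve.chiC p.2 < p.1} ∧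
      ∀ χ τ : ℝ, SpectralCurve.chiC τ < χ →
        ((χ, τ, L (χ, τ)) ∈ SpectralCurve.R12 ∧ SpectralCurve.f (L (χ, τ)) χ τ = 0) ∧
        ∀ lam : ℝ, (χ, τ, lam) ∈ SpectralCurve.R12 → SpectralCurve.f lam χ τ = 0 →
          lam = L (χ, τ) := by
  refine ⟨fun χ τ lam h => (SpectralCurve.mem_R12_iff_admissible.1 h).2.exists_isQuartet, ?_⟩
  have hex : ∀ p : ℝ × ℝ, ∃ lam, SpectralCurve.chiC p.2 < p.1 →
      ((p.1, p.2, lam) ∈ SpectralCurve.R12 ∧ SpectralCurve.f lam p.1 p.2 = 0) ∧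
      ∀ l, (p.1, p.2, l) ∈ SpectralCurve.R12 → SpectralCurve.f l p.1 p.2 = 0 → l = lam := by
    intro p
    by_cases hc : SpectralCurve.chiC p.2 < p.1
    · obtain ⟨lam, h1, h2⟩ := SpectralCurve.existsUnique_f_eq_zero hc
      exact ⟨lam, fun _ => ⟨h1, fun l hl hl' => h2 l ⟨hl, hl'⟩⟩⟩
    · exact ⟨0, fun h => absurd h hc⟩
  choose L hL using hex
  refine ⟨L, ?_, fun χ τ hc => hL (χ, τ) hc⟩
  rintro ⟨χ, τ⟩ hc
  obtain ⟨⟨hmem, hzero⟩, -⟩ := hL (χ, τ) hc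
  obtain ⟨φ, hφ, hev⟩ := SpectralCurve.exists_contDiffAt_zero
    (SpectralCurve.mem_R12_iff_admissible.1 hmem).2 hzero
  -- Near (χ, τ) the implicit function takes values in R₁₂, so uniqueness of the zero identifies it
  -- with `L`, which was chosen pointwise.
  have heq : L =ᶠ[nhds (χ, τ)] φ := by
    filter_upwards [hev, SpectralCurve.isOpen_chiC_lt.mem_nhds hc] with p hp hpc
    exact ((hL p hpc).2 _ (SpectralCurve.mem_R12_iff_admissible.2 ⟨hpc, hp.1⟩) hp.2).symm
  exact (hφ.congr_of_eventuallyEq heq).analyticAt
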